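/- Let $L^2(S^1)=H_+\oplus H_-$, where $H_+$ is the closed span of $e^{in\theta}$, $n\ge 0$, and $H_-=H_+^\perp$; let $P_\pm$ be the orthogonal projections and $F=P_+-P_-$. Let $\mathcal M^1$ be the algebra of bounded operators $a$ on $L^2(S^1)$ such that $Fa-aF$ is Hilbert–Schmidt. Let $\mathcal B=\mathcal B(H_+)$, let $\mathcal L^1\subset\mathcal B$ be the ideal of trace class operators, and let $\mathcal E$ be the algebra of pairs $(a,x)\in\mathcal M^1\times\mathcal B$ such that $P_+aP_+-x\in\mathcal L^1$, with projections $p_1\colon\mathcal E\to\mathcal M^1$ and $p_2\colon\mathcal E\to\mathcal B$. Write $GL=\varinjlim_n GL_n$, let $\mathfrak T=\ker GL(p_1)$, and let $\mathfrak T_1\subset\mathfrak T$ be the normal subgroup of $GL(\mathcal E)$ consisting of those $g\in\mathfrak T$ for which the Fredholm determinant of $GL(p_2)(g)$ is $1$. The determinant identifies $\mathfrak T/\mathfrak T_1$ with a central subgroup $\mathbf C^\times$ of $GL(\mathcal E)/\mathfrak T_1$. For a ring $A$ let $K_2(A)$ be the kernel of the canonical map $\pi\colon \mathrm{St}(A)\to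 GL(A)$ from the Steinberg group, and, for commuting units $a,b$ of $A$, let $\{a,b\}\in K_2(A)$ be the commutator $xyx^{-1}y^{-1}$ of preimages $x,y\in\mathrm{St}(A)$ of $\mathrm{diag}(a,a^{-1},1)$ and $\mathrm{diag}(b,1,b^{-1})$. Then there is exactly one homomorphism $\mathrm{ck}\colon K_2(\mathcal M^1)\to\mathbf C^\times$ (the Connes–Karoubi character) that is the restriction to $K_2(\mathcal M^1)$ of a homomorphism $\mathrm{St}(\mathcal M^1)\to GL(\mathcal E)/\mathfrak T_1$ lying over $\pi$. Let $\mu\colon C^\infty(S^1)\to\mathcal M^1$ send $q$ to the operator of multiplication by $q$, and let $R=\mathrm{ck}\circ K_2(\mu)\colon K_2(C^\infty(S^1))\to\mathbf C^\times$. For all nowhere vanishing $p,q\in C^\infty(S^1)$ there exist continuous branches of $\theta\mapsto\log p(e^{i\theta})$ and $\theta\mapsto\log q(e^{i\theta})$ on $[0,2\pi]$, and for every choice of such branches $$R\{p,q\}=\exp\left\{\frac{1}{2\pi i}\left(\int_{S^1}\log p\;d\log q-\log q(1)\int_{S^1}d\log p\right)\right\},$$ where the integrals run over $0\le\theta\le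 2\pi$ and $\log q(1)$ denotes the value of the branch of $\log q$ at $\theta=0$. -/

import Mathlib

open scoped commutatorElement InnerProductSpace

noncomputable section

set_option linter.unusedSectionVars false

namespace ConnesKaroubi

universe u

section OperatorIdeals

variable {E F G K : Type u}
  [NormedAddCommGroup E] [InnerProductSpace ℂ E] [CompleteSpace E]
  [NormedAddCommGroup F] [InnerProductSpace ℂ F] [CompleteSpace F]
  [NormedAddCommGroup G] [InnerProductSpace ℂ G] [CompleteSpace G]
  [NormedAddCommGroup K] [InnerProductSpace ℂ K] [CompleteSpace K]

/-- Hilbert–Schmidt operators: `∑ ‖T bᵢ‖² < ∞` for some orthonormal basis `b`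
(equivalently, for every orthonormal basis, see `IsHilbertSchmidt.summable`). -/
def IsHilbertSchmidt (T : E →L[ℂ] F) : Prop :=
  ∃ (ι : Type u) (b : HilbertBasis ι ℂ E), Summable fun i => ‖T (b i)‖ ^ 2

/-- Trace class operators, in the form of nuclear operators: `T = ∑ᵢ ⟪vᵢ, ·⟫ uᵢ` with
`∑ᵢ ‖vᵢ‖ ‖uᵢ‖ < ∞`. -/
def IsTraceClass (T : E →L[ℂ] F) : Prop :=
  ∃ (ι : Type u) (v : ι → E) (w : ι → F), (Summable fun i => ‖v i‖ * ‖w i‖) ∧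
    ∀ x, HasSum (fun i => ⟪v i, x⟫_ℂ • w i) (T x)

theorem hasSum_norm_inner_sq {ι : Type*} (b : HilbertBasis ι ℂ E) (x : E) :
    HasSum (fun i => ‖⟪b i, x⟫_ℂ‖ ^ 2) (‖x‖ ^ 2) := by
  have h := b.hasSum_inner_mul_inner x x
  rw [inner_self_eq_norm_sq_to_K] at h
  have e : ∀ i, ⟪x, b i⟫_ℂ * ⟪b i, x⟫_ℂ = ((‖⟪b i, x⟫_ℂ‖ ^ 2 : ℝ) : ℂ) := fun i => by
    rw [← inner_conj_symm x (b i), mul_comm, Complex.mul_conj, Complex.normSq_eq_norm_sq]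
  simp only [e] at h
  have h' : HasSum (fun i => ((‖⟪b i, x⟫_ℂ‖ ^ 2 : ℝ) : ℂ)) ((‖x‖ ^ 2 : ℝ) : ℂ) := by
    rw [Complex.ofReal_pow]
    exact h
  exact Complex.hasSum_ofReal.1 h'

theorem summable_matrix_iff {ι κ : Type*} (b : HilbertBasis ι ℂ E) (c : HilbertBasis κ ℂ F)
    (T : E →L[ℂ] F) :
    (Summable fun p : ι × κ => ‖⟪c p.2, T (b p.1)⟫_ℂ‖ ^ 2) ↔ Summable fun i => ‖T (b i)‖ ^ 2 := by
  rw [summable_prod_of_nonneg (fun p => by positivity)]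
  have h : ∀ i, ∑' j, ‖⟪c j, T (b i)⟫_ℂ‖ ^ 2 = ‖T (b i)‖ ^ 2 := fun i =>
    (hasSum_norm_inner_sq c _).tsum_eq
  simp only [h]
  exact ⟨fun h => h.2, fun h' => ⟨fun i => (hasSum_norm_inner_sq c _).summable, h'⟩⟩

theorem summable_adjoint_iff {ι κ : Type*} (b : HilbertBasis ι ℂ E) (c : HilbertBasis κ ℂ F)
    (T : E →L[ℂ] F) : (Summable fun j => ‖T.adjoint (c j)‖ ^ 2) ↔
      Summable fun i => ‖T (b i)‖ ^ 2 := by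
  rw [← summable_matrix_iff b c, ← summable_matrix_iff c b,
    ← (Equiv.prodComm ι κ).summable_iff]
  refine summable_congr fun p => ?_
  simp only [Function.comp, Equiv.prodComm_apply, Prod.fst_swap, Prod.snd_swap]
  rw [ContinuousLinearMap.adjoint_inner_right, norm_inner_symm]

theorem IsHilbertSchmidt.summable {T : E →L[ℂ] F} (hT : IsHilbertSchmidt T) {ι : Type*}
    (b : HilbertBasis ι ℂ E) : Summable fun i => ‖T (b i)‖ ^ 2 := by
  obtain ⟨ι', b', hb'⟩ := hT
  obtain ⟨κ, c, -⟩ := exists_hilbertBasis ℂ F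
  rw [← summable_adjoint_iff b c, summable_adjoint_iff b' c]
  exact hb'

theorem isHilbertSchmidt_of_summable {ι : Type*} (b : HilbertBasis ι ℂ E) {T : E →L[ℂ] F}
    (h : Summable fun i => ‖T (b i)‖ ^ 2) : IsHilbertSchmidt T := by
  obtain ⟨w, b', -⟩ := exists_hilbertBasis ℂ E
  obtain ⟨κ, c, -⟩ := exists_hilbertBasis ℂ F
  exact ⟨w, b', by rwa [← summable_adjoint_iff b' c, summable_adjoint_iff b c]⟩

theorem IsHilbertSchmidt.adjoint {T : E →L[ℂ] F} (hT : IsHilbertSchmidt T) :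
    IsHilbertSchmidt T.adjoint := by
  obtain ⟨w, b, -⟩ := exists_hilbertBasis ℂ E
  obtain ⟨κ, c, -⟩ := exists_hilbertBasis ℂ F
  exact isHilbertSchmidt_of_summable c ((summable_adjoint_iff b c T).2 (hT.summable b))

theorem isHilbertSchmidt_zero : IsHilbertSchmidt (0 : E →L[ℂ] F) := by
  obtain ⟨w, b, -⟩ := exists_hilbertBasis ℂ E
  exact ⟨w, b, by simp⟩

theorem IsHilbertSchmidt.add {S T : E →L[ℂ] F} (hS : IsHilbertSchmidt S)
    (hT : IsHilbertSchmidt T) : IsHilbertSchmidt (S + T) := by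
  obtain ⟨w, b, -⟩ := exists_hilbertBasis ℂ E
  refine ⟨w, b, Summable.of_nonneg_of_le (fun i => by positivity) (fun i => ?_)
    (((hS.summable b).add (hT.summable b)).mul_left 2)⟩
  have h := norm_add_le (S (b i)) (T (b i))
  have h0 := norm_nonneg (S (b i) + T (b i))
  rw [add_apply]
  nlinarith [sq_nonneg (‖S (b i)‖ - ‖T (b i)‖), norm_nonneg (S (b i)), norm_nonneg (T (b i))]

theorem IsHilbertSchmidt.comp_left {T : E →L[ℂ] F} (hT : IsHilbertSchmidt T) (S : F →L[ℂ] G) :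
    IsHilbertSchmidt (S ∘L T) := by
  obtain ⟨w, b, -⟩ := exists_hilbertBasis ℂ E
  refine ⟨w, b, Summable.of_nonneg_of_le (fun i => by positivity) (fun i => ?_)
    ((hT.summable b).mul_left (‖S‖ ^ 2))⟩
  rw [← mul_pow]
  exact pow_le_pow_left₀ (norm_nonneg _) (S.le_opNorm _) 2

theorem IsHilbertSchmidt.comp_right {T : F →L[ℂ] G} (hT : IsHilbertSchmidt T) (S : E →L[ℂ] F) :
    IsHilbertSchmidt (T ∘L S) := by
  have h := (hT.adjoint.comp_left S.adjoint).adjoint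
  rwa [ContinuousLinearMap.adjoint_comp, ContinuousLinearMap.adjoint_adjoint,
    ContinuousLinearMap.adjoint_adjoint] at h

theorem isTraceClass_zero : IsTraceClass (0 : E →L[ℂ] F) :=
  ⟨PEmpty, PEmpty.elim, PEmpty.elim, summable_empty, fun x => by
    simp⟩

theorem IsTraceClass.add {S T : E →L[ℂ] F} (hS : IsTraceClass S) (hT : IsTraceClass T) :
    IsTraceClass (S + T) := by
  obtain ⟨ι, v, w, h, hx⟩ := hS
  obtain ⟨ι', v', w', h', hx'⟩ := hT
  refine ⟨ι ⊕ ι', Sum.elim v v', Sum.elim w w', ?_, fun x => ?_⟩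
  · exact Summable.sum (f := fun i => ‖Sum.elim v v' i‖ * ‖Sum.elim w w' i‖) h h'
  · exact HasSum.sum (f := fun i => ⟪Sum.elim v v' i, x⟫_ℂ • Sum.elim w w' i) (hx x) (hx' x)

theorem IsTraceClass.comp_left {T : E →L[ℂ] F} (hT : IsTraceClass T) (S : F →L[ℂ] G) :
    IsTraceClass (S ∘L T) := by
  obtain ⟨ι, v, w, h, hx⟩ := hT
  refine ⟨ι, v, fun i => S (w i), ?_, fun x => ?_⟩
  · refine Summable.of_nonneg_of_le (fun i => by positivity) (fun i => ?_) (h.mul_left ‖S‖)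
    calc ‖v i‖ * ‖S (w i)‖ ≤ ‖v i‖ * (‖S‖ * ‖w i‖) := by gcongr; exact S.le_opNorm _
      _ = _ := by ring
  · simpa using S.hasSum (hx x)

theorem IsTraceClass.comp_right {T : F →L[ℂ] G} (hT : IsTraceClass T) (S : E →L[ℂ] F) :
    IsTraceClass (T ∘L S) := by
  obtain ⟨ι, v, w, h, hx⟩ := hT
  refine ⟨ι, fun i => S.adjoint (v i), w, ?_, fun x => ?_⟩
  · refine Summable.of_nonneg_of_le (fun i => by positivity) (fun i => ?_)
      (h.mul_left ‖S.adjoint‖)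
    calc ‖S.adjoint (v i)‖ * ‖w i‖ ≤ (‖S.adjoint‖ * ‖v i‖) * ‖w i‖ := by
          gcongr; exact S.adjoint.le_opNorm _
      _ = _ := by ring
  · simpa [ContinuousLinearMap.adjoint_inner_left] using hx (S x)

theorem IsTraceClass.neg {T : E →L[ℂ] F} (hT : IsTraceClass T) : IsTraceClass (-T) := by
  have h := hT.comp_left (-ContinuousLinearMap.id ℂ F)
  convert h using 1
  ext x; simp

theorem IsHilbertSchmidt.comp_isTraceClass {S : F →L[ℂ] G} {T : E →L[ℂ] F}
    (hS : IsHilbertSchmidt S) (hT : IsHilbertSchmidt T) : IsTraceClass (S ∘L T) := by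
  obtain ⟨ι, b, hb⟩ := hS
  refine ⟨ι, fun i => T.adjoint (b i), fun i => S (b i), ?_, fun x => ?_⟩
  · refine Summable.of_nonneg_of_le (fun i => by positivity) (fun i => ?_)
      ((hT.adjoint.summable b).add hb)
    nlinarith [sq_nonneg (‖T.adjoint (b i)‖ - ‖S (b i)‖), sq_nonneg (‖T.adjoint (b i)‖),
      sq_nonneg (‖S (b i)‖)]
  · have h := S.hasSum (b.hasSum_repr (T x))
    simpa [ContinuousLinearMap.adjoint_inner_left, b.repr_apply_apply] using h

end OperatorIdeals

section FredholmModule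

variable {H : Type u} [NormedAddCommGroup H] [InnerProductSpace ℂ H] [CompleteSpace H]
  (V : Submodule ℂ H) [CompleteSpace V]

/-- The grading operator `F = P₊ - P₋` for `H₊ = V`, `H₋ = Vᗮ`. -/
def grading : H →L[ℂ] H := V.starProjection - Vᗮ.starProjection

/-- The universal 2-summable Fredholm module over `H = V ⊕ Vᗮ`: the bounded operators `a` with
`[F, a]` Hilbert–Schmidt. -/
def universalModule : Subalgebra ℂ (H →L[ℂ] H) where
  carrier := {a | IsHilbertSchmidt (grading V * a - a * grading V)}
  mul_mem' {a b} ha hb := by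
    have h : grading V * (a * b) - a * b * grading V
        = (grading V * a - a * grading V) ∘L b + a ∘L (grading V * b - b * grading V) := by
      change _ = (grading V * a - a * grading V) * b + a * (grading V * b - b * grading V)
      noncomm_ring
    simp only [Set.mem_ofPred_eq] at ha hb ⊢
    rw [h]
    exact (ha.comp_right b).add (hb.comp_left a)
  add_mem' {a b} ha hb := by
    have h : grading V * (a + b) - (a + b) * grading V
        = (grading V * a - a * grading V) + (grading V * b - b * grading V) := by
      noncomm_ring
    simp only [Set.mem_ofPred_eq] at ha hb ⊢
    rw [h]
    exact ha.add hb
  algebraMap_mem' r := by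
    simp only [Set.mem_ofPred_eq]
    rw [Algebra.commutes, sub_self]
    exact isHilbertSchmidt_zero

/-- The compression `P₊ a P₊`, regarded as an operator on `H₊ = V`. -/
def compress (a : H →L[ℂ] H) : V →L[ℂ] V := V.orthogonalProjectionOnto ∘L a ∘L V.subtypeL

theorem compress_one : compress V 1 = 1 := by
  ext x; simp [compress]

theorem compress_add (a b : H →L[ℂ] H) : compress V (a + b) = compress V a + compress V b := by
  ext x; simp [compress]

theorem grading_apply (x : H) : grading V x = (2 : ℂ) • V.starProjection x - x := by
  simp [grading, Submodule.starProjection_orthogonal', two_smul]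
  abel

theorem projection_grading (x : H) :
    V.orthogonalProjectionOnto (grading V x) = V.orthogonalProjectionOnto x := by
  rw [grading_apply, map_sub, map_smul, Submodule.starProjection_apply,
    Submodule.orthogonalProjectionOnto_mem_subspace_eq_self, two_smul, add_sub_cancel_right]

theorem orthogonal_grading (x : H) :
    Vᗮ.starProjection (grading V x) = -Vᗮ.starProjection x := by
  have hP : V.starProjection (V.starProjection x) = V.starProjection x :=
    DFunLike.congr_fun V.isIdempotentElem_starProjection x
  simp [Submodule.starProjection_orthogonal', grading_apply, two_smul, hP]
  abel

theorem grading_orthogonal (x : H) :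
    grading V (Vᗮ.starProjection x) = -Vᗮ.starProjection x := by
  have hP : V.starProjection (V.starProjection x) = V.starProjection x :=
    DFunLike.congr_fun V.isIdempotentElem_starProjection x
  simp [Submodule.starProjection_orthogonal', grading_apply, hP]

theorem grading_coe (x : V) : grading V x = x := by
  simp [grading_apply, two_smul]

theorem compress_mul_sub {a b : H →L[ℂ] H} (ha : a ∈ universalModule V)
    (hb : b ∈ universalModule V) :
    IsTraceClass (compress V (a * b) - compress V a * compress V b) := by
  have key : compress V (a * b) - compress V a * compress V b
      = (((1 / 2 : ℂ) • V.orthogonalProjectionOnto) ∘L (grading V * a - a * grading V)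
          ∘L Vᗮ.starProjection) ∘L
        ((-(1 / 2 : ℂ) • Vᗮ.starProjection) ∘L (grading V * b - b * grading V)
          ∘L V.subtypeL) := by
    have h1 : ((1 / 2 : ℂ) • V.orthogonalProjectionOnto) ∘L (grading V * a - a * grading V)
        ∘L Vᗮ.starProjection = V.orthogonalProjectionOnto ∘L a ∘L Vᗮ.starProjection := by
      ext x
      change (((1 / 2 : ℂ) • V.orthogonalProjectionOnto (grading V (a (Vᗮ.starProjection x))
        - a (grading V (Vᗮ.starProjection x))) : V) : H) = _
      rw [map_sub, projection_grading, grading_orthogonal, map_neg, map_neg, sub_neg_eq_add,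
        ← two_smul ℂ, smul_smul]
      norm_num
    have h2 : (-(1 / 2 : ℂ) • Vᗮ.starProjection) ∘L (grading V * b - b * grading V)
        ∘L V.subtypeL = Vᗮ.starProjection ∘L b ∘L V.subtypeL := by
      ext x
      change -(1 / 2 : ℂ) • Vᗮ.starProjection (grading V (b x) - b (grading V x)) = _
      rw [map_sub, orthogonal_grading, grading_coe, ← neg_add', ← two_smul ℂ, smul_neg, smul_smul]
      norm_num
    rw [h1, h2]
    ext x
    change ((V.orthogonalProjectionOnto (a (b x))
      - V.orthogonalProjectionOnto (a (V.orthogonalProjectionOnto (b x))) : V) : H)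
        = V.orthogonalProjectionOnto (a (Vᗮ.starProjection (Vᗮ.starProjection (b x))))
    have hQ : Vᗮ.starProjection (Vᗮ.starProjection (b x)) = Vᗮ.starProjection (b x) :=
      DFunLike.congr_fun Vᗮ.isIdempotentElem_starProjection (b x)
    rw [hQ, Submodule.starProjection_orthogonal', sub_apply, map_sub, map_sub]
    rfl
  rw [key]
  exact ((IsHilbertSchmidt.comp_right ha _).comp_left _).comp_isTraceClass
    ((IsHilbertSchmidt.comp_right hb _).comp_left _)

/-- The fibre product of `universalModule V → B(V)/L¹(V)`, `a ↦ P₊ a P₊ mod L¹`, and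
`B(V) → B(V)/L¹(V)`: pairs `(a, x)` such that `P₊ a P₊ - x` is of trace class. -/
def extendedModule : Subalgebra ℂ (universalModule V × (V →L[ℂ] V)) where
  carrier := {ax | IsTraceClass (compress V (ax.1 : H →L[ℂ] H) - ax.2)}
  mul_mem' {s t} hs ht := by
    simp only [Set.mem_ofPred_eq] at hs ht ⊢
    have h : compress V ((s * t).1 : H →L[ℂ] H) - (s * t).2
        = (compress V ((s.1 : H →L[ℂ] H) * t.1) - compress V s.1 * compress V t.1)
          + ((compress V s.1 - s.2) ∘L compress V t.1 + s.2 ∘L (compress V t.1 - t.2)) := by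
      change compress V ((s.1 : H →L[ℂ] H) * t.1) - s.2 * t.2
        = _ + ((compress V s.1 - s.2) * compress V t.1 + s.2 * (compress V t.1 - t.2))
      rw [sub_mul, mul_sub]
      abel
    rw [h]
    exact (compress_mul_sub V s.1.2 t.1.2).add ((hs.comp_right _).add (ht.comp_left _))
  add_mem' {s t} hs ht := by
    simp only [Set.mem_ofPred_eq] at hs ht ⊢
    have h : compress V ((s + t).1 : H →L[ℂ] H) - (s + t).2
        = (compress V s.1 - s.2) + (compress V t.1 - t.2) := by
      change compress V ((s.1 : H →L[ℂ] H) + t.1) - (s.2 + t.2) = _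
      rw [compress_add]
      abel
    rw [h]
    exact hs.add ht
  algebraMap_mem' r := by
    simp only [Set.mem_ofPred_eq]
    have h : compress V ((algebraMap ℂ (universalModule V × (V →L[ℂ] V)) r).1 : H →L[ℂ] H)
        - (algebraMap ℂ (universalModule V × (V →L[ℂ] V)) r).2 = 0 := by
      change compress V (algebraMap ℂ (H →L[ℂ] H) r) - algebraMap ℂ (V →L[ℂ] V) r = 0
      ext x
      simp [compress, Algebra.algebraMap_eq_smul_one]
    rw [h]
    exact isTraceClass_zero

instance : Ring (universalModule V) := (universalModule V).toRing

instance : Ring (extendedModule V) := (extendedModule V).toRing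

/-- The projection of the fibre product to the universal Fredholm module. -/
def p₁ : extendedModule V →+* universalModule V :=
  (RingHom.fst _ _).comp (extendedModule V).subtype

/-- The projection of the fibre product to `B(V)`. -/
def p₂ : extendedModule V →+* (V →L[ℂ] V) :=
  (RingHom.snd _ _).comp (extendedModule V).subtype

end FredholmModule

section KTheory

/-- Infinite matrices over `A` that agree with the identity matrix outside a finite block.
This monoid is the union of the `Mₙ(A)` along the inclusions `m ↦ m ⊕ 1`. -/
@[ext]
structure StableMatrix (A : Type*) [Ring A] where
  entry : ℕ → ℕ → A
  stable : ∃ N, ∀ i j, N ≤ i ∨ N ≤ j → entry i j = (if i = j then 1 else 0)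

namespace StableMatrix

variable {A B : Type*} [Ring A] [Ring B]

theorem finsum_eq_of_left {X Y : ℕ → ℕ → A} {n i : ℕ} (hi : i < n)
    (hX : ∀ i j, n ≤ i ∨ n ≤ j → X i j = (if i = j then 1 else 0)) (j : ℕ) :
    ∑ᶠ k, X i k * Y k j = ∑ k ∈ Finset.range n, X i k * Y k j := by
  apply finsum_eq_sum_of_support_subset
  intro k hk
  by_contra h
  have h' : n ≤ k := by simpa using h
  apply hk
  have : i ≠ k := by omega
  simp [hX i k (Or.inr h'), this]

theorem finsum_eq_of_right {X Y : ℕ → ℕ → A} {n j : ℕ} (hj : j < n)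
    (hY : ∀ i j, n ≤ i ∨ n ≤ j → Y i j = (if i = j then 1 else 0)) (i : ℕ) :
    ∑ᶠ k, X i k * Y k j = ∑ k ∈ Finset.range n, X i k * Y k j := by
  apply finsum_eq_sum_of_support_subset
  intro k hk
  by_contra h
  have h' : n ≤ k := by simpa using h
  apply hk
  have : k ≠ j := by omega
  simp [hY k j (Or.inl h'), this]

theorem finsum_one_left (Y : ℕ → ℕ → A) (i j : ℕ) :
    ∑ᶠ k, (if i = k then 1 else 0) * Y k j = Y i j := by
  rw [finsum_eq_single _ i]
  · simp
  · intro k hk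
    simp [hk.symm]

theorem finsum_one_right (X : ℕ → ℕ → A) (i j : ℕ) :
    ∑ᶠ k, X i k * (if k = j then 1 else 0) = X i j := by
  rw [finsum_eq_single _ j]
  · simp
  · intro k hk
    simp [hk]

instance : One (StableMatrix A) := ⟨⟨fun i j => if i = j then 1 else 0, 0, fun _ _ _ => rfl⟩⟩

instance : Mul (StableMatrix A) where
  mul X Y :=
    { entry := fun i j => ∑ᶠ k, X.entry i k * Y.entry k j
      stable := by
        obtain ⟨n, hn⟩ := X.stable
        obtain ⟨m, hm⟩ := Y.stable
        refine ⟨max n m, fun i j hij => ?_⟩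
        rcases hij with h | h
        · rw [← hm i j (Or.inl (by omega)), ← finsum_one_left Y.entry i j]
          refine finsum_congr fun k => ?_
          rw [hn i k (Or.inl (by omega))]
        · rw [← hn i j (Or.inr (by omega)), ← finsum_one_right X.entry i j]
          refine finsum_congr fun k => ?_
          rw [hm k j (Or.inr (by omega))] }

theorem one_entry : (1 : StableMatrix A).entry = fun i j => if i = j then 1 else 0 := rfl

theorem mul_entry (X Y : StableMatrix A) (i j : ℕ) :
    (X * Y).entry i j = ∑ᶠ k, X.entry i k * Y.entry k j := rfl

theorem stable_mono {X : ℕ → ℕ → A} {n m : ℕ} (hnm : n ≤ m)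
    (hX : ∀ i j, n ≤ i ∨ n ≤ j → X i j = (if i = j then 1 else 0)) :
    ∀ i j, m ≤ i ∨ m ≤ j → X i j = (if i = j then 1 else 0) :=
  fun i j h => hX i j (by omega)

instance : Monoid (StableMatrix A) where
  one_mul X := by ext i j; exact finsum_one_left _ _ _
  mul_one X := by ext i j; exact finsum_one_right _ _ _
  mul_assoc X Y Z := by
    ext i j
    obtain ⟨n₁, h₁⟩ := X.stable
    obtain ⟨n₂, h₂⟩ := Y.stable
    obtain ⟨n₃, h₃⟩ := Z.stable
    let n := n₁ + n₂ + n₃ + i + j + 1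
    have hX := stable_mono (m := n) (by omega) h₁
    have hY := stable_mono (m := n) (by omega) h₂
    have hZ := stable_mono (m := n) (by omega) h₃
    have hi : i < n := by omega
    have hj : j < n := by omega
    rw [mul_entry, mul_entry, finsum_eq_of_right hj hZ, finsum_eq_of_left hi hX]
    have e₁ : ∀ k, (X * Y).entry i k
        = ∑ l ∈ Finset.range n, X.entry i l * Y.entry l k := fun k => by
      rw [mul_entry, finsum_eq_of_left hi hX]
    have e₂ : ∀ k, (Y * Z).entry k j
        = ∑ l ∈ Finset.range n, Y.entry k l * Z.entry l j := fun k => by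
      rw [mul_entry, finsum_eq_of_right hj hZ]
    simp only [e₁, e₂, Finset.sum_mul, Finset.mul_sum, mul_assoc]
    exact Finset.sum_comm

/-- Functoriality in the ring. -/
def map (f : A →+* B) : StableMatrix A →* StableMatrix B where
  toFun X :=
    { entry := fun i j => f (X.entry i j)
      stable := by
        obtain ⟨n, hn⟩ := X.stable
        refine ⟨n, fun i j hij => ?_⟩
        rw [hn i j hij]
        by_cases h : i = j <;> simp [h] }
  map_one' := by
    ext i j
    by_cases h : i = j <;> simp [one_entry, h]
  map_mul' X Y := by
    ext i j
    obtain ⟨n, hn⟩ := X.stable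
    have hX := stable_mono (m := n + i + 1) (by omega) hn
    have hX' : ∀ k l, n + i + 1 ≤ k ∨ n + i + 1 ≤ l →
        f (X.entry k l) = (if k = l then 1 else 0) := fun k l hkl => by
      rw [hX k l hkl]
      by_cases h : k = l <;> simp [h]
    change f ((X * Y).entry i j) = ∑ᶠ k, f (X.entry i k) * f (Y.entry k j)
    rw [finsum_eq_of_left (X := fun i j => f (X.entry i j)) (Y := fun i j => f (Y.entry i j))
      (n := n + i + 1) (by omega) hX', mul_entry, finsum_eq_of_left (by omega) hX, map_sum]
    simp

/-- The elementary matrix with entry `a` at the place `(i, j)`, `i ≠ j`. -/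
def elem (i j : ℕ) (a : A) : StableMatrix A where
  entry := fun k l => (if k = l then 1 else 0) + if k = i ∧ l = j then a else 0
  stable := by
    refine ⟨i + j + 1, fun k l hkl => ?_⟩
    have : ¬ (k = i ∧ l = j) := by omega
    simp [this]

theorem elem_mul_entry (i j : ℕ) (a : A) (X : StableMatrix A) (k l : ℕ) :
    (elem i j a * X).entry k l = X.entry k l + if k = i then a * X.entry j l else 0 := by
  rw [mul_entry, finsum_eq_sum_of_support_subset (s := {k, j})]
  · by_cases hkj : k = j
    · subst hkj
      by_cases hki : k = i <;> simp [elem, hki, add_mul]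
    · rw [Finset.sum_pair hkj]
      by_cases hki : k = i <;> simp_all [elem]
  · intro m hm
    by_contra h
    simp only [Finset.coe_insert, Finset.coe_singleton, Set.mem_insert_iff,
      Set.mem_singleton_iff, not_or] at h
    apply hm
    simp [elem, Ne.symm h.1, h.2]

theorem elem_entry (i j : ℕ) (a : A) (k l : ℕ) : (elem i j a).entry k l
    = (if k = l then 1 else 0) + if k = i ∧ l = j then a else 0 := by
  rfl

theorem elem_mul_elem_same {i j : ℕ} (h : i ≠ j) (a b : A) :
    elem i j a * elem i j b = elem i j (a + b) := by
  ext k l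
  simp only [elem_mul_entry, elem_entry]
  grind

theorem elem_zero (i j : ℕ) : elem i j (0 : A) = 1 := by
  ext k l
  simp [elem, one_entry]

theorem map_elem (f : A →+* B) (i j : ℕ) (a : A) : map f (elem i j a) = elem i j (f a) := by
  ext k l
  simp only [map, MonoidHom.coe_mk, OneHom.coe_mk, elem_entry]
  split_ifs <;> simp

/-- Diagonal matrices that are eventually the identity. -/
def diagonal (d : ℕ → A) (hd : ∃ N, ∀ i, N ≤ i → d i = 1) : StableMatrix A where
  entry := fun i j => if i = j then d i else 0
  stable := by
    obtain ⟨N, hN⟩ := hd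
    refine ⟨N, fun i j hij => ?_⟩
    by_cases h : i = j
    · subst h
      simp [hN i (by omega)]
    · simp [h]

theorem diagonal_mul_diagonal (d e : ℕ → A) (hd he) (hde) :
    diagonal d hd * diagonal e he = diagonal (fun i => d i * e i) hde := by
  ext i j
  rw [mul_entry, finsum_eq_single _ i]
  · by_cases h : i = j
    · subst h; simp [diagonal]
    · simp [diagonal, h]
  · intro k hk
    simp [diagonal, Ne.symm hk]

end StableMatrix

variable {A B : Type*} [Ring A] [Ring B]

/-- The stable general linear group `StableGL(A) = lim GLₙ(A)`. -/
abbrev StableGL (A : Type*) [Ring A] : Type _ := (StableMatrix A)ˣ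

/-- Functoriality of `StableGL`. -/
def StableGL.map (f : A →+* B) : StableGL A →* StableGL B := Units.map (StableMatrix.map f)

/-- The elementary matrix `e_ij(a)` as an element of `GL(A)`. -/
def StableGL.elem {i j : ℕ} (h : i ≠ j) (a : A) : StableGL A where
  val := StableMatrix.elem i j a
  inv := StableMatrix.elem i j (-a)
  val_inv := by rw [StableMatrix.elem_mul_elem_same h]; simp [StableMatrix.elem_zero]
  inv_val := by rw [StableMatrix.elem_mul_elem_same h]; simp [StableMatrix.elem_zero]

/-- The diagonal matrix with `a` at place `i`, `a⁻¹` at place `j` and `1` elsewhere. -/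
def StableGL.diag {i j : ℕ} (_ : i ≠ j) (a : Aˣ) : StableGL A where
  val := StableMatrix.diagonal (fun k => if k = i then a else if k = j then ↑a⁻¹ else 1)
    ⟨i + j + 1, fun k hk => by rw [if_neg (by omega), if_neg (by omega)]⟩
  inv := StableMatrix.diagonal (fun k => if k = i then ↑a⁻¹ else if k = j then a else 1)
    ⟨i + j + 1, fun k hk => by rw [if_neg (by omega), if_neg (by omega)]⟩
  val_inv := by
    rw [StableMatrix.diagonal_mul_diagonal (hde := ⟨0, fun k _ => by split_ifs <;> simp⟩)]
    ext k l
    by_cases hkl : k = l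
    · subst hkl
      simp only [StableMatrix.diagonal, StableMatrix.one_entry]
      split_ifs <;> simp
    · simp [StableMatrix.diagonal, StableMatrix.one_entry, hkl]
  inv_val := by
    rw [StableMatrix.diagonal_mul_diagonal (hde := ⟨0, fun k _ => by split_ifs <;> simp⟩)]
    ext k l
    by_cases hkl : k = l
    · subst hkl
      simp only [StableMatrix.diagonal, StableMatrix.one_entry]
      split_ifs <;> simp
    · simp [StableMatrix.diagonal, StableMatrix.one_entry, hkl]

theorem StableGL.diag_commute {i j i' j' : ℕ} (h : i ≠ j) (h' : i' ≠ j') {a b : Aˣ}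
    (hab : Commute a b) : Commute (StableGL.diag h a) (StableGL.diag h' b) := by
  have hc : Commute (a : A) (b : A) := congrArg Units.val hab.eq
  apply Units.ext
  rw [Units.val_mul, Units.val_mul]
  simp only [StableGL.diag]
  ext k l
  rw [StableMatrix.diagonal_mul_diagonal, StableMatrix.diagonal_mul_diagonal]
  · by_cases hkl : k = l
    · subst hkl
      simp only [StableMatrix.diagonal]
      have c1 : Commute (a : A) (↑b⁻¹ : A) := hc.units_inv_right
      have c2 : Commute (↑a⁻¹ : A) (b : A) := hc.units_inv_left
      have c3 : Commute (↑a⁻¹ : A) (↑b⁻¹ : A) := c1.units_inv_left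
      split_ifs <;> simp [hc.eq, c1.eq, c2.eq, c3.eq]
    · simp [StableMatrix.diagonal, hkl]
  all_goals
    refine ⟨i + j + i' + j' + 1, fun k hk => ?_⟩
    rw [if_neg (by omega), if_neg (by omega), if_neg (by omega), if_neg (by omega)]
    simp

/-- Index set of the generators `x_ij(a)`, `i ≠ j`, of the Steinberg group. -/
abbrev SteinbergGen (A : Type*) : Type _ := {p : ℕ × ℕ // p.1 ≠ p.2} × A

/-- The free generator `x_ij(a)`. -/
def SteinbergGen.free {i j : ℕ} (h : i ≠ j) (a : A) : FreeGroup (SteinbergGen A) :=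
  FreeGroup.of (⟨(i, j), h⟩, a)

open SteinbergGen in
/-- The relators of the Steinberg group. -/
inductive SteinbergRel (A : Type*) [Ring A] : FreeGroup (SteinbergGen A) → Prop
  | add {i j : ℕ} (h : i ≠ j) (a b : A) :
      SteinbergRel A (free h a * free h b * (free h (a + b))⁻¹)
  | comm {i j k : ℕ} (hij : i ≠ j) (hjk : j ≠ k) (hik : i ≠ k) (a b : A) :
      SteinbergRel A (⁅free hij a, free hjk b⁆ * (free hik (a * b))⁻¹)
  | comm_one {i j k l : ℕ} (hij : i ≠ j) (hkl : k ≠ l) (hjk : j ≠ k) (hil : i ≠ l) (a b : A) :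
      SteinbergRel A ⁅free hij a, free hkl b⁆

/-- The stable Steinberg group `St(A)`. -/
abbrev Steinberg (A : Type*) [Ring A] : Type _ := PresentedGroup {r | SteinbergRel A r}

/-- The generator `x_ij(a)` of the Steinberg group. -/
def Steinberg.x {i j : ℕ} (h : i ≠ j) (a : A) : Steinberg A :=
  PresentedGroup.of (⟨(i, j), h⟩, a)

theorem Steinberg.mk_free {i j : ℕ} (h : i ≠ j) (a : A) :
    PresentedGroup.mk {r | SteinbergRel A r} (SteinbergGen.free h a) = Steinberg.x h a := rfl

theorem StableGL.elem_add {i j : ℕ} (h : i ≠ j) (a b : A) :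
    StableGL.elem h a * StableGL.elem h b = StableGL.elem h (a + b) :=
  Units.ext (StableMatrix.elem_mul_elem_same h a b)

theorem StableGL.elem_comm {i j k : ℕ} (hij : i ≠ j) (hjk : j ≠ k) (hik : i ≠ k) (a b : A) :
    StableGL.elem hij a * StableGL.elem hjk b = StableGL.elem hik (a * b) * (StableGL.elem hjk b * StableGL.elem hij a) := by
  apply Units.ext
  ext k l
  simp only [StableGL.elem, Units.val_mul, StableMatrix.elem_mul_entry, StableMatrix.elem_entry,
    mul_add, mul_ite, mul_one, mul_zero]
  grind

theorem StableGL.elem_comm_one {i j k l : ℕ} (hij : i ≠ j) (hkl : k ≠ l) (hjk : j ≠ k) (hil : i ≠ l)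
    (a b : A) : StableGL.elem hij a * StableGL.elem hkl b = StableGL.elem hkl b * StableGL.elem hij a := by
  apply Units.ext
  ext k l
  simp only [StableGL.elem, Units.val_mul, StableMatrix.elem_mul_entry, StableMatrix.elem_entry,
    mul_add, mul_ite, mul_one, mul_zero]
  grind

theorem lift_rel {r : FreeGroup (SteinbergGen A)} (hr : SteinbergRel A r) :
    FreeGroup.lift (fun g : SteinbergGen A => StableGL.elem g.1.2 g.2) r = 1 := by
  have hf : ∀ {i j : ℕ} (h : i ≠ j) (a : A),
      FreeGroup.lift (fun g : SteinbergGen A => StableGL.elem g.1.2 g.2) (SteinbergGen.free h a)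
        = StableGL.elem h a := fun h a => by simp [SteinbergGen.free]
  cases hr with
  | add h a b => simp [hf, StableGL.elem_add]
  | comm hij hjk hik a b =>
    simp only [map_mul, map_inv, hf, commutatorElement_def]
    rw [StableGL.elem_comm hij hjk hik]
    group
  | comm_one hij hkl hjk hil a b =>
    simp only [map_mul, map_inv, hf, commutatorElement_def]
    rw [StableGL.elem_comm_one hij hkl hjk hil]
    group

/-- The canonical projection `St(A) → GL(A)`, `x_ij(a) ↦ e_ij(a)`; its range is `E(A)`. -/
def Steinberg.proj (A : Type*) [Ring A] : Steinberg A →* StableGL A :=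
  PresentedGroup.toGroup (f := fun g : SteinbergGen A => StableGL.elem g.1.2 g.2)
    fun _ hr => lift_rel hr

theorem Steinberg.proj_x {i j : ℕ} (h : i ≠ j) (a : A) :
    Steinberg.proj A (Steinberg.x h a) = StableGL.elem h a :=
  PresentedGroup.toGroup.of (f := fun g : SteinbergGen A => StableGL.elem g.1.2 g.2)
    fun _ hr => lift_rel hr

theorem mk_eq_of_rel {r : FreeGroup (SteinbergGen A)} (hr : SteinbergRel A r) :
    PresentedGroup.mk {r | SteinbergRel A r} r = 1 :=
  PresentedGroup.one_of_mem hr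

theorem lift_map_rel (f : A →+* B) {r : FreeGroup (SteinbergGen A)} (hr : SteinbergRel A r) :
    FreeGroup.lift (fun g : SteinbergGen A => Steinberg.x g.1.2 (f g.2)) r = 1 := by
  have hf : ∀ {i j : ℕ} (h : i ≠ j) (a : A),
      FreeGroup.lift (fun g : SteinbergGen A => Steinberg.x g.1.2 (f g.2))
        (SteinbergGen.free h a) = Steinberg.x h (f a) := fun h a => by simp [SteinbergGen.free]
  cases hr with
  | add h a b =>
    have := mk_eq_of_rel (SteinbergRel.add h (f a) (f b))
    simpa [hf, Steinberg.mk_free] using this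
  | comm hij hjk hik a b =>
    have := mk_eq_of_rel (SteinbergRel.comm hij hjk hik (f a) (f b))
    simpa [hf, Steinberg.mk_free, map_commutatorElement] using this
  | comm_one hij hkl hjk hil a b =>
    have := mk_eq_of_rel (SteinbergRel.comm_one hij hkl hjk hil (f a) (f b))
    simpa [hf, Steinberg.mk_free, map_commutatorElement] using this

/-- Functoriality of the Steinberg group. -/
def Steinberg.map (f : A →+* B) : Steinberg A →* Steinberg B :=
  PresentedGroup.toGroup (f := fun g : SteinbergGen A => Steinberg.x g.1.2 (f g.2))
    fun _ hr => lift_map_rel f hr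

theorem Steinberg.map_x (f : A →+* B) {i j : ℕ} (h : i ≠ j) (a : A) :
    Steinberg.map f (Steinberg.x h a) = Steinberg.x h (f a) :=
  PresentedGroup.toGroup.of (f := fun g : SteinbergGen A => Steinberg.x g.1.2 (f g.2))
    fun _ hr => lift_map_rel f hr

theorem Steinberg.proj_map (f : A →+* B) (u : Steinberg A) :
    Steinberg.proj B (Steinberg.map f u) = StableGL.map f (Steinberg.proj A u) := by
  have : (Steinberg.proj B).comp (Steinberg.map f) = (StableGL.map f).comp (Steinberg.proj A) := by
    apply PresentedGroup.ext
    rintro ⟨⟨⟨i, j⟩, h⟩, a⟩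
    change Steinberg.proj B (Steinberg.map f (Steinberg.x h a))
      = StableGL.map f (Steinberg.proj A (Steinberg.x h a))
    rw [Steinberg.map_x, Steinberg.proj_x, Steinberg.proj_x]
    exact Units.ext (StableMatrix.map_elem f i j a).symm
  exact DFunLike.congr_fun this u

/-- `K₂(A)`, the kernel of `St(A) → GL(A)`. -/
abbrev K₂ (A : Type*) [Ring A] : Subgroup (Steinberg A) := (Steinberg.proj A).ker

/-- Functoriality of `K₂`. -/
def K₂.map (f : A →+* B) : K₂ A →* K₂ B :=
  ((Steinberg.map f).comp (K₂ A).subtype).codRestrict (K₂ B) fun u => by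
    have hu : Steinberg.proj A u = 1 := u.2
    simp [MonoidHom.mem_ker, Steinberg.proj_map, hu]

/-- `w_ij(a) = x_ij(a) x_ji(-a⁻¹) x_ij(a)`. -/
def Steinberg.w {i j : ℕ} (h : i ≠ j) (a : Aˣ) : Steinberg A :=
  x h (a : A) * x h.symm (-(↑a⁻¹ : A)) * x h (a : A)

/-- `h_ij(a) = w_ij(a) w_ij(-1)`, a preimage of the diagonal matrix with `a`, `a⁻¹` at the
places `i`, `j`. -/
def Steinberg.h {i j : ℕ} (h : i ≠ j) (a : Aˣ) : Steinberg A := w h a * w h (-1)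

theorem Steinberg.proj_h {i j : ℕ} (h : i ≠ j) (a : Aˣ) :
    Steinberg.proj A (Steinberg.h h a) = StableGL.diag h a := by
  simp only [Steinberg.h, Steinberg.w, map_mul, Steinberg.proj_x, mul_assoc]
  apply Units.ext
  ext k l
  simp only [StableGL.elem, StableGL.diag, Units.val_mul, StableMatrix.elem_mul_entry,
    StableMatrix.elem_entry, StableMatrix.diagonal]
  by_cases hki : k = i
  · subst hki
    by_cases hlk : l = k
    · subst hlk; simp [h, h.symm]
    · by_cases hlj : l = j
      · subst hlj; simp [h, h.symm]
      · simp [h, h.symm, hlj, Ne.symm hlk, Ne.symm hlj]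
  · by_cases hkj : k = j
    · subst hkj
      by_cases hlk : l = k
      · subst hlk; simp [h, h.symm]
      · by_cases hli : l = i
        · subst hli; simp [h, h.symm]
        · simp [h, h.symm, hlk, Ne.symm hlk, Ne.symm hli]
    · simp [hki, hkj]

/-- The Steinberg symbol `{a, b}` of two commuting units: the commutator of preimages in the
Steinberg group of `diag(a, a⁻¹, 1)` and `diag(b, 1, b⁻¹)`. The preimages used are `h₁₂(a)` and
`h₁₃(b)` (see `Steinberg.proj_h`; indices start at `0` here); as `K₂(A)` is central in the
Steinberg group, any others give the same commutator. -/
def steinbergSymbol (a b : Aˣ) (hab : Commute a b) : K₂ A :=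
  ⟨⁅Steinberg.h (i := 0) (j := 1) (by decide) a, Steinberg.h (i := 0) (j := 2) (by decide) b⁆, by
    rw [MonoidHom.mem_ker, map_commutatorElement, Steinberg.proj_h, Steinberg.proj_h,
      commutatorElement_eq_one_iff_commute]
    exact StableGL.diag_commute _ _ hab⟩

end KTheory

section Determinant

variable {E : Type u} [NormedAddCommGroup E] [InnerProductSpace ℂ E]

open Classical in
/-- The Fredholm determinant of `g ∈ GL(B(E))`, an invertible matrix of operators that differs
from the identity by trace class operators, is `d`: in every orthonormal basis `b` of `E`, the
determinants of the finite sections of `g`, viewed as an operator on `E ⊕ E ⊕ ⋯`, converge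
to `d`. -/
def HasFredholmDet (g : StableGL (E →L[ℂ] E)) (d : ℂ) : Prop :=
  ∀ (ι : Type u) (b : HilbertBasis ι ℂ E),
    Filter.Tendsto (fun t : Finset (ℕ × ι) =>
      Matrix.det (Matrix.of fun i j : t => ⟪b i.1.2, g.val.entry i.1.1 j.1.1 (b j.1.2)⟫_ℂ))
      Filter.atTop (nhds d)

variable {H : Type u} [NormedAddCommGroup H] [InnerProductSpace ℂ H] [CompleteSpace H]
  (V : Submodule ℂ H) [CompleteSpace V]

/-- The normal subgroup of the elements of the kernel of `GL(p₁)` with Fredholm determinant `1`.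
These elements do form a normal subgroup, so that passing to the normal closure changes nothing;
it is used so that normality need not be proved at this point (see also
`IsConnesKaroubiCharacter.mem_detOne_iff`). -/
def detOne : Subgroup (StableGL (extendedModule V)) :=
  Subgroup.normalClosure
    {g | StableGL.map (p₁ V) g = 1 ∧ HasFredholmDet (StableGL.map (p₂ V) g) 1}

instance : (detOne V).Normal := Subgroup.normalClosure_normal

theorem detOne_le_ker : detOne V ≤ (StableGL.map (p₁ V)).ker :=
  Subgroup.normalClosure_le_normal fun _ hg => hg.1

/-- The homomorphism from the Connes–Karoubi extension `GL(extendedModule V) / detOne V` to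
`GL(universalModule V)` induced by `GL(p₁)`. -/
def extensionProj :
    StableGL (extendedModule V) ⧸ detOne V →* StableGL (universalModule V) :=
  QuotientGroup.lift (detOne V) (StableGL.map (p₁ V)) (detOne_le_ker V)

/-- `ck` is the Connes–Karoubi character: the homomorphism `K₂ → ℂˣ` obtained by restricting to
`K₂` a morphism `τ` over `GL(universalModule V)` from the Steinberg group to the central
extension `GL(extendedModule V) / detOne V`, the kernel of the latter being identified with
`ℂˣ` by the Fredholm determinant. -/
def IsConnesKaroubiCharacter (ck : K₂ (universalModule V) →* ℂˣ) : Prop :=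
  ∃ τ : Steinberg (universalModule V) →* StableGL (extendedModule V) ⧸ detOne V,
    (extensionProj V).comp τ = Steinberg.proj (universalModule V) ∧
    ∀ (u : K₂ (universalModule V)) (g : StableGL (extendedModule V)),
      (g : StableGL (extendedModule V) ⧸ detOne V) = τ u →
        HasFredholmDet (StableGL.map (p₂ V) g) (ck u : ℂ)

theorem IsConnesKaroubiCharacter.mem_detOne_iff {ck : K₂ (universalModule V) →* ℂˣ}
    (h : IsConnesKaroubiCharacter V ck) (g : StableGL (extendedModule V)) :
    g ∈ detOne V ↔
      StableGL.map (p₁ V) g = 1 ∧ HasFredholmDet (StableGL.map (p₂ V) g) 1 := by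
  refine ⟨fun hg => ⟨detOne_le_ker V hg, ?_⟩, fun hg => Subgroup.subset_normalClosure hg⟩
  obtain ⟨τ, -, hτ⟩ := h
  have := hτ 1 g (by rw [(QuotientGroup.eq_one_iff g).2 hg]; simp)
  simpa using this

end Determinant

section Circle

open MeasureTheory Real AddCircle

instance fact_two_pi_pos : Fact (0 < 2 * π) := ⟨Real.two_pi_pos⟩

/-- `L²(S¹)`, with `S¹` parametrized as `ℝ / 2πℤ` and with normalized Lebesgue measure. -/
abbrev L2Circle : Type := Lp ℂ 2 (haarAddCircle : Measure (AddCircle (2 * π)))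

/-- The Hardy space `H₊ ⊆ L²(S¹)`, the closed span of `e^{inθ}`, `n ≥ 0`. -/
abbrev hardySpace : Submodule ℂ L2Circle :=
  (Submodule.span ℂ (Set.range fun n : ℕ =>
    (fourierLp 2 (n : ℤ) : L2Circle))).topologicalClosure

/-- The operator `M(φ)` of multiplication by the continuous function `φ` on `L²(S¹)`. -/
def mulOp (φ : C(AddCircle (2 * π), ℂ)) : L2Circle →L[ℂ] L2Circle :=
  (ContinuousLinearMap.mul ℂ ℂ).holderL haarAddCircle ⊤ 2 2
    (ContinuousMap.toLp ⊤ haarAddCircle ℂ φ)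

theorem coeFn_mulOp (φ : C(AddCircle (2 * π), ℂ)) (ξ : L2Circle) :
    mulOp φ ξ =ᵐ[haarAddCircle] fun x => φ x * ξ x := by
  have h := ContinuousLinearMap.coeFn_holder (r := 2) (ContinuousLinearMap.mul ℂ ℂ)
    (ContinuousMap.toLp ⊤ haarAddCircle ℂ φ) ξ
  have h' := ContinuousMap.coeFn_toLp (p := ⊤) (𝕜 := ℂ)
    (haarAddCircle : Measure (AddCircle (2 * π))) φ
  filter_upwards [h, h'] with x hx hx'
  rw [← hx']
  exact hx

theorem mulOp_one : mulOp 1 = 1 := by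
  ext1 ξ
  apply Lp.ext
  filter_upwards [coeFn_mulOp 1 ξ] with x hx
  simpa using hx

theorem mulOp_mul (φ ψ : C(AddCircle (2 * π), ℂ)) : mulOp (φ * ψ) = mulOp φ * mulOp ψ := by
  ext1 ξ
  apply Lp.ext
  filter_upwards [coeFn_mulOp (φ * ψ) ξ, coeFn_mulOp φ (mulOp ψ ξ), coeFn_mulOp ψ ξ]
    with x h1 h2 h3
  rw [h1]
  change _ = mulOp φ (mulOp ψ ξ) x
  rw [h2, h3, ContinuousMap.mul_apply, mul_assoc]

theorem mulOp_add (φ ψ : C(AddCircle (2 * π), ℂ)) : mulOp (φ + ψ) = mulOp φ + mulOp ψ := by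
  rw [mulOp, map_add, map_add]; rfl

theorem mulOp_zero : mulOp 0 = 0 := by
  rw [mulOp, map_zero, map_zero]

theorem inner_mulOp (φ : C(AddCircle (2 * π), ℂ)) (m n : ℤ) :
    ⟪(fourierLp 2 m : L2Circle), mulOp φ (fourierLp 2 n : L2Circle)⟫_ℂ
      = fourierCoeff φ (m - n) := by
  have h := (fourierBasis (T := 2 * π)).repr_apply_apply (mulOp φ (fourierLp 2 n)) m
  rw [coe_fourierBasis, fourierBasis_repr] at h
  rw [← h, fourierCoeff, fourierCoeff]
  apply integral_congr_ae
  filter_upwards [coeFn_mulOp φ (fourierLp 2 n : L2Circle), coeFn_fourierLp (T := 2 * π) 2 n]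
    with x h1 h2
  rw [h1, h2, neg_sub, sub_eq_add_neg, fourier_add]
  simp only [smul_eq_mul]
  ring

theorem grading_fourierLp (n : ℤ) : grading hardySpace (fourierLp 2 n : L2Circle)
    = (if 0 ≤ n then 1 else -1 : ℂ) • (fourierLp 2 n : L2Circle) := by
  split_ifs with hn
  · rw [one_smul]
    refine grading_coe hardySpace ⟨_, Submodule.le_topologicalClosure _ (Submodule.subset_span ?_)⟩
    exact ⟨n.toNat, by simp [hn]⟩
  · have hmem : (fourierLp 2 n : L2Circle) ∈ hardySpaceᗮ := by
      rw [Submodule.orthogonal_closure, Submodule.mem_orthogonal]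
      intro x hx
      induction hx using Submodule.span_induction with
      | mem x hx =>
        obtain ⟨k, rfl⟩ := hx
        exact (orthonormal_fourier (T := 2 * π)).2 (by omega)
      | zero => simp
      | add x y _ _ hx hy => rw [inner_add_left, hx, hy, add_zero]
      | smul c x _ hx => rw [inner_smul_left, hx, mul_zero]
    have h := grading_orthogonal hardySpace (fourierLp 2 n : L2Circle)
    rw [Submodule.starProjection_eq_self_iff.2 hmem] at h
    rw [h, neg_smul, one_smul]

theorem inner_grading_left (V : Submodule ℂ L2Circle) [CompleteSpace V] (x y : L2Circle) :
    ⟪x, grading V y⟫_ℂ = ⟪grading V x, y⟫_ℂ := by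
  simp only [grading_apply, inner_sub_left, inner_sub_right, inner_smul_left, inner_smul_right,
    Submodule.inner_starProjection_left_eq_right]
  have h2 : (starRingEnd ℂ) 2 = 2 := Complex.conj_ofNat 2
  rw [h2]

/-- Multiplication operators whose symbol has quadratically decaying Fourier coefficients belong
to the universal Fredholm module. -/
theorem mulOp_mem_of_decay (φ : C(AddCircle (2 * π), ℂ)) (C : ℝ)
    (hC : ∀ n : ℤ, (n : ℝ) ^ 2 * ‖fourierCoeff φ n‖ ≤ C) :
    mulOp φ ∈ universalModule hardySpace := by
  refine isHilbertSchmidt_of_summable (fourierBasis (T := 2 * π)) ?_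
  rw [← summable_matrix_iff _ (fourierBasis (T := 2 * π))]
  have hs : Summable fun n : ℤ => 1 / (1 + (n : ℝ) ^ 2) := by
    refine Summable.of_norm_bounded_eventually
      (g := fun n : ℤ => 1 / (n : ℝ) ^ 2) (Real.summable_one_div_int_pow.2 one_lt_two) ?_
    rw [Filter.eventually_cofinite]
    refine (Set.finite_singleton (0 : ℤ)).subset fun n hn => ?_
    by_contra h0
    apply hn
    have : (0 : ℝ) < (n : ℝ) ^ 2 := by
      have : (n : ℝ) ≠ 0 := by exact_mod_cast h0
      positivity
    rw [Real.norm_of_nonneg (by positivity)]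
    exact one_div_le_one_div_of_le this (by linarith)
  have hp := (hs.mul_of_nonneg hs (fun n => div_nonneg zero_le_one (by positivity))
    (fun n => div_nonneg zero_le_one (by positivity))).mul_left
    (16 * C ^ 2)
  refine Summable.of_nonneg_of_le (fun p => by positivity) (fun ⟨n, m⟩ => ?_) hp
  have hent : ⟪(fourierLp 2 m : L2Circle), (grading hardySpace * mulOp φ
      - mulOp φ * grading hardySpace) (fourierLp 2 n : L2Circle)⟫_ℂ
      = ((if 0 ≤ m then 1 else -1 : ℂ) - (if 0 ≤ n then 1 else -1 : ℂ))
        * fourierCoeff φ (m - n) := by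
    change ⟪(fourierLp 2 m : L2Circle), grading hardySpace (mulOp φ (fourierLp 2 n))
      - mulOp φ (grading hardySpace (fourierLp 2 n))⟫_ℂ = _
    rw [inner_sub_right, inner_grading_left, grading_fourierLp, grading_fourierLp, map_smul,
      inner_smul_left, inner_smul_right, inner_mulOp, sub_mul]
    congr 2
    split_ifs <;> simp
  simp only [coe_fourierBasis]
  rw [hent]
  by_cases hmn : (0 ≤ m ↔ 0 ≤ n)
  · simp only [hmn, sub_self, zero_mul, norm_zero, zero_pow two_ne_zero]
    positivity
  · have hC' := hC (m - n)
    have h1 : (1 : ℝ) + (m : ℝ) ^ 2 ≤ 2 * ((m - n : ℤ) : ℝ) ^ 2 := by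
      exact_mod_cast (show (1 : ℤ) + m ^ 2 ≤ 2 * (m - n) ^ 2 by
        rcases le_or_gt 0 m with h | h <;> rcases le_or_gt 0 n with h' | h' <;>
          first | (exact absurd (by omega) hmn) | nlinarith)
    have h2 : (1 : ℝ) + (n : ℝ) ^ 2 ≤ 2 * ((m - n : ℤ) : ℝ) ^ 2 := by
      exact_mod_cast (show (1 : ℤ) + n ^ 2 ≤ 2 * (m - n) ^ 2 by
        rcases le_or_gt 0 m with h | h <;> rcases le_or_gt 0 n with h' | h' <;>
          first | (exact absurd (by omega) hmn) | nlinarith)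
    have h3 : ‖(if 0 ≤ m then 1 else -1 : ℂ) - (if 0 ≤ n then 1 else -1 : ℂ)‖ ≤ 2 := by
      refine (norm_sub_le _ _).trans ?_
      split_ifs <;> norm_num
    have h4 : ‖((if 0 ≤ m then 1 else -1 : ℂ) - (if 0 ≤ n then 1 else -1 : ℂ))
        * fourierCoeff φ (m - n)‖ ≤ 2 * ‖fourierCoeff φ (m - n)‖ := by
      rw [norm_mul]; gcongr
    set y := ‖fourierCoeff φ (m - n)‖
    set k : ℝ := ((m - n : ℤ) : ℝ) ^ 2
    have hy : 0 ≤ y := norm_nonneg _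
    have hk : 0 ≤ k := sq_nonneg _
    calc _ ≤ (2 * y) ^ 2 := pow_le_pow_left₀ (norm_nonneg _) h4 2
      _ ≤ 16 * C ^ 2 * (1 / (1 + (n : ℝ) ^ 2) * (1 / (1 + (m : ℝ) ^ 2))) := by
        have hA : 0 < 1 + (n : ℝ) ^ 2 := by positivity
        have hB : 0 < 1 + (m : ℝ) ^ 2 := by positivity
        rw [one_div_mul_one_div, mul_one_div, le_div_iff₀ (by positivity)]
        have h5 : (1 + (n : ℝ) ^ 2) * (1 + (m : ℝ) ^ 2) ≤ (2 * k) * (2 * k) :=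
          mul_le_mul h2 h1 hB.le (by positivity)
        have h6 : (k * y) ^ 2 ≤ C ^ 2 := pow_le_pow_left₀ (by positivity) hC' 2
        have h7 := mul_le_mul_of_nonneg_left h5 (sq_nonneg y)
        nlinarith

/-- Integration by parts for Fourier integrals of periodic functions. -/
theorem integral_fourier_deriv {f f' : ℝ → ℂ} (hf : ∀ x, HasDerivAt f (f' x) x)
    (hf' : Continuous f') (hper : f (2 * π) = f 0) (n : ℤ) :
    ∫ x in (0 : ℝ)..2 * π, Complex.exp (-(n * Complex.I * x)) * f' x
      = n * Complex.I * ∫ x in (0 : ℝ)..2 * π, Complex.exp (-(n * Complex.I * x)) * f x := by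
  have hv : ∀ x : ℝ, HasDerivAt (fun x : ℝ => Complex.exp (-(n * Complex.I * x)))
      (-(n * Complex.I) * Complex.exp (-(n * Complex.I * x))) x := fun x => by
    have h1 : HasDerivAt (fun x : ℝ => -(n * Complex.I * x)) (-(n * Complex.I)) x := by
      have h2 := ((hasDerivAt_id x).ofReal_comp.const_mul (n * Complex.I)).neg
      rw [Complex.ofReal_one, mul_one] at h2
      exact h2
    convert h1.cexp using 1
    ring
  have h := intervalIntegral.integral_mul_deriv_eq_deriv_mul (a := 0) (b := 2 * π)
    (fun x _ => hv x) (fun x _ => hf x)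
    (by apply Continuous.intervalIntegrable; fun_prop) (hf'.intervalIntegrable _ _)
  have e : Complex.exp (-(n * Complex.I * ((2 * π : ℝ) : ℂ))) = 1 := by
    rw [Complex.exp_neg, inv_eq_one, ← Complex.exp_int_mul_two_pi_mul_I n]
    push_cast; ring_nf
  rw [h, e, hper]
  simp [mul_assoc, intervalIntegral.integral_const_mul]

theorem fourierCoeff_decay (φ : C(AddCircle (2 * π), ℂ))
    (hφ : ContDiff ℝ 2 fun x : ℝ => φ x) :
    ∃ C : ℝ, ∀ n : ℤ, (n : ℝ) ^ 2 * ‖fourierCoeff φ n‖ ≤ C := by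
  have hper : ∀ x : ℝ, φ ((x + 2 * π : ℝ) : AddCircle (2 * π)) = φ (x : AddCircle (2 * π)) :=
    fun x => by rw [AddCircle.coe_add_period]
  set f : ℝ → ℂ := fun x => φ (x : AddCircle (2 * π)) with hf
  have hd0 : Differentiable ℝ f := hφ.differentiable (by norm_num)
  have hφ1 : ContDiff ℝ 1 (deriv f) := ((contDiff_succ_iff_deriv (n := 1)).1 hφ).2.2
  have hd1 : Differentiable ℝ (deriv f) := hφ1.differentiable (by norm_num)
  have hc2 : Continuous (deriv (deriv f)) := hφ1.continuous_deriv le_rfl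
  have hper1 : deriv f (2 * π) = deriv f 0 := by
    have : (fun x => f (x + 2 * π)) = f := funext hper
    rw [← zero_add (2 * π), ← deriv_comp_add_const f (2 * π) 0, this]
  have hper0 : f (2 * π) = f 0 := by
    have := hper 0
    rw [zero_add] at this
    exact this
  refine ⟨(2 * π)⁻¹ * ∫ x in (0 : ℝ)..2 * π, ‖deriv (deriv f) x‖, fun n => ?_⟩
  have h1 := integral_fourier_deriv (fun x => (hd0 x).hasDerivAt) hφ1.continuous hper0 n
  have h2 := integral_fourier_deriv (fun x => (hd1 x).hasDerivAt) hc2 hper1 n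
  rw [h1] at h2
  have hcoef : fourierCoeff φ n
      = ((2 * π)⁻¹ : ℝ) • ∫ x in (0 : ℝ)..2 * π, Complex.exp (-(n * Complex.I * x)) * f x := by
    rw [fourierCoeff_eq_intervalIntegral _ _ 0, zero_add, one_div]
    congr 1
    apply intervalIntegral.integral_congr
    intro x _
    simp only [smul_eq_mul, hf, fourier_coe_apply]
    congr 2
    have : (π : ℂ) ≠ 0 := by exact_mod_cast Real.pi_ne_zero
    push_cast
    field_simp
  have hnorm : ‖∫ x in (0 : ℝ)..2 * π, Complex.exp (-(n * Complex.I * x)) * deriv (deriv f) x‖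
      ≤ ∫ x in (0 : ℝ)..2 * π, ‖deriv (deriv f) x‖ := by
    refine (intervalIntegral.norm_integral_le_integral_norm Real.two_pi_pos.le).trans_eq ?_
    apply intervalIntegral.integral_congr
    intro x _
    have : -(n * Complex.I * x) = ((-(n * x) : ℝ) : ℂ) * Complex.I := by push_cast; ring
    simp only [norm_mul, this, Complex.norm_exp_ofReal_mul_I, one_mul]
  rw [h2, norm_mul, norm_mul, Complex.norm_I, mul_one, Complex.norm_intCast,
    norm_mul, norm_mul, Complex.norm_I, mul_one, Complex.norm_intCast] at hnorm
  rw [hcoef, norm_smul, Real.norm_of_nonneg (by positivity), mul_left_comm]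
  refine mul_le_mul_of_nonneg_left (le_trans (le_of_eq ?_) hnorm) (by positivity)
  rw [← sq_abs]
  ring

open scoped Manifold ContDiff

instance contMDiffRing_complex : ContMDiffRing 𝓘(ℝ, ℂ) ∞ ℂ :=
  { instNormedSpaceLieAddGroup with
    contMDiff_mul := by
      rw [contMDiff_iff]
      refine ⟨continuous_mul, fun x y => ?_⟩
      simp only [mfld_simps, chartAt_self_eq]
      rw [contDiffOn_univ]
      exact contDiff_mul }

/-- The ring `C^∞(S¹)` of smooth complex-valued functions on the unit circle. -/
abbrev SmoothCircle : Type := C^∞⟮𝓡 1, Circle; 𝓘(ℝ, ℂ), ℂ⟯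

/-- A smooth function on the unit circle as a continuous function of the angle. -/
def SmoothCircle.toContinuousMap (f : SmoothCircle) : C(AddCircle (2 * π), ℂ) where
  toFun t := f (AddCircle.toCircle t)
  continuous_toFun := f.contMDiff.continuous.comp AddCircle.continuous_toCircle

theorem SmoothCircle.contDiff (f : SmoothCircle) :
    ContDiff ℝ 2 fun x : ℝ => f.toContinuousMap x := by
  have h : ContMDiff 𝓘(ℝ, ℝ) 𝓘(ℝ, ℂ) ∞ fun x : ℝ => f (Circle.exp x) :=
    f.contMDiff.comp contMDiff_circleExp
  have h' : (fun x : ℝ => f.toContinuousMap x) = fun x : ℝ => f (Circle.exp x) := by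
    funext x
    change f (AddCircle.toCircle (x : AddCircle (2 * π))) = _
    rw [AddCircle.toCircle_apply_mk, div_self Real.two_pi_pos.ne', one_mul]
  rw [h']
  exact contDiff_infty.1 h.contDiff 2

/-- The Fredholm module `μ : C^∞(S¹) → B(L²(S¹))` of multiplication operators, `μ(q) = M(q)`. -/
def multiplicationModule : SmoothCircle →+* universalModule hardySpace where
  toFun f := ⟨mulOp f.toContinuousMap, by
    obtain ⟨C, hC⟩ := fourierCoeff_decay f.toContinuousMap f.contDiff
    exact mulOp_mem_of_decay _ C hC⟩
  map_one' := Subtype.ext mulOp_one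
  map_mul' f g := Subtype.ext (mulOp_mul f.toContinuousMap g.toContinuousMap)
  map_zero' := Subtype.ext mulOp_zero
  map_add' f g := Subtype.ext (mulOp_add f.toContinuousMap g.toContinuousMap)

/-- A nowhere vanishing smooth function on the circle as a unit of `C^∞(S¹)`. -/
def SmoothCircle.unit (p : SmoothCircle) (hp : ∀ x, p x ≠ 0) : SmoothCircleˣ where
  val := p
  inv := ⟨fun x => (p x)⁻¹, fun x =>
    ((contDiffAt_inv ℝ (hp x)).contMDiffAt (n := ∞)).comp x (p.contMDiff x)⟩
  val_inv := by ext x; exact mul_inv_cancel₀ (hp x)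
  inv_val := by ext x; exact inv_mul_cancel₀ (hp x)

/-- `a` is a continuous branch of `θ ↦ log p(e^{iθ})` on `[0, 2π]`. -/
def IsLogBranch (p : SmoothCircle) (a : ℝ → ℂ) : Prop :=
  ContinuousOn a (Set.Icc 0 (2 * π)) ∧
    ∀ θ ∈ Set.Icc 0 (2 * π), Complex.exp (a θ) = p (Circle.exp θ)

end Circle

end ConnesKaroubi

end

open ConnesKaroubi

/-!
The lifts of the projection from the Steinberg group to `GL(ℰ)/𝔗₁` are governed by the Fredholm
determinant on the kernel of `GL(p₁)`. An operator `1 + ∑ᵢ ⟪vᵢ, ·⟫ wᵢ` with `∑ᵢ ‖vᵢ‖ ‖wᵢ‖ < ∞` is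
given the determinant of Fredholm's series, the sum of all principal minors of the Gram matrix
`⟪vᵢ, wⱼ⟫`; Hadamard's inequality makes the series converge, uniformly enough to pass to limits
(`tendsto_minorSum`). The series is the limit of the determinants of finite sections in any basis,
so it does not depend on the representation. It is multiplicative (`IsNuclearDet.mul`), because a
product of sections of two operators is the section of an operator close to their product, and it is
invariant under conjugation. Hence the kernel of the extension is central
(`commute_of_extensionProj_eq_one`). Elementary matrices over `ker p₁` have determinant `1`, so the
Steinberg relations lift (`exists_steinbergLift`), and as the Steinberg group is perfect the lift is
unique (`steinbergLift_unique`). On `K₂` the determinant of the lift is the Connes–Karoubi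
character.

By centrality the character on a symbol is the determinant of the commutator of arbitrary lifts of
the two diagonal matrices (`IsConnesKaroubiCharacter.eq_of_commutator`), and this determinant is
bimultiplicative (`HasCommutatorDet`). A nowhere vanishing smooth function is `z^m e^{φ₁ + φ₂}` with
`φ₁` without negative and `φ₂` without positive frequencies (`exists_factorization`). Toeplitz
operators are multiplicative enough on these factors to lift the diagonal matrix of each factor to
an invertible matrix over `ℰ`, and three kinds of commutators remain.

* For `z` and `z` the commutator exchanges two orthogonal vectors, and its determinant is `-1`.
* For `e^f` and `z` it is a rank one perturbation of the identity, and its determinant is the mean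
  of `e^f`. Replacing `f` by `f / n` and taking the `n`-th power, the limit is the exponential of the
  mean of `f` (`eq_cexpUnit_mean`).
* For `e^f` and `e^g` with `f` analytic and `g` antianalytic it is the exponential of the trace
  `-∑ m f̂(m) ĝ(-m)` of the commutator of the Toeplitz operators of `f` and `g`. Instead of a
  determinant formula for exponentials of operators, the proof uses `f / n` and `g / n` and the
  `n²`-th power, for which Fredholm's series to first order suffices
  (`tendsto_det_toeplitzCommutator`, `hasCommutatorDet_expLift12_expLift13`). The error terms are
  dominated because the Fourier coefficients of `n (e^{f / n} - 1)` decay quadratically, uniformly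
  in `n`.

Finally the antisymmetrized pairing is the integral `(2πi)⁻¹ ∫ f dg` (`integral_mul_deriv_eq`), and
integrating the linear parts of the logarithms gives the remaining terms, up to an integral multiple
of `2πi` that depends on the branches (`log_integral_eq`).
-/

noncomputable section

set_option linter.unusedSectionVars false

namespace ConnesKaroubi

universe u

open Filter Topology

/-! ### Hadamard's inequality -/

section Hadamard

variable {E : Type*} [NormedAddCommGroup E] [InnerProductSpace ℂ E]

/-- Hadamard's inequality in an orthonormal basis. -/
theorem norm_orthonormalBasis_det_le {n : ℕ} (o : OrthonormalBasis (Fin n) ℂ E) (f : Fin n → E) :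
    ‖o.toBasis.det f‖ ≤ ∏ i, ‖f i‖ := by
  have : FiniteDimensional ℂ E := o.toBasis.finiteDimensional_of_finite
  have h : Module.finrank ℂ E = Fintype.card (Fin n) := Module.finrank_eq_card_basis o.toBasis
  set g := InnerProductSpace.gramSchmidtOrthonormalBasis h f
  have h1 := o.toBasis.det.eq_smul_basis_det g.toBasis
  rw [h1, AlternatingMap.smul_apply, smul_eq_mul, norm_mul, OrthonormalBasis.coe_toBasis,
    OrthonormalBasis.det_to_matrix_orthonormalBasis, one_mul,
    InnerProductSpace.gramSchmidtOrthonormalBasis_det, norm_prod]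
  refine Finset.prod_le_prod (fun i _ => norm_nonneg _) fun i _ => ?_
  refine (norm_inner_le_norm _ _).trans ?_
  rw [g.orthonormal.1 i, one_mul]

/-- If `v` is linearly independent, both families may be projected to the span of `v`, where
the Gram matrix is a product of two coordinate matrices. For dependent `v` the determinant
vanishes. -/
theorem norm_det_inner_le_fin {n : ℕ} (v w : Fin n → E) :
    ‖Matrix.det (Matrix.of fun i j => ⟪v i, w j⟫_ℂ)‖ ≤ ∏ i, ‖v i‖ * ‖w i‖ := by
  by_cases hv : LinearIndependent ℂ v
  · let U := Submodule.span ℂ (Set.range v)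
    have : FiniteDimensional ℂ U := FiniteDimensional.span_of_finite ℂ (Set.finite_range v)
    have hfin : Module.finrank ℂ U = n := by
      rw [finrank_span_eq_card hv, Fintype.card_fin]
    let o : OrthonormalBasis (Fin n) ℂ U := (stdOrthonormalBasis ℂ U).reindex (finCongr hfin)
    let v' : Fin n → U := fun i => ⟨v i, Submodule.subset_span ⟨i, rfl⟩⟩
    let w' : Fin n → U := fun i => U.orthogonalProjectionOnto (w i)
    have key : Matrix.of (fun i j => ⟪v i, w j⟫_ℂ)
        = (o.toBasis.toMatrix v').conjTranspose * o.toBasis.toMatrix w' := by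
      ext i j
      rw [Matrix.mul_apply]
      have h1 : ⟪v i, w j⟫_ℂ = ⟪v' i, w' j⟫_ℂ := by
        have := Submodule.inner_orthogonalProjectionOnto_eq_of_mem_right (K := U) (v' i) (w j)
        rw [Submodule.coe_inner]
        exact (Submodule.inner_orthogonalProjectionOnto_eq_of_mem_left (v' i) (w j)).symm
      rw [Matrix.of_apply, h1, ← o.sum_inner_mul_inner]
      refine Finset.sum_congr rfl fun k _ => ?_
      simp only [Matrix.conjTranspose_apply, Module.Basis.toMatrix_apply,
        OrthonormalBasis.coe_toBasis_repr_apply, OrthonormalBasis.repr_apply_apply, RCLike.star_def,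
        inner_conj_symm]
    rw [key, Matrix.det_mul, Matrix.det_conjTranspose, norm_mul, norm_star, Finset.prod_mul_distrib,
      ← Module.Basis.det_apply, ← Module.Basis.det_apply]
    refine mul_le_mul (norm_orthonormalBasis_det_le o v') ?_ (norm_nonneg _)
      (Finset.prod_nonneg fun i _ => norm_nonneg _)
    refine (norm_orthonormalBasis_det_le o w').trans ?_
    exact Finset.prod_le_prod (fun i _ => norm_nonneg _) fun i _ =>
      U.norm_orthogonalProjectionOnto_apply_le (w i)
  · rw [Fintype.linearIndependent_iff] at hv
    push Not at hv
    obtain ⟨c, hc, i₀, hi₀⟩ := hv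
    have : Matrix.det (Matrix.of fun i j => ⟪v i, w j⟫_ℂ) = 0 := by
      -- a relation `∑ cᵢ vᵢ = 0` gives the relation between the rows with coefficients `conj cᵢ`,
      -- the inner product being antilinear in its first argument
      refine Matrix.exists_vecMul_eq_zero_iff.1 ⟨fun i => starRingEnd ℂ (c i), ?_, ?_⟩
      · intro h
        exact hi₀ (by simpa using congrFun h i₀)
      · ext j
        have h2 : ⟪∑ i, c i • v i, w j⟫_ℂ = 0 := by rw [hc, inner_zero_left]
        rw [sum_inner] at h2
        simpa [Matrix.vecMul, dotProduct, inner_smul_left] using h2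
    rw [this, norm_zero]
    exact Finset.prod_nonneg fun i _ => by positivity

/-- Hadamard's inequality for mixed Gram determinants. -/
theorem norm_det_inner_le {ι : Type*} [Fintype ι] [DecidableEq ι] (v w : ι → E) :
    ‖Matrix.det (Matrix.of fun i j => ⟪v i, w j⟫_ℂ)‖ ≤ ∏ i, ‖v i‖ * ‖w i‖ := by
  let e := (Fintype.equivFin ι).symm
  rw [← Matrix.det_submatrix_equiv_self e, ← Equiv.prod_comp e]
  exact norm_det_inner_le_fin (v ∘ e) (w ∘ e)

end Hadamard

/-! ### Finite sections of nuclear operators -/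

section MinorSum

variable {ι : Type*}

open Classical in
/-- The principal minor of an infinite matrix on a finite set of indices. -/
def principalMinor (G : ι → ι → ℂ) (s : Finset ι) : ℂ :=
  Matrix.det (Matrix.of fun i j : s => G i j)

/-- Fredholm's series for the determinant of `1 + G`: the sum of all principal minors of `G`. -/
def minorSum (G : ι → ι → ℂ) : ℂ := ∑' s : Finset ι, principalMinor G s

theorem principalMinor_inner_le {E : Type*} [NormedAddCommGroup E] [InnerProductSpace ℂ E]
    (v w : ι → E) (s : Finset ι) :
    ‖principalMinor (fun i j => ⟪v i, w j⟫_ℂ) s‖ ≤ ∏ i ∈ s, ‖v i‖ * ‖w i‖ := by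
  classical
  rw [← Finset.prod_coe_sort s fun i => ‖v i‖ * ‖w i‖, principalMinor]
  convert norm_det_inner_le (fun i : s => v i) (fun i : s => w i)

theorem tendsto_principalMinor {α : Type*} {l : Filter α} {G : α → ι → ι → ℂ} {G' : ι → ι → ℂ}
    (hG : ∀ i j, Tendsto (fun a => G a i j) l (𝓝 (G' i j))) (s : Finset ι) :
    Tendsto (fun a => principalMinor (G a) s) l (𝓝 (principalMinor G' s)) := by
  classical
  refine ((continuous_id.matrix_det).tendsto _).comp ?_
  exact tendsto_pi_nhds.2 fun i => tendsto_pi_nhds.2 fun j => hG i j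

/-- Continuity of Fredholm's series in the entries, along families whose minors admit a common
multiplicative bound. Such bounds come from Hadamard's inequality, `principalMinor_inner_le`. -/
theorem tendsto_minorSum {α : Type*} {l : Filter α} {G : α → ι → ι → ℂ} {G' : ι → ι → ℂ}
    {c : ι → ℝ} (hc : Summable c) (h0 : ∀ i, 0 ≤ c i)
    (hG : ∀ i j, Tendsto (fun a => G a i j) l (𝓝 (G' i j)))
    (hb : ∀ a s, ‖principalMinor (G a) s‖ ≤ ∏ i ∈ s, c i) :
    Tendsto (fun a => minorSum (G a)) l (𝓝 (minorSum G')) :=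
  tendsto_tsum_of_dominated_convergence (summable_finsetProd_of_summable_nonneg h0 hc)
    (tendsto_principalMinor hG) (Eventually.of_forall hb)

theorem principalMinor_empty (G : ι → ι → ℂ) : principalMinor G ∅ = 1 := by
  classical
  unfold principalMinor
  convert Matrix.det_isEmpty (n := (∅ : Finset ι)) (R := ℂ)

theorem principalMinor_singleton (G : ι → ι → ℂ) (i : ι) : principalMinor G {i} = G i i := by
  classical
  unfold principalMinor
  convert Matrix.det_eq_elem_of_card_eq_one (n := ({i} : Finset ι)) (R := ℂ)
    (A := Matrix.of fun a b : ({i} : Finset ι) => G a b) (by simp)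
    ⟨i, Finset.mem_singleton_self i⟩ using 1
  rfl

theorem principalMinor_smul (ε : ℂ) (G : ι → ι → ℂ) (s : Finset ι) :
    principalMinor (fun i j => ε * G i j) s = ε ^ s.card * principalMinor G s := by
  classical
  rw [principalMinor, principalMinor, ← Fintype.card_coe s, ← Matrix.det_smul]
  rfl

/-- First order expansion of Fredholm's series, uniformly over a dominated family. -/
theorem tendsto_minorSum_smul {α : Type*} {l : Filter α} {G : α → ι → ι → ℂ} {G' : ι → ι → ℂ}
    {c : ι → ℝ} (hc : Summable c) (h0 : ∀ i, 0 ≤ c i)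
    (hG : ∀ i j, Tendsto (fun a => G a i j) l (𝓝 (G' i j)))
    (hb : ∀ a s, ‖principalMinor (G a) s‖ ≤ ∏ i ∈ s, c i)
    {ε : α → ℂ} (hε : Tendsto ε l (𝓝 0)) (hε0 : ∀ a, ε a ≠ 0) (hε1 : ∀ a, ‖ε a‖ ≤ 1) :
    Tendsto (fun a => (ε a)⁻¹ * (minorSum (fun i j => ε a * G a i j) - 1)) l
      (𝓝 (∑' i, G' i i)) := by
  classical
  have hsum := summable_finsetProd_of_summable_nonneg h0 hc
  -- the terms of the normalized series, without the empty minor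
  let F : α → Finset ι → ℂ := fun a s =>
    if s = ∅ then 0 else (ε a) ^ (s.card - 1) * principalMinor (G a) s
  let F' : Finset ι → ℂ := fun s => if s.card = 1 then principalMinor G' s else 0
  have hF : Tendsto (fun a => ∑' s, F a s) l (𝓝 (∑' s, F' s)) := by
    refine tendsto_tsum_of_dominated_convergence hsum (fun s => ?_)
      (Eventually.of_forall fun a s => ?_)
    · by_cases hs : s = ∅
      · simpa [F, F', hs] using tendsto_const_nhds
      · have hcard : 0 < s.card := Finset.card_pos.2 (Finset.nonempty_iff_ne_empty.2 hs)
        simp only [F, F', if_neg hs]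
        have h1 := (hε.pow (s.card - 1)).mul (tendsto_principalMinor hG s)
        by_cases h : s.card = 1
        · simpa [h] using h1
        · have : s.card - 1 ≠ 0 := by omega
          simpa [h, zero_pow this] using h1
    · by_cases hs : s = ∅
      · simp [F, hs]
      · simp only [F, if_neg hs, norm_mul, norm_pow]
        calc _ ≤ 1 * ∏ i ∈ s, c i :=
              mul_le_mul (pow_le_one₀ (norm_nonneg _) (hε1 a)) (hb a s) (norm_nonneg _) zero_le_one
          _ = _ := one_mul _
  -- only the minors of size one survive in the limit, and they sum to the trace
  have e1 : ∑' s, F' s = ∑' i, G' i i := by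
    have hinj : Function.Injective fun i : ι => ({i} : Finset ι) := Finset.singleton_injective
    rw [← hinj.tsum_eq]
    · exact tsum_congr fun i => by simp [F', principalMinor_singleton]
    · intro s hs
      have : s.card = 1 := by
        by_contra h
        exact hs (by simp [F', h])
      obtain ⟨i, rfl⟩ := Finset.card_eq_one.1 this
      exact ⟨i, rfl⟩
  have e2 : ∀ a, (ε a)⁻¹ * (minorSum (fun i j => ε a * G a i j) - 1) = ∑' s, F a s := fun a => by
    have hs : Summable fun s => principalMinor (fun i j => ε a * G a i j) s := by
      refine Summable.of_norm_bounded hsum fun s => ?_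
      rw [principalMinor_smul, norm_mul, norm_pow]
      calc _ ≤ 1 * ∏ i ∈ s, c i :=
            mul_le_mul (pow_le_one₀ (norm_nonneg _) (hε1 a)) (hb a s) (norm_nonneg _) zero_le_one
        _ = _ := one_mul _
    rw [minorSum, hs.tsum_eq_add_tsum_ite ∅, principalMinor_empty, add_sub_cancel_left,
      ← tsum_mul_left]
    refine tsum_congr fun s => ?_
    by_cases h : s = ∅
    · simp [F, h]
    · simp only [F, if_neg h, principalMinor_smul]
      have hcard : 0 < s.card := Finset.card_pos.2 (Finset.nonempty_iff_ne_empty.2 h)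
      conv_lhs => rw [show s.card = (s.card - 1) + 1 by omega, pow_succ]
      field_simp [hε0 a]
  rw [← e1]
  exact hF.congr fun a => (e2 a).symm

/-- Expansion of `det (1 + M)` by multilinearity in the rows. -/
theorem det_one_add_eq_sum {n : Type*} [Fintype n] [DecidableEq n] (M : Matrix n n ℂ) :
    (1 + M).det = ∑ s : Finset n, principalMinor M s := by
  rw [add_comm]
  have h := (Matrix.detRowAlternating (n := n) (R := ℂ)).map_add_univ M (1 : Matrix n n ℂ)
  refine Eq.trans h ?_
  refine Finset.sum_congr rfl fun s _ => ?_
  have := Matrix.det_piecewise_one_eq_submatrix_det M s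
  unfold principalMinor
  convert this using 1
  · rfl
  · congr!

theorem sum_powerset_principalMinor (G : ι → ι → ℂ) (S : Finset ι) [DecidableEq S] :
    ∑ s ∈ S.powerset, principalMinor G s
      = (1 + Matrix.of fun i j : S => G i j).det := by
  classical
  rw [det_one_add_eq_sum]
  symm
  refine Finset.sum_bij (fun s _ => s.map (Function.Embedding.subtype _)) ?_ ?_ ?_ ?_
  · intro s _
    rw [Finset.mem_powerset]
    intro i hi
    obtain ⟨j, -, rfl⟩ := Finset.mem_map.1 hi
    exact j.2
  · intro s _ t _ h
    exact Finset.map_injective _ h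
  · intro s hs
    rw [Finset.mem_powerset] at hs
    refine ⟨s.subtype (· ∈ S), Finset.mem_univ _, ?_⟩
    rw [Finset.subtype_map]
    exact Finset.filter_true_of_mem hs
  · intro s _
    unfold principalMinor
    let e : s ≃ (s.map (Function.Embedding.subtype fun i => i ∈ S)) := Equiv.ofBijective
      (fun i => ⟨i, Finset.mem_map_of_mem _ i.2⟩) ⟨fun i j h =>
        Subtype.ext (Subtype.ext (Subtype.mk.inj h)), fun ⟨j, hj⟩ => by
        obtain ⟨k, hk, rfl⟩ := Finset.mem_map.1 hj
        exact ⟨⟨k, hk⟩, rfl⟩⟩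
    rw [← Matrix.det_submatrix_equiv_self e]
    congr!

/-- Fredholm's series computes the determinant of a matrix written as a sum of rank one matrices. -/
theorem det_one_add_tsum_eq_minorSum {τ : Type*} [Fintype τ] [DecidableEq τ]
    (v w : ι → EuclideanSpace ℂ τ) (h : Summable fun i => ‖v i‖ * ‖w i‖) :
    (1 + Matrix.of fun a b : τ => ∑' i, w i a * starRingEnd ℂ (v i b)).det
      = minorSum fun i j => ⟪v i, w j⟫_ℂ := by
  classical
  have hs : Summable fun s => principalMinor (fun i j => ⟪v i, w j⟫_ℂ) s :=
    Summable.of_norm_bounded (summable_finsetProd_of_summable_nonneg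
      (fun i => by positivity) h) (principalMinor_inner_le v w)
  have h1 := hs.hasSum.comp tendsto_finset_powerset_atTop_atTop
  refine tendsto_nhds_unique ?_ h1
  have h2 : Tendsto (fun S : Finset ι =>
      (1 + Matrix.of fun a b : τ => ∑ i ∈ S, w i a * starRingEnd ℂ (v i b)).det) atTop
      (𝓝 (1 + Matrix.of fun a b : τ => ∑' i, w i a * starRingEnd ℂ (v i b)).det) := by
    refine ((continuous_id.matrix_det).tendsto _).comp ?_
    refine tendsto_pi_nhds.2 fun a => tendsto_pi_nhds.2 fun b => ?_
    refine Tendsto.const_add _ ?_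
    refine (Summable.of_norm_bounded h fun i => ?_).hasSum
    rw [norm_mul, RCLike.norm_conj, mul_comm]
    exact mul_le_mul (PiLp.norm_apply_le _ _) (PiLp.norm_apply_le _ _) (norm_nonneg _)
      (norm_nonneg _)
  refine h2.congr fun S => ?_
  simp only [Function.comp_apply]
  rw [sum_powerset_principalMinor]
  -- a finite partial sum is `A * B` with `B * A` the Gram matrix, and `det (1 + A B) = det (1 + B A)`
  let A : Matrix τ S ℂ := Matrix.of fun a i => w i a
  let B : Matrix S τ ℂ := Matrix.of fun i b => starRingEnd ℂ (v i b)
  have e1 : (Matrix.of fun a b : τ => ∑ i ∈ S, w i a * starRingEnd ℂ (v i b)) = A * B := by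
    ext a b
    rw [Matrix.mul_apply]
    exact (Finset.sum_coe_sort S fun i => w i a * starRingEnd ℂ (v i b)).symm
  have e2 : (Matrix.of fun i j : S => ⟪v i, w j⟫_ℂ) = B * A := by
    ext i j
    rw [Matrix.mul_apply, Matrix.of_apply, PiLp.inner_apply]
    exact Finset.sum_congr rfl fun b _ => by simp [A, B, mul_comm]
  rw [e1, e2, Matrix.det_one_add_mul_comm]

end MinorSum

/-! ### The determinant of a nuclear perturbation of the identity -/

section FredholmDet

variable {E : Type u} [NormedAddCommGroup E] [InnerProductSpace ℂ E] [CompleteSpace E]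

open Classical in
/-- The determinants of the finite sections of `1 + ∑ᵢ ⟪vᵢ, ·⟫ wᵢ` converge to Fredholm's series.
The functionals `vt t i` may vary with the section `t`; this freedom is used for products, see
`IsNuclearDet.mul_of_hilbertBasis`. -/
theorem tendsto_det_section {κ ι : Type*} (c : HilbertBasis κ ℂ E) {v w : ι → E}
    {vt : Finset κ → ι → E} {C : ι → ℝ} (hC : Summable C)
    (hv : ∀ i, Tendsto (fun t => vt t i) atTop (𝓝 (v i)))
    (hb : ∀ t i, ‖vt t i‖ * ‖w i‖ ≤ C i) :
    Tendsto (fun t : Finset κ => (1 + Matrix.of fun a b : t =>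
      ∑' i, ⟪c a, w i⟫_ℂ * ⟪vt t i, c b⟫_ℂ).det) atTop
      (𝓝 (minorSum fun i j => ⟪v i, w j⟫_ℂ)) := by
  have hC0 : ∀ i, 0 ≤ C i := fun i => le_trans (by positivity) (hb ∅ i)
  -- coordinates of a vector in the finite section
  let co : (t : Finset κ) → E → EuclideanSpace ℂ t := fun t x =>
    WithLp.toLp 2 fun k : t => ⟪c k, x⟫_ℂ
  have hco : ∀ t x, ‖co t x‖ ≤ ‖x‖ := fun t x => by
    refine (sq_le_sq₀ (norm_nonneg _) (norm_nonneg _)).1 ?_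
    rw [EuclideanSpace.norm_sq_eq]
    have := c.orthonormal.sum_inner_products_le x (s := t)
    rw [← Finset.sum_coe_sort] at this
    exact this
  have hin : ∀ t x y, ⟪co t x, co t y⟫_ℂ = ∑ k ∈ t, ⟪x, c k⟫_ℂ * ⟪c k, y⟫_ℂ := fun t x y => by
    rw [PiLp.inner_apply, ← Finset.sum_coe_sort t fun k => ⟪x, c k⟫_ℂ * ⟪c k, y⟫_ℂ]
    refine Finset.sum_congr rfl fun k _ => ?_
    simp [co, mul_comm]
  have hdet : ∀ t : Finset κ, (1 + Matrix.of fun a b : t =>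
      ∑' i, ⟪c a, w i⟫_ℂ * ⟪vt t i, c b⟫_ℂ).det
        = minorSum fun i j => ⟪co t (vt t i), co t (w j)⟫_ℂ := fun t => by
    rw [← det_one_add_tsum_eq_minorSum]
    · congr! 7
      simp [co]
    · refine Summable.of_nonneg_of_le (fun i => by positivity) (fun i => ?_) hC
      exact (mul_le_mul (hco _ _) (hco _ _) (norm_nonneg _) (norm_nonneg _)).trans (hb t i)
  refine Tendsto.congr (fun t => (hdet t).symm) ?_
  refine tendsto_minorSum hC hC0 (fun i j => ?_) fun t s => ?_
  · have h1 : Tendsto (fun t : Finset κ => ∑ k ∈ t, ⟪c k, w j⟫_ℂ • c k) atTop (𝓝 (w j)) := by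
      have := c.hasSum_repr (w j)
      simp only [c.repr_apply_apply] at this
      exact this
    refine ((hv i).inner h1).congr fun t => ?_
    rw [hin, inner_sum]
    exact Finset.sum_congr rfl fun k _ => by rw [inner_smul_right, mul_comm]
  · refine (principalMinor_inner_le _ _ s).trans (Finset.prod_le_prod (fun i _ => by positivity)
      fun i _ => ?_)
    exact (mul_le_mul (hco _ _) (hco _ _) (norm_nonneg _) (norm_nonneg _)).trans (hb t i)

/-- The Fredholm determinant of the operator `A`, which differs from the identity by a trace class
operator, is `d`. The determinant is computed by Fredholm's series in terms of a nuclear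
representation `A - 1 = ∑ᵢ ⟪vᵢ, ·⟫ wᵢ`; see `IsNuclearDet.unique` for the independence of the
representation. -/
def IsNuclearDet (A : E →L[ℂ] E) (d : ℂ) : Prop :=
  ∃ (ι : Type u) (v w : ι → E), (Summable fun i => ‖v i‖ * ‖w i‖) ∧
    (∀ x, HasSum (fun i => ⟪v i, x⟫_ℂ • w i) (A x - x)) ∧
    minorSum (fun i j => ⟪v i, w j⟫_ℂ) = d

theorem exists_isNuclearDet {A : E →L[ℂ] E} (hA : IsTraceClass (A - 1)) :
    ∃ d, IsNuclearDet A d := by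
  obtain ⟨ι, v, w, h, hx⟩ := hA
  exact ⟨_, ι, v, w, h, hx, rfl⟩

theorem inner_section_eq {A : E →L[ℂ] E} {ι : Type*} {v w : ι → E}
    (hx : ∀ x, HasSum (fun i => ⟪v i, x⟫_ℂ • w i) (A x - x)) (a b : E) :
    HasSum (fun i => ⟪a, w i⟫_ℂ * ⟪v i, b⟫_ℂ) (⟪a, A b⟫_ℂ - ⟪a, b⟫_ℂ) := by
  have h := (innerSL ℂ a).hasSum (hx b)
  simp only [innerSL_apply_apply, inner_smul_right, inner_sub_right] at h
  exact h.congr_fun fun i => mul_comm _ _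

theorem inner_hilbertBasis_eq_one {κ : Type*} (c : HilbertBasis κ ℂ E) {t : Finset κ}
    [DecidableEq t] (a b : t) : ⟪c a, c b⟫_ℂ = (1 : Matrix t t ℂ) a b := by
  by_cases h : a = b
  · subst h
    rw [Matrix.one_apply_eq, inner_self_eq_norm_sq_to_K, c.orthonormal.1]
    simp
  · rw [Matrix.one_apply_ne h]
    exact c.orthonormal.2 fun h' => h (Subtype.ext h')

open Classical in
/-- The Fredholm determinant is the limit of the determinants of the finite sections in any
orthonormal basis. -/
theorem IsNuclearDet.tendsto {A : E →L[ℂ] E} {d : ℂ} (hA : IsNuclearDet A d) {κ : Type*}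
    (c : HilbertBasis κ ℂ E) :
    Tendsto (fun t : Finset κ => (Matrix.of fun a b : t => ⟪c a, A (c b)⟫_ℂ).det) atTop (𝓝 d) := by
  obtain ⟨ι, v, w, h, hx, rfl⟩ := hA
  refine (tendsto_det_section c (vt := fun _ => v) h (fun i => tendsto_const_nhds)
    fun t i => le_rfl).congr fun t => ?_
  congr 1
  ext a b
  rw [Matrix.add_apply, Matrix.of_apply, (inner_section_eq hx _ _).tsum_eq, Matrix.of_apply]
  rw [inner_hilbertBasis_eq_one]
  ring

theorem IsNuclearDet.unique {A : E →L[ℂ] E} {d d' : ℂ} (h : IsNuclearDet A d)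
    (h' : IsNuclearDet A d') : d = d' := by
  obtain ⟨w, c, -⟩ := exists_hilbertBasis ℂ E
  exact tendsto_nhds_unique (h.tendsto c) (h'.tendsto c)

theorem isNuclearDet_one : IsNuclearDet (1 : E →L[ℂ] E) 1 := by
  refine ⟨PEmpty, PEmpty.elim, PEmpty.elim, summable_empty, fun x => by simp, ?_⟩
  rw [minorSum, tsum_eq_single ∅, principalMinor_empty]
  intro s hs
  exact absurd (Finset.eq_empty_of_isEmpty s) hs

/-- Multiplicativity, in the presence of a basis. If `P` is the projection onto finitely many basis
vectors, the product of the determinants of the sections of `A` and `B` by `P` is the determinant of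
the section of `A + B - 1 + (A - 1) P (B - 1)`, which tends to `A B` as `P` tends to `1`. -/
theorem IsNuclearDet.mul_of_hilbertBasis {κ : Type*} (c : HilbertBasis κ ℂ E) {A B : E →L[ℂ] E}
    {d e : ℂ} (hA : IsNuclearDet A d) (hB : IsNuclearDet B e) :
    IsNuclearDet (A * B) (d * e) := by
  classical
  have hlim := (hA.tendsto c).mul (hB.tendsto c)
  obtain ⟨ι, v, w, h, hx, rfl⟩ := hA
  obtain ⟨ι', v', w', h', hx', rfl⟩ := hB
  let L : E →L[ℂ] E := B - 1
  have hL : ∀ x, L x = B x - x := fun x => rfl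
  let pr : Finset κ → E → E := fun t x => ∑ k ∈ t, ⟪c k, x⟫_ℂ • c k
  have hpr : ∀ x, Tendsto (fun t => pr t x) atTop (𝓝 x) := fun x => by
    have := c.hasSum_repr x
    simp only [c.repr_apply_apply] at this
    exact this
  have hprn : ∀ t x, ‖pr t x‖ ≤ ‖x‖ := fun t x => by
    refine (sq_le_sq₀ (norm_nonneg _) (norm_nonneg _)).1 ?_
    have h1 : ‖pr t x‖ ^ 2 = ∑ k ∈ t, ‖⟪c k, x⟫_ℂ‖ ^ 2 := by
      have h2 := c.orthonormal.inner_sum (fun k => ⟪c k, x⟫_ℂ) (fun k => ⟪c k, x⟫_ℂ) t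
      rw [inner_self_eq_norm_sq_to_K] at h2
      simp only [Complex.conj_mul'] at h2
      refine Complex.ofReal_injective ?_
      rw [Complex.ofReal_pow, Complex.ofReal_sum]
      simp only [Complex.ofReal_pow]
      exact h2
    rw [h1]
    exact c.orthonormal.sum_inner_products_le x
  -- `(A - 1) (1 + P L) + L`, with `L = B - 1`, as a sum of rank one operators; `v''` is the limit
  -- of `vt t` as `P` tends to the identity
  let vt : Finset κ → ι ⊕ ι' → E := fun t => Sum.elim (fun i => v i + L.adjoint (pr t (v i))) v'
  let v'' : ι ⊕ ι' → E := Sum.elim (fun i => v i + L.adjoint (v i)) v'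
  let w'' : ι ⊕ ι' → E := Sum.elim w w'
  let C : ι ⊕ ι' → ℝ := Sum.elim (fun i => (1 + ‖L.adjoint‖) * (‖v i‖ * ‖w i‖))
    fun i => ‖v' i‖ * ‖w' i‖
  have hC : Summable C :=
    Summable.sum (f := C) (h.mul_left _) h'
  have hbd : ∀ x i, ‖x‖ ≤ ‖v i‖ → ‖v i + L.adjoint x‖ * ‖w i‖ ≤ C (Sum.inl i) := fun x i hxi => by
    change _ ≤ (1 + ‖L.adjoint‖) * (‖v i‖ * ‖w i‖)
    rw [← mul_assoc]
    refine mul_le_mul_of_nonneg_right ?_ (norm_nonneg _)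
    refine (norm_add_le _ _).trans ?_
    have := (L.adjoint.le_opNorm x).trans (mul_le_mul_of_nonneg_left hxi (norm_nonneg _))
    linarith
  have hsec := tendsto_det_section c (v := v'') (w := w'') (vt := vt) hC (by
    rintro (i | i)
    · exact tendsto_const_nhds.add ((L.adjoint.continuous.tendsto _).comp (hpr (v i)))
    · exact tendsto_const_nhds) (by
    rintro t (i | i)
    · exact hbd _ i (hprn t _)
    · exact le_rfl)
  refine ⟨ι ⊕ ι', v'', w'', ?_, ?_, ?_⟩
  · refine Summable.of_nonneg_of_le (fun i => by positivity) ?_ hC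
    rintro (i | i)
    · exact hbd _ i le_rfl
    · exact le_rfl
  · intro x
    have h1 := hx (x + L x)
    have h2 := hx' x
    have h3 : (A * B) x - x = (A (x + L x) - (x + L x)) + (B x - x) := by
      rw [hL]; simp
    rw [h3]
    refine HasSum.sum (f := fun i => ⟪v'' i, x⟫_ℂ • w'' i) (h1.congr_fun fun i => ?_) h2
    change ⟪v i + L.adjoint (v i), x⟫_ℂ • w i = _
    rw [inner_add_left, ContinuousLinearMap.adjoint_inner_left, inner_add_right]
  · refine tendsto_nhds_unique hsec (hlim.congr fun t => ?_)
    rw [← Matrix.det_mul]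
    congr 1
    ext a b
    have hone : ∀ a b : t, ⟪c a, c b⟫_ℂ = (1 : Matrix t t ℂ) a b :=
      inner_hilbertBasis_eq_one c
    have hs : HasSum (fun i => ⟪c a, w'' i⟫_ℂ * ⟪vt t i, c b⟫_ℂ)
        ((⟪c a, A (c b + pr t (L (c b)))⟫_ℂ - ⟪c a, c b + pr t (L (c b))⟫_ℂ)
          + (⟪c a, B (c b)⟫_ℂ - ⟪c a, c b⟫_ℂ)) := by
      refine HasSum.sum (f := fun i => ⟪c a, w'' i⟫_ℂ * ⟪vt t i, c b⟫_ℂ)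
        ((inner_section_eq hx (c a) (c b + pr t (L (c b)))).congr_fun fun i => ?_)
        (inner_section_eq hx' (c a) (c b))
      change ⟪c a, w i⟫_ℂ * ⟪v i + L.adjoint (pr t (v i)), c b⟫_ℂ = _
      rw [inner_add_left, ContinuousLinearMap.adjoint_inner_left, inner_add_right]
      congr 2
      simp only [pr, sum_inner, inner_sum, inner_smul_left, inner_smul_right, inner_conj_symm]
      exact Finset.sum_congr rfl fun k _ => mul_comm _ _
    rw [Matrix.add_apply, Matrix.of_apply, hs.tsum_eq, Matrix.mul_apply]
    have e1 : ∀ k : t, ⟪c k, B (c b)⟫_ℂ = (1 : Matrix t t ℂ) k b + ⟪c k, L (c b)⟫_ℂ := fun k => by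
      rw [hL, inner_sub_right, hone]; ring
    have e2 : ∀ z : E, ⟪z, pr t (L (c b))⟫_ℂ = ∑ k : t, ⟪z, c k⟫_ℂ * ⟪c k, L (c b)⟫_ℂ := fun z => by
      simp only [pr, inner_sum, inner_smul_right]
      rw [← Finset.sum_coe_sort]
      exact Finset.sum_congr rfl fun k _ => mul_comm _ _
    have e3 : ⟪c a, A (pr t (L (c b)))⟫_ℂ = ∑ k : t, ⟪c a, A (c k)⟫_ℂ * ⟪c k, L (c b)⟫_ℂ := by
      rw [← ContinuousLinearMap.adjoint_inner_left, e2]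
      simp only [ContinuousLinearMap.adjoint_inner_left]
    simp only [Matrix.of_apply]
    simp only [e1, mul_add, Finset.sum_add_distrib, map_add, inner_add_right, e3, e2, hone,
      Matrix.one_apply, mul_ite, ite_mul, mul_one, mul_zero, one_mul, zero_mul,
      Finset.sum_ite_eq, Finset.sum_ite_eq', Finset.mem_univ, if_true]
    ring

theorem IsNuclearDet.mul {A B : E →L[ℂ] E} {d e : ℂ} (hA : IsNuclearDet A d)
    (hB : IsNuclearDet B e) : IsNuclearDet (A * B) (d * e) := by
  obtain ⟨κ, c, -⟩ := exists_hilbertBasis ℂ E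
  exact hA.mul_of_hilbertBasis c hB

/-- Conjugation by a bounded invertible operator does not change the Gram matrix of a nuclear
representation. -/
theorem IsNuclearDet.conj {A B B' : E →L[ℂ] E} {d : ℂ} (hA : IsNuclearDet A d)
    (h1 : B * B' = 1) (h2 : B' * B = 1) : IsNuclearDet (B * A * B') d := by
  obtain ⟨ι, v, w, h, hx, rfl⟩ := hA
  have e1 : ∀ x, B (B' x) = x := fun x => DFunLike.congr_fun h1 x
  have e2 : ∀ x, B' (B x) = x := fun x => DFunLike.congr_fun h2 x
  refine ⟨ι, fun i => B'.adjoint (v i), fun i => B (w i), ?_, fun x => ?_, ?_⟩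
  · refine Summable.of_nonneg_of_le (fun i => by positivity) (fun i => ?_)
      (h.mul_left (‖B'.adjoint‖ * ‖B‖))
    rw [mul_mul_mul_comm]
    exact mul_le_mul (ContinuousLinearMap.le_opNorm _ _) (ContinuousLinearMap.le_opNorm _ _)
      (norm_nonneg _) (by positivity)
  · have h3 := B.hasSum (hx (B' x))
    simp only [map_smul, map_sub, e1] at h3
    simp only [ContinuousLinearMap.adjoint_inner_left]
    exact h3
  · simp only [ContinuousLinearMap.adjoint_inner_left, e2]

theorem isNuclearDet_rankOne {A : E →L[ℂ] E} (v w : E) (hA : ∀ x, A x = x + ⟪v, x⟫_ℂ • w) :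
    IsNuclearDet A (1 + ⟪v, w⟫_ℂ) := by
  refine ⟨PUnit, fun _ => v, fun _ => w, Summable.of_finite, fun x => ?_, ?_⟩
  · rw [hA, add_sub_cancel_left]
    simp
  · have h := det_one_add_eq_sum fun _ _ : PUnit.{u + 1} => ⟪v, w⟫_ℂ
    rw [minorSum, tsum_fintype, ← h, Matrix.det_unique]
    rfl

end FredholmDet

/-! ### Stable matrices of operators as operators on the sum of countably many copies -/

section SumSpace

variable {E : Type u} [NormedAddCommGroup E] [InnerProductSpace ℂ E] [CompleteSpace E]

variable (E) in
/-- The Hilbert space `E ⊕ E ⊕ ⋯`. -/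
abbrev SumSpace : Type u := lp (fun _ : ℕ => E) 2

/-- The inclusion of the `m`-th summand. -/
def inclusion (m : ℕ) : E →L[ℂ] SumSpace E :=
  lp.singleContinuousLinearMap ℂ (fun _ : ℕ => E) 2 m

/-- The projection to the `m`-th summand. -/
def coordinate (m : ℕ) : SumSpace E →L[ℂ] E := lp.evalCLM ℂ (fun _ : ℕ => E) 2 m

theorem coordinate_apply (m : ℕ) (z : SumSpace E) : coordinate m z = z m := rfl

theorem inclusion_apply (m n : ℕ) (x : E) :
    (inclusion m x : SumSpace E) n = if n = m then x else 0 := by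
  change lp.single (E := fun _ : ℕ => E) 2 m x n = _
  rw [lp.single_apply, Pi.single_apply]

theorem inner_inclusion_left (m : ℕ) (x : E) (z : SumSpace E) :
    ⟪inclusion m x, z⟫_ℂ = ⟪x, z m⟫_ℂ :=
  lp.inner_single_left m x z

theorem norm_inclusion (m : ℕ) (x : E) : ‖(inclusion m x : SumSpace E)‖ = ‖x‖ :=
  lp.norm_single (E := fun _ : ℕ => E) (p := 2) (by norm_num) m x

theorem orthonormal_inclusion {ι : Type*} (b : HilbertBasis ι ℂ E) :
    Orthonormal ℂ fun p : ℕ × ι => (inclusion p.1 (b p.2) : SumSpace E) := by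
  refine ⟨fun p => by rw [norm_inclusion, b.orthonormal.1], fun p q hpq => ?_⟩
  change ⟪inclusion p.1 (b p.2), inclusion q.1 (b q.2)⟫_ℂ = 0
  rw [inner_inclusion_left, inclusion_apply]
  split_ifs with h
  · exact b.orthonormal.2 fun h' => hpq (Prod.ext h h')
  · exact inner_zero_right _

/-- The orthonormal basis of `E ⊕ E ⊕ ⋯` consisting of copies of an orthonormal basis of `E`. -/
def sumBasis {ι : Type*} (b : HilbertBasis ι ℂ E) : HilbertBasis (ℕ × ι) ℂ (SumSpace E) :=
  HilbertBasis.mkOfOrthogonalEqBot (orthonormal_inclusion b)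
    (by
      rw [Submodule.eq_bot_iff]
      intro z hz
      ext m
      have h : ∀ i, b.repr (z m) i = 0 := fun i => by
        rw [b.repr_apply_apply, ← inner_inclusion_left]
        exact (Submodule.mem_orthogonal _ _).1 hz _ (Submodule.subset_span ⟨(m, i), rfl⟩)
      have h' : b.repr (z m) = 0 := lp.ext (funext h)
      simpa using h')

theorem sumBasis_apply {ι : Type*} (b : HilbertBasis ι ℂ E) (p : ℕ × ι) :
    sumBasis b p = inclusion p.1 (b p.2) := by
  rw [sumBasis, HilbertBasis.coe_mkOfOrthogonalEqBot]

/-- The operator on `E ⊕ E ⊕ ⋯` defined by a stable matrix of operators on `E`. -/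
def toOperatorFun (X : StableMatrix (E →L[ℂ] E)) : SumSpace E →L[ℂ] SumSpace E :=
  1 + ∑ m ∈ Finset.range X.stable.choose, ∑ n ∈ Finset.range X.stable.choose,
    inclusion m ∘L (X.entry m n - if m = n then 1 else 0) ∘L coordinate n

theorem toOperatorFun_apply (X : StableMatrix (E →L[ℂ] E)) {N : ℕ}
    (hN : ∀ i j, N ≤ i ∨ N ≤ j → X.entry i j = if i = j then 1 else 0) (z : SumSpace E) {m : ℕ}
    (hm : m < N) : toOperatorFun X z m = ∑ n ∈ Finset.range N, X.entry m n (z n) := by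
  have hM := X.stable.choose_spec
  set M := X.stable.choose with hMdef
  have h1 : toOperatorFun X z m
      = z m + ∑ n ∈ Finset.range M, (X.entry m n - if m = n then 1 else 0) (z n) := by
    rw [toOperatorFun, ← hMdef]
    have h2 : ((1 + ∑ m ∈ Finset.range M, ∑ n ∈ Finset.range M,
        inclusion m ∘L (X.entry m n - if m = n then 1 else 0) ∘L coordinate n :
          SumSpace E →L[ℂ] SumSpace E) z) m = z m + ∑ k ∈ Finset.range M, ∑ n ∈ Finset.range M,
        coordinate m (inclusion k ((X.entry k n - if k = n then 1 else 0) (z n))) := by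
      rw [← coordinate_apply, add_apply, map_add]
      simp only [sum_apply, map_sum]
      rfl
    rw [h2]
    congr 1
    simp only [coordinate_apply, inclusion_apply]
    by_cases hmM : m < M
    · rw [Finset.sum_eq_single m]
      · simp
      · intro k _ hk
        simp [hk.symm]
      · intro h
        exact absurd (Finset.mem_range.2 hmM) h
    · rw [Finset.sum_eq_zero, Finset.sum_eq_zero]
      · intro n _
        rw [hM m n (Or.inl (not_lt.1 hmM)), sub_self, zero_apply]
      · intro k hk
        have : m ≠ k := by have := Finset.mem_range.1 hk; omega
        simp [this]
  have h3 : ∀ K, (∀ i j, K ≤ i ∨ K ≤ j → X.entry i j = if i = j then 1 else 0) →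
      ∀ L, K ≤ L → ∑ n ∈ Finset.range K, (X.entry m n - if m = n then 1 else 0) (z n)
        = ∑ n ∈ Finset.range L, (X.entry m n - if m = n then 1 else 0) (z n) := by
    intro K hK L hKL
    refine Finset.sum_subset (Finset.range_mono hKL) fun n _ hn => ?_
    rw [hK m n (Or.inr (by simpa using hn)), sub_self, zero_apply]
  rw [h1, h3 M hM (max M N) (le_max_left _ _), ← h3 N hN (max M N) (le_max_right _ _)]
  simp only [sub_apply, Finset.sum_sub_distrib]
  have h4 : ∑ n ∈ Finset.range N, (if m = n then (1 : E →L[ℂ] E) else 0) (z n) = z m := by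
    rw [Finset.sum_eq_single m]
    · simp
    · intro k _ hk
      simp [hk.symm]
    · intro h
      exact absurd (Finset.mem_range.2 hm) h
  rw [h4]
  abel

/-- The action of stable matrices of operators on `E ⊕ E ⊕ ⋯`. -/
def toOperator : StableMatrix (E →L[ℂ] E) →* (SumSpace E →L[ℂ] SumSpace E) where
  toFun := toOperatorFun
  map_one' := by
    ext z m
    rw [toOperatorFun_apply 1 (N := m + 1) (fun _ _ _ => rfl) z (Nat.lt_succ_self m),
      Finset.sum_eq_single m]
    · simp [StableMatrix.one_entry]
    · intro k _ hk
      simp [StableMatrix.one_entry, hk.symm]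
    · intro h
      simp at h
  map_mul' X Y := by
    ext z m
    obtain ⟨n₁, h₁⟩ := X.stable
    obtain ⟨n₂, h₂⟩ := Y.stable
    obtain ⟨n₃, h₃⟩ := (X * Y).stable
    let n := n₁ + n₂ + n₃ + m + 1
    have hX := StableMatrix.stable_mono (m := n) (by omega) h₁
    have hY := StableMatrix.stable_mono (m := n) (by omega) h₂
    have hXY := StableMatrix.stable_mono (m := n) (by omega) h₃
    have hm : m < n := by omega
    change _ = toOperatorFun X (toOperatorFun Y z) m
    rw [toOperatorFun_apply _ hXY z hm, toOperatorFun_apply _ hX _ hm]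
    have e1 : ∀ k, (X * Y).entry m k
        = ∑ l ∈ Finset.range n, X.entry m l * Y.entry l k := fun k => by
      rw [StableMatrix.mul_entry, StableMatrix.finsum_eq_of_left hm hX]
    have e2 : ∀ l ∈ Finset.range n, X.entry m l (toOperatorFun Y z l)
        = ∑ k ∈ Finset.range n, X.entry m l (Y.entry l k (z k)) := fun l hl => by
      rw [toOperatorFun_apply _ hY _ (Finset.mem_range.1 hl), map_sum]
    rw [Finset.sum_congr rfl e2, Finset.sum_comm]
    refine Finset.sum_congr rfl fun k _ => ?_
    rw [e1, sum_apply]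
    rfl

theorem toOperator_apply (X : StableMatrix (E →L[ℂ] E)) {N : ℕ}
    (hN : ∀ i j, N ≤ i ∨ N ≤ j → X.entry i j = if i = j then 1 else 0) (z : SumSpace E) {m : ℕ}
    (hm : m < N) : toOperator X z m = ∑ n ∈ Finset.range N, X.entry m n (z n) :=
  toOperatorFun_apply X hN z hm

theorem inner_toOperator (X : StableMatrix (E →L[ℂ] E)) (m n : ℕ) (x y : E) :
    ⟪inclusion m x, toOperator X (inclusion n y)⟫_ℂ = ⟪x, X.entry m n y⟫_ℂ := by
  obtain ⟨N, hN⟩ := X.stable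
  have hX := StableMatrix.stable_mono (m := N + m + n + 1) (by omega) hN
  rw [inner_inclusion_left, toOperator_apply X hX _ (by omega), Finset.sum_eq_single n]
  · simp [inclusion_apply]
  · intro k _ hk
    simp [inclusion_apply, hk]
  · intro h
    exact absurd (Finset.mem_range.2 (by omega)) h

theorem isTraceClass_sum {F G : Type u} [NormedAddCommGroup F] [InnerProductSpace ℂ F]
    [CompleteSpace F] [NormedAddCommGroup G] [InnerProductSpace ℂ G] [CompleteSpace G]
    {ι : Type*} (s : Finset ι) (T : ι → F →L[ℂ] G) (hT : ∀ i, IsTraceClass (T i)) :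
    IsTraceClass (∑ i ∈ s, T i) := by
  classical
  induction s using Finset.induction_on with
  | empty => rw [Finset.sum_empty]; exact isTraceClass_zero
  | insert i s hi ih => rw [Finset.sum_insert hi]; exact (hT i).add ih

theorem isTraceClass_toOperator_sub_one (X : StableMatrix (E →L[ℂ] E))
    (hX : ∀ m n, IsTraceClass (X.entry m n - if m = n then 1 else 0)) :
    IsTraceClass (toOperator X - 1) := by
  change IsTraceClass (toOperatorFun X - 1)
  rw [toOperatorFun, add_sub_cancel_left]
  exact isTraceClass_sum _ _ fun m => isTraceClass_sum _ _ fun n =>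
    ((hX m n).comp_right _).comp_left _

/-- In the orthonormal basis of `E ⊕ E ⊕ ⋯` built from one of `E`, the sections of the operator are the
block sections that define `HasFredholmDet`. -/
theorem hasFredholmDet_of_isNuclearDet {g : StableGL (E →L[ℂ] E)} {d : ℂ}
    (h : IsNuclearDet (toOperator g.val) d) : HasFredholmDet g d := by
  classical
  intro ι b
  refine (h.tendsto (sumBasis b)).congr fun t => ?_
  congr! 3 with i
  funext j
  rw [sumBasis_apply, sumBasis_apply, inner_toOperator]

theorem HasFredholmDet.unique {g : StableGL (E →L[ℂ] E)} {d d' : ℂ}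
    (h : HasFredholmDet g d) (h' : HasFredholmDet g d') : d = d' := by
  obtain ⟨w, c, -⟩ := exists_hilbertBasis ℂ E
  exact tendsto_nhds_unique (h w c) (h' w c)

theorem minorSum_zero {ι : Type*} : minorSum (fun _ _ : ι => 0) = 1 := by
  rw [minorSum, tsum_eq_single ∅, principalMinor_empty]
  intro s hs
  obtain ⟨i, hi⟩ := Finset.nonempty_iff_ne_empty.2 hs
  classical
  exact Matrix.det_eq_zero_of_row_eq_zero ⟨i, hi⟩ fun _ => rfl

/-- Elementary matrices have determinant `1`: the Gram matrix of the natural nuclear representation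
vanishes. -/
theorem isNuclearDet_elem {i j : ℕ} (hij : i ≠ j) {t : E →L[ℂ] E} (ht : IsTraceClass t) :
    IsNuclearDet (toOperator (StableMatrix.elem i j t)) 1 := by
  obtain ⟨ι, v, w, h, hx⟩ := ht
  refine ⟨ι, fun k => inclusion j (v k), fun k => inclusion i (w k), ?_, fun z => ?_, ?_⟩
  · simpa only [norm_inclusion] using h
  · have h1 : toOperator (StableMatrix.elem i j t) z - z = inclusion i (t (z j)) := by
      ext m
      obtain ⟨N, hN⟩ := (StableMatrix.elem i j t).stable
      have hX := StableMatrix.stable_mono (m := N + m + j + 1) (by omega) hN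
      rw [lp.coeFn_sub, Pi.sub_apply, toOperator_apply _ hX _ (by omega : m < N + m + j + 1),
        inclusion_apply]
      have h2 : ∀ n, (StableMatrix.elem i j t).entry m n (z n)
          = (if m = n then z n else 0) + if n = j then (if m = i then t (z j) else 0) else 0 := by
        intro n
        rw [StableMatrix.elem_entry, add_apply]
        congr 1
        · split_ifs <;> simp
        · by_cases hn : n = j
          · subst hn; by_cases hm : m = i <;> simp [hm]
          · simp [hn]
      simp only [h2, Finset.sum_add_distrib, Finset.sum_ite_eq, Finset.sum_ite_eq',
        Finset.mem_range]
      rw [if_pos (by omega), if_pos (by omega), add_sub_cancel_left]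
    rw [h1]
    have h3 := (inclusion i : E →L[ℂ] SumSpace E).hasSum (hx (z j))
    simpa only [map_smul, inner_inclusion_left] using h3
  · have : ∀ k l, ⟪(inclusion j (v k) : SumSpace E), inclusion i (w l)⟫_ℂ = 0 := fun k l => by
      rw [inner_inclusion_left, inclusion_apply, if_neg hij.symm, inner_zero_right]
    simp only [this]
    exact minorSum_zero

end SumSpace

/-! ### Determinants on a group extension -/

section CentralExtension

variable {Q K : Type*} [Group Q] [Group K]

/-- In a central extension, commutators of lifts do not depend on the lifts. -/
theorem commutator_eq_of_map_eq {ρ : Q →* K} (hρ : ∀ z, ρ z = 1 → ∀ y, Commute z y)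
    {x x' y y' : Q} (hx : ρ x = ρ x') (hy : ρ y = ρ y') : ⁅x, y⁆ = ⁅x', y'⁆ := by
  have h1 := hρ (x'⁻¹ * x) (by rw [map_mul, map_inv, hx, inv_mul_cancel])
  have h2 := hρ (y'⁻¹ * y) (by rw [map_mul, map_inv, hy, inv_mul_cancel])
  obtain ⟨z, rfl⟩ : ∃ z, x = x' * z := ⟨x'⁻¹ * x, by group⟩
  obtain ⟨t, rfl⟩ : ∃ t, y = y' * t := ⟨y'⁻¹ * y, by group⟩
  simp only [inv_mul_cancel_left] at h1 h2
  have e1 : z * (y' * t) = y' * t * z := (h1 (y' * t)).eq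
  have e2 : t * x'⁻¹ = x'⁻¹ * t := (h2 x'⁻¹).eq
  calc ⁅x' * z, y' * t⁆ = x' * (z * (y' * t)) * z⁻¹ * x'⁻¹ * t⁻¹ * y'⁻¹ := by
        rw [commutatorElement_def]; group
    _ = x' * y' * (t * x'⁻¹) * t⁻¹ * y'⁻¹ := by rw [e1]; group
    _ = ⁅x', y'⁆ := by rw [e2, commutatorElement_def]; group

/-- The graph of a conjugation invariant homomorphism from the kernel of `π` to `ℂˣ`. -/
structure IsDeterminantGraph (π : Q →* K) (D : Subgroup (Q × ℂˣ)) : Prop where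
  map_eq_one : ∀ {g d}, (g, d) ∈ D → π g = 1
  unique : ∀ {g d d'}, (g, d) ∈ D → (g, d') ∈ D → d = d'
  exists_mem : ∀ {g}, π g = 1 → ∃ d, (g, d) ∈ D
  conj : ∀ {g d}, (g, d) ∈ D → ∀ x, (x * g * x⁻¹, d) ∈ D

namespace IsDeterminantGraph

variable {π : Q →* K} {D : Subgroup (Q × ℂˣ)} (hD : IsDeterminantGraph π D)
  {N : Subgroup Q} [N.Normal] (hN : ∀ g, g ∈ N ↔ (g, (1 : ℂˣ)) ∈ D)

include hD hN

/-- The kernel of `π` is central modulo the elements of determinant `1`. -/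
theorem commute_mk {g : Q} (hg : π g = 1) (z : Q ⧸ N) : Commute (g : Q ⧸ N) z := by
  obtain ⟨h, rfl⟩ := QuotientGroup.mk_surjective z
  obtain ⟨d, hd⟩ := hD.exists_mem hg
  have h1 := D.mul_mem (D.inv_mem hd) (hD.conj hd h⁻¹)
  have h2 : g⁻¹ * (h⁻¹ * g * h⁻¹⁻¹) ∈ N := by
    rw [hN]
    convert h1 using 1
    exact Prod.ext rfl (inv_mul_cancel d).symm
  change (g : Q ⧸ N) * h = h * g
  rw [← QuotientGroup.mk_mul, ← QuotientGroup.mk_mul, eq_comm, QuotientGroup.eq]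
  convert h2 using 1
  group

theorem eq_of_mk_eq {p q : Q × ℂˣ} (hp : p ∈ D) (hq : q ∈ D) (h : (p.1 : Q ⧸ N) = q.1) :
    p.2 = q.2 := by
  rw [QuotientGroup.eq, hN] at h
  have h1 := D.mul_mem (D.inv_mem hp) hq
  have h2 := hD.unique h (d' := p.2⁻¹ * q.2) h1
  exact inv_mul_eq_one.1 h2.symm

omit hN in
/-- Given a homomorphism `τ` to the quotient by the elements of determinant `1`, every element
that `τ` sends to the kernel of `π` is represented by an element with a determinant. -/
theorem exists_rep {U : Type*} [Group U] {τ : U →* Q ⧸ N}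
    (hτ : ∀ u, ∀ g : Q, (g : Q ⧸ N) = τ u → π g = 1) (u : U) :
    ∃ p : Q × ℂˣ, p ∈ D ∧ (p.1 : Q ⧸ N) = τ u := by
  obtain ⟨g, hg⟩ := QuotientGroup.mk_surjective (τ u)
  obtain ⟨d, hd⟩ := hD.exists_mem (hτ u g hg)
  exact ⟨(g, d), hd, hg⟩

/-- The determinant of representatives of the values of `τ`. -/
theorem exists_character {U : Type*} [Group U] (τ : U →* Q ⧸ N)
    (hτ : ∀ u, ∀ g : Q, (g : Q ⧸ N) = τ u → π g = 1) :
    ∃ χ : U →* ℂˣ, ∀ u, ∀ g : Q, (g : Q ⧸ N) = τ u → (g, χ u) ∈ D := by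
  choose p hp hpτ using hD.exists_rep hτ
  refine ⟨MonoidHom.mk' (fun u => (p u).2) fun u v => ?_, fun u g hg => ?_⟩
  · refine hD.eq_of_mk_eq hN (q := p u * p v) (hp _) (D.mul_mem (hp u) (hp v)) ?_
    rw [hpτ, Prod.fst_mul, QuotientGroup.mk_mul, hpτ, hpτ, map_mul]
  · obtain ⟨d, hd⟩ := hD.exists_mem (hτ u g hg)
    have h := hD.eq_of_mk_eq hN hd (hp u) (hg.trans (hpτ u).symm)
    change (g, (p u).2) ∈ D
    rw [← h]
    exact hd

end IsDeterminantGraph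

/-- For fixed `y`, the pairs `(x, d)` such that the commutator `⁅x, y⁆` has determinant `d`. That
these form a subgroup says that the determinant of the commutator is multiplicative in `x`. -/
def commutatorGraph {π : Q →* K} {D : Subgroup (Q × ℂˣ)} (hD : IsDeterminantGraph π D) (y : Q) :
    Subgroup (Q × ℂˣ) where
  carrier := {p | (⁅p.1, y⁆, p.2) ∈ D}
  one_mem' := by
    change (⁅(1 : Q), y⁆, (1 : ℂˣ)) ∈ D
    rw [commutatorElement_one_left]
    exact D.one_mem
  mul_mem' {p q} hp hq := by
    have h := D.mul_mem (hD.conj hq p.1) hp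
    change (⁅p.1 * q.1, y⁆, p.2 * q.2) ∈ D
    convert h using 1
    rw [Prod.mk_mul_mk, mul_comm q.2]
    congr 1
    simp only [commutatorElement_def]
    group
  inv_mem' {p} hp := by
    have h := hD.conj (D.inv_mem hp) p.1⁻¹
    change (⁅p.1⁻¹, y⁆, p.2⁻¹) ∈ D
    convert h using 2
    change _ = p.1⁻¹ * ⁅p.1, y⁆⁻¹ * p.1⁻¹⁻¹
    simp only [commutatorElement_def]
    group

theorem commutatorGraph_symm {π : Q →* K} {D : Subgroup (Q × ℂˣ)} (hD : IsDeterminantGraph π D)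
    {x y : Q} {d : ℂˣ} (h : (x, d) ∈ commutatorGraph hD y) :
    (y, d⁻¹) ∈ commutatorGraph hD x := by
  have h1 := D.inv_mem h
  change (⁅y, x⁆, d⁻¹) ∈ D
  rw [← commutatorElement_inv]
  exact h1

end CentralExtension

/-! ### Lifting the Steinberg group -/

section SteinbergLift

variable {A M : Type*} [Ring A] [Ring M] (f : A →+* M) (N : Subgroup (StableGL A)) [N.Normal]

variable {f N} in
theorem mk_elem_eq (hN : ∀ {i j : ℕ} (hij : i ≠ j) (x : A), f x = 0 → StableGL.elem hij x ∈ N)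
    {i j : ℕ} (hij : i ≠ j) {x y : A} (hxy : f x = f y) :
    (StableGL.elem hij x : StableGL A ⧸ N) = StableGL.elem hij y := by
  rw [QuotientGroup.eq]
  have h : (StableGL.elem hij x)⁻¹ * StableGL.elem hij y = StableGL.elem hij (-x + y) := by
    rw [inv_mul_eq_iff_eq_mul, StableGL.elem_add, add_neg_cancel_left]
  rw [h]
  exact hN hij _ (by rw [map_add, map_neg, hxy, neg_add_cancel])

variable {N}

/-- If `f` is surjective and the elementary matrices over its kernel lie in `N`, the projection
`St(M) → GL(M)` lifts to `GL(A) ⧸ N`. -/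
theorem exists_steinbergLift
    (hN : ∀ {i j : ℕ} (hij : i ≠ j) (x : A), f x = 0 → StableGL.elem hij x ∈ N)
    (hf : Function.Surjective f) :
    ∃ τ : Steinberg M →* StableGL A ⧸ N, ∀ {i j : ℕ} (hij : i ≠ j) (x : A),
      τ (Steinberg.x hij (f x)) = StableGL.elem hij x := by
  -- `σ` is only a section of sets; modulo `N` the elementary matrices of its values satisfy the
  -- Steinberg relations all the same
  obtain ⟨σ, hσ⟩ := hf.hasRightInverse
  let gen : SteinbergGen M → StableGL A ⧸ N := fun g => (StableGL.elem g.1.2 (σ g.2) : StableGL A)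
  have hrel : ∀ r ∈ {r | SteinbergRel M r}, FreeGroup.lift gen r = 1 := by
    intro r hr
    have hgen : ∀ {i j : ℕ} (h : i ≠ j) (a : M),
        FreeGroup.lift gen (SteinbergGen.free h a) = (StableGL.elem h (σ a) : StableGL A) :=
      fun h a => by simp [SteinbergGen.free, gen]
    cases hr with
    | add h a b =>
      rw [map_mul, map_mul, map_inv, hgen, hgen, hgen, mul_inv_eq_one, ← QuotientGroup.mk_mul,
        StableGL.elem_add]
      exact mk_elem_eq hN h (by rw [map_add, hσ, hσ, hσ])
    | comm hij hjk hik a b =>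
      rw [map_mul, map_commutatorElement, map_inv, hgen, hgen, hgen, mul_inv_eq_one,
        commutatorElement_def, ← QuotientGroup.mk_mul, StableGL.elem_comm hij hjk hik,
        QuotientGroup.mk_mul, QuotientGroup.mk_mul, mul_inv_eq_iff_eq_mul, mul_inv_eq_iff_eq_mul,
        mul_assoc, mk_elem_eq hN hik (x := σ a * σ b) (y := σ (a * b))
          (by rw [map_mul, hσ, hσ, hσ])]
    | comm_one hij hkl hjk hil a b =>
      rw [map_commutatorElement, hgen, hgen, commutatorElement_eq_one_iff_mul_comm,
        ← QuotientGroup.mk_mul, ← QuotientGroup.mk_mul, StableGL.elem_comm_one hij hkl hjk hil]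
  refine ⟨PresentedGroup.toGroup hrel, fun hij x => ?_⟩
  refine (PresentedGroup.toGroup.of hrel).trans ?_
  exact mk_elem_eq hN hij (hσ _)

/-- The Steinberg group is perfect, so liftings from it to a central extension are unique. -/
theorem steinbergLift_unique {Q K : Type*} [Group Q] [Group K] {ρ : Q →* K}
    (hρ : ∀ z, ρ z = 1 → ∀ y, Commute z y) {τ τ' : Steinberg M →* Q}
    (h : ρ.comp τ = ρ.comp τ') : τ = τ' := by
  apply PresentedGroup.ext
  rintro ⟨⟨⟨i, j⟩, hij⟩, a⟩
  change τ (Steinberg.x hij a) = τ' (Steinberg.x hij a)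
  have hik : i ≠ i + j + 1 := by omega
  have hkj : i + j + 1 ≠ j := by omega
  have hx : Steinberg.x hij a = ⁅Steinberg.x hik a, Steinberg.x hkj 1⁆ := by
    have h1 := mk_eq_of_rel (SteinbergRel.comm hik hkj hij a 1)
    rw [map_mul, map_inv, map_commutatorElement, Steinberg.mk_free, Steinberg.mk_free,
      Steinberg.mk_free, mul_inv_eq_one, mul_one] at h1
    exact h1.symm
  rw [hx, map_commutatorElement, map_commutatorElement]
  exact commutator_eq_of_map_eq hρ (DFunLike.congr_fun h _) (DFunLike.congr_fun h _)

end SteinbergLift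

/-! ### Existence and uniqueness of the Connes–Karoubi character -/

section Character

variable {H : Type u} [NormedAddCommGroup H] [InnerProductSpace ℂ H] [CompleteSpace H]
  (V : Submodule ℂ H) [CompleteSpace V]

/-- The action of `GL` of the fibre product on `V ⊕ V ⊕ ⋯` through the second projection. -/
def extendedOperator : StableGL (extendedModule V) →* (SumSpace V →L[ℂ] SumSpace V) :=
  (toOperator.comp (StableMatrix.map (p₂ V))).comp (Units.coeHom _)

theorem exists_isNuclearDet_extendedOperator {g : StableGL (extendedModule V)}
    (hg : StableGL.map (p₁ V) g = 1) : ∃ d, IsNuclearDet (extendedOperator V g) d := by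
  refine exists_isNuclearDet (isTraceClass_toOperator_sub_one _ fun m n => ?_)
  have h1 : p₁ V (g.val.entry m n) = if m = n then 1 else 0 := by
    have h2 := congrArg (fun x : StableGL (universalModule V) => x.val.entry m n) hg
    exact h2
  have h3 : IsTraceClass (compress V ((p₁ V (g.val.entry m n) : universalModule V) : H →L[ℂ] H)
      - p₂ V (g.val.entry m n)) := (g.val.entry m n).2
  have h4 : compress V ((p₁ V (g.val.entry m n) : universalModule V) : H →L[ℂ] H)
      = if m = n then 1 else 0 := by
    rw [h1]
    split_ifs
    · exact compress_one V
    · change compress V 0 = 0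
      ext x
      simp [compress]
  rw [h4] at h3
  have h5 := h3.neg
  rw [neg_sub] at h5
  exact h5

theorem extendedOperator_conj {g : StableGL (extendedModule V)} {d : ℂ}
    (h : IsNuclearDet (extendedOperator V g) d) (x : StableGL (extendedModule V)) :
    IsNuclearDet (extendedOperator V (x * g * x⁻¹)) d := by
  rw [map_mul, map_mul]
  exact h.conj (by rw [← map_mul, mul_inv_cancel, map_one])
    (by rw [← map_mul, inv_mul_cancel, map_one])

/-- The graph of the determinant on the kernel of `GL(p₁)`. -/
def detGraph : Subgroup (StableGL (extendedModule V) × ℂˣ) where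
  carrier := {p | StableGL.map (p₁ V) p.1 = 1 ∧ IsNuclearDet (extendedOperator V p.1) p.2}
  one_mem' := ⟨map_one _, by
    rw [Prod.fst_one, map_one]
    exact isNuclearDet_one⟩
  mul_mem' {p q} hp hq := ⟨by rw [Prod.fst_mul, map_mul, hp.1, hq.1, one_mul], by
    rw [Prod.fst_mul, map_mul, Prod.snd_mul, Units.val_mul]
    exact hp.2.mul hq.2⟩
  inv_mem' {p} hp := by
    have h1 : StableGL.map (p₁ V) p.1⁻¹ = 1 := by rw [map_inv, hp.1, inv_one]
    refine ⟨h1, ?_⟩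
    obtain ⟨d, hd⟩ := exists_isNuclearDet_extendedOperator V h1
    have h2 := hp.2.mul hd
    rw [← map_mul, mul_inv_cancel, map_one] at h2
    have h3 : (p.2 : ℂ) * d = 1 := h2.unique isNuclearDet_one
    have h4 : ((p.2⁻¹ : ℂˣ) : ℂ) = d := by
      rw [Units.val_inv_eq_inv_val]
      exact inv_eq_of_mul_eq_one_right h3
    rw [Prod.fst_inv, Prod.snd_inv, h4]
    exact hd

variable {V}

theorem exists_mem_detGraph {g : StableGL (extendedModule V)}
    (hg : StableGL.map (p₁ V) g = 1) : ∃ d, (g, d) ∈ detGraph V := by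
  obtain ⟨d, hd⟩ := exists_isNuclearDet_extendedOperator V hg
  have h1 : StableGL.map (p₁ V) g⁻¹ = 1 := by rw [map_inv, hg, inv_one]
  obtain ⟨e, he⟩ := exists_isNuclearDet_extendedOperator V h1
  have h2 := hd.mul he
  rw [← map_mul, mul_inv_cancel, map_one] at h2
  have h3 : d * e = 1 := h2.unique isNuclearDet_one
  exact ⟨Units.mkOfMulEqOne d e h3, hg, hd⟩

variable (V) in
theorem isDeterminantGraph_detGraph :
    IsDeterminantGraph (StableGL.map (p₁ V)) (detGraph V) where
  map_eq_one h := h.1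
  unique h h' := Units.ext (h.2.unique h'.2)
  exists_mem h := exists_mem_detGraph h
  conj {g d} h x := by
    refine ⟨?_, extendedOperator_conj V h.2 x⟩
    have h1 : StableGL.map (p₁ V) g = 1 := h.1
    change StableGL.map (p₁ V) (x * g * x⁻¹) = 1
    rw [map_mul, map_mul, map_inv, h1, mul_one, mul_inv_cancel]

theorem hasFredholmDet_of_mem_detGraph {g : StableGL (extendedModule V)} {d : ℂˣ}
    (h : (g, d) ∈ detGraph V) : HasFredholmDet (StableGL.map (p₂ V) g) d :=
  hasFredholmDet_of_isNuclearDet h.2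

/-- The normal closure in the definition of `detOne` adds nothing: the elements of determinant `1`
already form a normal subgroup. -/
theorem mem_detOne_iff_detGraph {g : StableGL (extendedModule V)} :
    g ∈ detOne V ↔ (g, (1 : ℂˣ)) ∈ detGraph V := by
  constructor
  · intro hg
    let N : Subgroup (StableGL (extendedModule V)) :=
      (detGraph V).comap (MonoidHom.inl _ _)
    have : N.Normal := ⟨fun g hg x => (isDeterminantGraph_detGraph V).conj (d := 1) hg x⟩
    have hle : detOne V ≤ N := Subgroup.normalClosure_le_normal fun x hx => by
      obtain ⟨d, hd⟩ := exists_mem_detGraph hx.1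
      have h1 : (d : ℂ) = 1 := (hasFredholmDet_of_mem_detGraph hd).unique hx.2
      have h2 : d = 1 := Units.ext h1
      subst h2
      exact hd
    exact hle hg
  · intro h
    exact Subgroup.subset_normalClosure ⟨h.1, by
      simpa using hasFredholmDet_of_mem_detGraph h⟩

/-- Elementary matrices over the ideal `ker p₁` of trace class operators have determinant `1`, so the
Steinberg relations of the quotient can be lifted. -/
theorem elem_mem_detOne {i j : ℕ} (hij : i ≠ j) {x : extendedModule V} (hx : p₁ V x = 0) :
    StableGL.elem hij x ∈ detOne V := by
  rw [mem_detOne_iff_detGraph]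
  refine ⟨?_, ?_⟩
  · apply Units.ext
    change StableMatrix.map (p₁ V) (StableMatrix.elem i j x) = 1
    rw [StableMatrix.map_elem, hx, StableMatrix.elem_zero]
  · change IsNuclearDet (toOperator (StableMatrix.map (p₂ V) (StableMatrix.elem i j x))) 1
    rw [StableMatrix.map_elem]
    refine isNuclearDet_elem hij ?_
    have h3 : IsTraceClass (compress V ((p₁ V x : universalModule V) : H →L[ℂ] H) - p₂ V x) := x.2
    rw [hx] at h3
    have h4 : compress V (((0 : universalModule V)) : H →L[ℂ] H) = 0 := by
      change compress V 0 = 0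
      ext x
      simp [compress]
    rw [h4, zero_sub] at h3
    simpa using h3.neg

/-- The kernel of the Connes–Karoubi extension is central. -/
theorem commute_of_extensionProj_eq_one {z : StableGL (extendedModule V) ⧸ detOne V}
    (hz : extensionProj V z = 1) (y : StableGL (extendedModule V) ⧸ detOne V) :
    Commute z y := by
  obtain ⟨g, rfl⟩ := QuotientGroup.mk_surjective z
  exact (isDeterminantGraph_detGraph V).commute_mk (fun _ => mem_detOne_iff_detGraph) hz y

variable (V) in
/-- `p₁` is surjective: `(a, P₊ a P₊)` lies in the fibre product. -/
theorem p₁_surjective : Function.Surjective (p₁ V) := fun a =>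
  ⟨⟨(a, compress V (a : H →L[ℂ] H)), by
    change IsTraceClass (compress V (a : H →L[ℂ] H) - compress V (a : H →L[ℂ] H))
    rw [sub_self]
    exact isTraceClass_zero⟩, rfl⟩

variable (V) in
/-- On `K₂`, a lift of the Steinberg group takes values in the kernel of `GL(p₁)` modulo elements of
determinant `1`. The character is the determinant of these values. -/
theorem exists_isConnesKaroubiCharacter :
    ∃ ck : K₂ (universalModule V) →* ℂˣ, IsConnesKaroubiCharacter V ck := by
  obtain ⟨τ, hτ⟩ := exists_steinbergLift (p₁ V) (N := detOne V)
    (fun hij x hx => elem_mem_detOne hij hx) (p₁_surjective V)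
  have hτ' : (extensionProj V).comp τ = Steinberg.proj (universalModule V) := by
    apply PresentedGroup.ext
    rintro ⟨⟨⟨i, j⟩, h⟩, a⟩
    obtain ⟨x, rfl⟩ := p₁_surjective V a
    change extensionProj V (τ (Steinberg.x h (p₁ V x)))
      = Steinberg.proj _ (Steinberg.x h (p₁ V x))
    rw [Steinberg.proj_x, hτ]
    exact Units.ext (StableMatrix.map_elem (p₁ V) i j x)
  have hker : ∀ (u : K₂ (universalModule V)) (g : StableGL (extendedModule V)),
      (g : StableGL (extendedModule V) ⧸ detOne V) = τ.comp (K₂ _).subtype u →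
        StableGL.map (p₁ V) g = 1 := fun u g hg => by
    have h1 : extensionProj V (g : StableGL (extendedModule V) ⧸ detOne V)
        = Steinberg.proj _ (u : Steinberg (universalModule V)) := by
      rw [hg]
      exact DFunLike.congr_fun hτ' _
    exact h1.trans u.2
  obtain ⟨ck, hck⟩ := (isDeterminantGraph_detGraph V).exists_character
    (fun _ => mem_detOne_iff_detGraph) (τ.comp (K₂ _).subtype) hker
  exact ⟨ck, τ, hτ', fun u g hg => hasFredholmDet_of_mem_detGraph (hck u g hg)⟩

theorem IsConnesKaroubiCharacter.eq {ck ck' : K₂ (universalModule V) →* ℂˣ}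
    (h : IsConnesKaroubiCharacter V ck) (h' : IsConnesKaroubiCharacter V ck') : ck = ck' := by
  obtain ⟨τ, hτ, hd⟩ := h
  obtain ⟨τ', hτ', hd'⟩ := h'
  obtain rfl := steinbergLift_unique (fun z => commute_of_extensionProj_eq_one)
    (hτ.trans hτ'.symm)
  refine MonoidHom.ext fun u => Units.ext ?_
  obtain ⟨g, hg⟩ := QuotientGroup.mk_surjective (τ u)
  exact (hd u g hg).unique (hd' u g hg)

/-- The Connes–Karoubi character of a commutator in the Steinberg group is the determinant of the
commutator of arbitrary lifts of the images in `GL`. -/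
theorem IsConnesKaroubiCharacter.eq_of_commutator {ck : K₂ (universalModule V) →* ℂˣ}
    (h : IsConnesKaroubiCharacter V ck) {u : K₂ (universalModule V)}
    {x y : Steinberg (universalModule V)} (hu : (u : Steinberg (universalModule V)) = ⁅x, y⁆)
    {P Q : StableGL (extendedModule V)}
    (hP : StableGL.map (p₁ V) P = Steinberg.proj _ x)
    (hQ : StableGL.map (p₁ V) Q = Steinberg.proj _ y) {d : ℂˣ}
    (hd : (⁅P, Q⁆, d) ∈ detGraph V) : ck u = d := by
  obtain ⟨τ, hτ, hck⟩ := h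
  have h1 : ((⁅P, Q⁆ : StableGL (extendedModule V)) : StableGL (extendedModule V) ⧸ detOne V)
      = τ u := by
    rw [hu, map_commutatorElement]
    exact (map_commutatorElement (QuotientGroup.mk' (detOne V)) P Q).trans
      (commutator_eq_of_map_eq (fun z => commute_of_extensionProj_eq_one)
        (hP.trans (DFunLike.congr_fun hτ x).symm) (hQ.trans (DFunLike.congr_fun hτ y).symm))
  exact Units.ext ((hck u _ h1).unique (hasFredholmDet_of_mem_detGraph hd))

end Character

/-! ### Lifts of diagonal matrices -/

section BlockMatrix

variable {R S : Type*} [Ring R] [Ring S]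

/-- The entries of `X ⊕ 1`. -/
def stabilizeEntry (X : Matrix (Fin 3) (Fin 3) R) (i j : ℕ) : R :=
  if h : i < 3 ∧ j < 3 then X ⟨i, h.1⟩ ⟨j, h.2⟩ else if i = j then 1 else 0

theorem stabilizeEntry_of_le (X : Matrix (Fin 3) (Fin 3) R) (i j : ℕ) (hij : 3 ≤ i ∨ 3 ≤ j) :
    stabilizeEntry X i j = if i = j then 1 else 0 :=
  dif_neg (by omega)

/-- The inclusion `M₃(R) → M(R)`, `X ↦ X ⊕ 1`. -/
def stabilize : Matrix (Fin 3) (Fin 3) R →* StableMatrix R where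
  toFun X := { entry := stabilizeEntry X, stable := ⟨3, stabilizeEntry_of_le X⟩ }
  map_one' := by
    ext i j
    simp only [StableMatrix.one_entry, stabilizeEntry, Matrix.one_apply, Fin.mk.injEq]
    split_ifs <;> rfl
  map_mul' X Y := by
    ext i j
    change stabilizeEntry (X * Y) i j = ∑ᶠ k, stabilizeEntry X i k * stabilizeEntry Y k j
    by_cases hi : i < 3
    · rw [StableMatrix.finsum_eq_of_left hi (stabilizeEntry_of_le X), Finset.sum_range]
      by_cases hj : j < 3
      · simp [stabilizeEntry, hi, hj, Matrix.mul_apply]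
      · have hij : i ≠ j := by omega
        have h : ∀ k : Fin 3, (k : ℕ) ≠ j := fun k => by omega
        simp [stabilizeEntry, hj, hij, h]
    · simp only [stabilizeEntry_of_le X i _ (Or.inl (not_lt.1 hi)),
        stabilizeEntry_of_le (X * Y) i j (Or.inl (not_lt.1 hi))]
      rw [StableMatrix.finsum_one_left, stabilizeEntry_of_le Y i j (Or.inl (not_lt.1 hi))]

theorem stabilize_entry (X : Matrix (Fin 3) (Fin 3) R) (i j : ℕ) : (stabilize X).entry i j
    = if h : i < 3 ∧ j < 3 then X ⟨i, h.1⟩ ⟨j, h.2⟩ else if i = j then 1 else 0 := rfl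

theorem map_stabilize (f : R →+* S) (X : Matrix (Fin 3) (Fin 3) R) :
    StableMatrix.map f (stabilize X) = stabilize (X.map f) := by
  ext i j
  change f ((stabilize X).entry i j) = _
  rw [stabilize_entry, stabilize_entry]
  split_ifs <;> simp

/-- `diag(a, a⁻¹, 1)`. -/
def diag12 (a : Rˣ) : (Matrix (Fin 3) (Fin 3) R)ˣ where
  val := !![(a : R), 0, 0; 0, ((a⁻¹ : Rˣ) : R), 0; 0, 0, 1]
  inv := !![((a⁻¹ : Rˣ) : R), 0, 0; 0, (a : R), 0; 0, 0, 1]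
  val_inv := by
    ext i j
    fin_cases i <;> fin_cases j <;> simp [Matrix.mul_apply, Fin.sum_univ_three]
  inv_val := by
    ext i j
    fin_cases i <;> fin_cases j <;> simp [Matrix.mul_apply, Fin.sum_univ_three]

/-- `diag(a, 1, a⁻¹)`. -/
def diag13 (a : Rˣ) : (Matrix (Fin 3) (Fin 3) R)ˣ where
  val := !![(a : R), 0, 0; 0, 1, 0; 0, 0, ((a⁻¹ : Rˣ) : R)]
  inv := !![((a⁻¹ : Rˣ) : R), 0, 0; 0, 1, 0; 0, 0, (a : R)]
  val_inv := by
    ext i j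
    fin_cases i <;> fin_cases j <;> simp [Matrix.mul_apply, Fin.sum_univ_three]
  inv_val := by
    ext i j
    fin_cases i <;> fin_cases j <;> simp [Matrix.mul_apply, Fin.sum_univ_three]

/-- The commutator is concentrated in the first coordinate, the only one in which both matrices differ
from `1`. -/
theorem commutator_diag12_diag13 (a b : Rˣ) :
    (⁅diag12 a, diag13 b⁆ : (Matrix (Fin 3) (Fin 3) R)ˣ).val
      = !![((⁅a, b⁆ : Rˣ) : R), 0, 0; 0, 1, 0; 0, 0, 1] := by
  change (diag12 a).val * (diag13 b).val * (diag12 a).inv * (diag13 b).inv = _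
  ext i j
  fin_cases i <;> fin_cases j <;>
    simp [Matrix.mul_apply, Fin.sum_univ_three, diag12, diag13, commutatorElement_def]

variable {s s' : R} (h : s' * s = 1)

/-- Let `s` have the left inverse `s'`. This is a lift of `diag(s, s', 1)` to an invertible matrix;
the defect of invertibility of `s` is the idempotent `1 - s s'`. -/
def shift12 : (Matrix (Fin 3) (Fin 3) R)ˣ where
  val := !![s, 1 - s * s', 0; 0, s', 0; 0, 0, 1]
  inv := !![s', 0, 0; 1 - s * s', s, 0; 0, 0, 1]
  val_inv := by
    have h1 : s * s' * s = s := by rw [mul_assoc, h, mul_one]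
    have h2 : s' * (s * s') = s' := by rw [← mul_assoc, h, one_mul]
    ext i j
    fin_cases i <;> fin_cases j <;>
      simp [Matrix.mul_apply, Fin.sum_univ_three, h, mul_sub, sub_mul, h1, h2, ← mul_assoc]
  inv_val := by
    have h1 : s * s' * s = s := by rw [mul_assoc, h, mul_one]
    have h2 : s' * (s * s') = s' := by rw [← mul_assoc, h, one_mul]
    ext i j
    fin_cases i <;> fin_cases j <;>
      simp [Matrix.mul_apply, Fin.sum_univ_three, h, mul_sub, sub_mul, h1, h2, ← mul_assoc]

/-- The analogous lift of `diag(s, 1, s')`. -/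
def shift13 : (Matrix (Fin 3) (Fin 3) R)ˣ where
  val := !![s, 0, 1 - s * s'; 0, 1, 0; 0, 0, s']
  inv := !![s', 0, 0; 0, 1, 0; 1 - s * s', 0, s]
  val_inv := by
    have h1 : s * s' * s = s := by rw [mul_assoc, h, mul_one]
    have h2 : s' * (s * s') = s' := by rw [← mul_assoc, h, one_mul]
    ext i j
    fin_cases i <;> fin_cases j <;>
      simp [Matrix.mul_apply, Fin.sum_univ_three, h, mul_sub, sub_mul, h1, h2, ← mul_assoc]
  inv_val := by
    have h1 : s * s' * s = s := by rw [mul_assoc, h, mul_one]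
    have h2 : s' * (s * s') = s' := by rw [← mul_assoc, h, one_mul]
    ext i j
    fin_cases i <;> fin_cases j <;>
      simp [Matrix.mul_apply, Fin.sum_univ_three, h, mul_sub, sub_mul, h1, h2, ← mul_assoc]

theorem commutator_diag12_shift13 (a : Rˣ) :
    (⁅diag12 a, shift13 h⁆ : (Matrix (Fin 3) (Fin 3) R)ˣ).val
      = !![a * s * ((a⁻¹ : Rˣ) : R) * s' + a * (1 - s * s'), 0, 0; 0, 1, 0; 0, 0, 1] := by
  change (diag12 a).val * (shift13 h).val * (diag12 a).inv * (shift13 h).inv = _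
  have h2 : s' * (s * s') = s' := by rw [← mul_assoc, h, one_mul]
  ext i j
  fin_cases i <;> fin_cases j <;>
    simp [Matrix.mul_apply, Fin.sum_univ_three, diag12, shift13, h, mul_sub, sub_mul, h2, mul_assoc]

theorem commutator_diag13_shift12 (a : Rˣ) :
    (⁅diag13 a, shift12 h⁆ : (Matrix (Fin 3) (Fin 3) R)ˣ).val
      = !![a * s * ((a⁻¹ : Rˣ) : R) * s' + a * (1 - s * s'), 0, 0; 0, 1, 0; 0, 0, 1] := by
  change (diag13 a).val * (shift12 h).val * (diag13 a).inv * (shift12 h).inv = _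
  have h2 : s' * (s * s') = s' := by rw [← mul_assoc, h, one_mul]
  ext i j
  fin_cases i <;> fin_cases j <;>
    simp [Matrix.mul_apply, Fin.sum_univ_three, diag13, shift12, h, mul_sub, sub_mul, h2, mul_assoc]

/-- The commutator of the two lifts exchanges the ranges of the idempotents `e` and `s e s'`, where
`e = 1 - s s'`. -/
theorem commutator_shift12_shift13 {e : R} (he : e = 1 - s * s') :
    (⁅shift12 h, shift13 h⁆ : (Matrix (Fin 3) (Fin 3) R)ˣ).val
      = !![1 - (e + s * e * s') + (s * e + e * s'), 0, 0; 0, 1, 0; 0, 0, 1] := by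
  have hes : e * s = 0 := by rw [he, sub_mul, mul_assoc, h, mul_one, one_mul, sub_self]
  have hse : s' * e = 0 := by rw [he, mul_sub, ← mul_assoc, h, mul_one, one_mul, sub_self]
  have hee : e * e = e := by
    conv_lhs => rw [he, sub_mul, one_mul, ← he, mul_assoc, hse, mul_zero, sub_zero]
  have hss : s * s' = 1 - e := by rw [he]; abel
  have key : (shift12 h).val * (shift13 h).val
      = !![1 - (e + s * e * s') + (s * e + e * s'), 0, 0; 0, 1, 0; 0, 0, 1]
        * ((shift13 h).val * (shift12 h).val) := by
    have z1 : e * (s * s) = 0 := by rw [← mul_assoc, hes, zero_mul]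
    have z2 : e * (s' * (s * s)) = 0 := by rw [← mul_assoc s', h, one_mul, hes]
    have z4 : e * (s * e) = 0 := by rw [← mul_assoc, hes, zero_mul]
    have z5 : e * (s' * (s * e)) = e := by rw [← mul_assoc s', h, one_mul, hee]
    simp only [shift12, shift13, ← he]
    ext i j
    fin_cases i <;> fin_cases j <;>
      simp [Matrix.mul_apply, Fin.sum_univ_three, add_mul, sub_mul, hse, hee, z1, z2, z4, z5,
        mul_assoc]
  rw [commutatorElement_def, Units.val_mul, Units.val_mul, Units.val_mul, key, ← Units.val_mul,
    mul_assoc, mul_assoc, ← Units.val_mul, ← Units.val_mul]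
  have : shift13 h * shift12 h * ((shift12 h)⁻¹ * (shift13 h)⁻¹) = 1 := by group
  rw [this, Units.val_one, mul_one]

theorem map_diag12 (f : R →+* S) (a : Rˣ) (h01 : (0 : ℕ) ≠ 1) :
    StableGL.map f (Units.map stabilize (diag12 a))
      = StableGL.diag h01 (Units.map (f : R →* S) a) := by
  apply Units.ext
  change StableMatrix.map f (stabilize (diag12 a).val) = _
  rw [map_stabilize]
  ext i j
  rw [stabilize_entry]
  by_cases hij : i < 3 ∧ j < 3
  · obtain ⟨hi, hj⟩ := hij
    interval_cases i <;> interval_cases j <;>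
      simp [diag12, StableGL.diag, StableMatrix.diagonal]
  · rw [dif_neg hij]
    by_cases h' : i = j
    · subst h'
      have h0 : i ≠ 0 := by omega
      have h1 : i ≠ 1 := by omega
      simp [StableGL.diag, StableMatrix.diagonal, h0, h1]
    · simp [StableGL.diag, StableMatrix.diagonal, h']

theorem map_diag13 (f : R →+* S) (a : Rˣ) (h02 : (0 : ℕ) ≠ 2) :
    StableGL.map f (Units.map stabilize (diag13 a))
      = StableGL.diag h02 (Units.map (f : R →* S) a) := by
  apply Units.ext
  change StableMatrix.map f (stabilize (diag13 a).val) = _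
  rw [map_stabilize]
  ext i j
  rw [stabilize_entry]
  by_cases hij : i < 3 ∧ j < 3
  · obtain ⟨hi, hj⟩ := hij
    interval_cases i <;> interval_cases j <;>
      simp [diag13, StableGL.diag, StableMatrix.diagonal]
  · rw [dif_neg hij]
    by_cases h' : i = j
    · subst h'
      have h0 : i ≠ 0 := by omega
      have h1 : i ≠ 2 := by omega
      simp [StableGL.diag, StableMatrix.diagonal, h0, h1]
    · simp [StableGL.diag, StableMatrix.diagonal, h']

theorem map_shift12 (f : R →+* S) (u : Sˣ) (hs : f s = u) (hs' : f s' = (u⁻¹ : Sˣ))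
    (h01 : (0 : ℕ) ≠ 1) :
    StableGL.map f (Units.map stabilize (shift12 h)) = StableGL.diag h01 u := by
  apply Units.ext
  change StableMatrix.map f (stabilize (shift12 h).val) = _
  rw [map_stabilize]
  ext i j
  rw [stabilize_entry]
  by_cases hij : i < 3 ∧ j < 3
  · obtain ⟨hi, hj⟩ := hij
    interval_cases i <;> interval_cases j <;>
      simp [shift12, StableGL.diag, StableMatrix.diagonal, hs, hs']
  · rw [dif_neg hij]
    by_cases h' : i = j
    · subst h'
      have h0 : i ≠ 0 := by omega
      have h1 : i ≠ 1 := by omega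
      simp [StableGL.diag, StableMatrix.diagonal, h0, h1]
    · simp [StableGL.diag, StableMatrix.diagonal, h']

theorem map_shift13 (f : R →+* S) (u : Sˣ) (hs : f s = u) (hs' : f s' = (u⁻¹ : Sˣ))
    (h02 : (0 : ℕ) ≠ 2) :
    StableGL.map f (Units.map stabilize (shift13 h)) = StableGL.diag h02 u := by
  apply Units.ext
  change StableMatrix.map f (stabilize (shift13 h).val) = _
  rw [map_stabilize]
  ext i j
  rw [stabilize_entry]
  by_cases hij : i < 3 ∧ j < 3
  · obtain ⟨hi, hj⟩ := hij
    interval_cases i <;> interval_cases j <;>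
      simp [shift13, StableGL.diag, StableMatrix.diagonal, hs, hs']
  · rw [dif_neg hij]
    by_cases h' : i = j
    · subst h'
      have h0 : i ≠ 0 := by omega
      have h1 : i ≠ 2 := by omega
      simp [StableGL.diag, StableMatrix.diagonal, h0, h1]
    · simp [StableGL.diag, StableMatrix.diagonal, h']

end BlockMatrix

/-! ### Diagonal matrices over a commutative ring -/

section DiagHom

variable {B M : Type*} [CommRing B] [Ring M]

/-- Over a commutative ring, `a ↦ diag(a, a⁻¹)` is multiplicative. -/
def diagHom {i j : ℕ} (hij : i ≠ j) : Bˣ →* StableGL B where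
  toFun := StableGL.diag hij
  map_one' := by
    apply Units.ext
    ext k l
    simp only [StableGL.diag, StableMatrix.diagonal, Units.val_one, StableMatrix.one_entry]
    split_ifs <;> simp_all
  map_mul' a b := by
    apply Units.ext
    rw [Units.val_mul]
    simp only [StableGL.diag]
    rw [StableMatrix.diagonal_mul_diagonal]
    · ext k l
      simp only [StableMatrix.diagonal]
      split_ifs <;> simp [mul_comm]
    · exact ⟨i + j + 1, fun k hk => by simp [show k ≠ i by omega, show k ≠ j by omega]⟩

theorem map_diag (f : B →+* M) {i j : ℕ} (hij : i ≠ j) (a : Bˣ) :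
    StableGL.map f (StableGL.diag hij a) = StableGL.diag hij (Units.map (f : B →* M) a) := by
  apply Units.ext
  ext k l
  change f ((StableGL.diag hij a).val.entry k l) = _
  simp only [StableGL.diag, StableMatrix.diagonal]
  split_ifs <;> simp

end DiagHom

/-! ### Determinants of corner matrices -/

section Corner

variable {E : Type u} [NormedAddCommGroup E] [InnerProductSpace ℂ E] [CompleteSpace E]

/-- A nuclear representation of the corner gives one of the whole matrix with the same Gram matrix. -/
theorem isNuclearDet_stabilize {A : E →L[ℂ] E} {d : ℂ} (hA : IsNuclearDet A d) :
    IsNuclearDet (toOperator (stabilize !![A, 0, 0; 0, 1, 0; 0, 0, 1])) d := by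
  obtain ⟨ι, v, w, h, hx, hd⟩ := hA
  refine ⟨ι, fun k => inclusion 0 (v k), fun k => inclusion 0 (w k), ?_, fun z => ?_, ?_⟩
  · simpa only [norm_inclusion] using h
  · have h1 : toOperator (stabilize !![A, 0, 0; 0, 1, 0; 0, 0, 1]) z - z
        = inclusion 0 (A (z 0) - z 0) := by
      ext m
      have hX : ∀ i j, m + 3 ≤ i ∨ m + 3 ≤ j →
          (stabilize !![A, 0, 0; 0, 1, 0; 0, 0, 1]).entry i j = if i = j then 1 else 0 :=
        fun i j hij => dif_neg (by omega)
      rw [lp.coeFn_sub, Pi.sub_apply, toOperator_apply _ hX _ (by omega : m < m + 3),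
        inclusion_apply]
      have h2 : ∀ n, (stabilize !![A, 0, 0; 0, 1, 0; 0, 0, 1]).entry m n (z n)
          = (if m = n then z n else 0)
            + if n = 0 then (if m = 0 then A (z 0) - z 0 else 0) else 0 := by
        intro n
        rw [stabilize_entry]
        by_cases hmn : m < 3 ∧ n < 3
        · rw [dif_pos hmn]
          obtain ⟨hm, hn⟩ := hmn
          interval_cases m <;> interval_cases n <;> simp
        · rw [dif_neg hmn]
          by_cases hn : m = n
          · subst hn
            have : m ≠ 0 := by omega
            simp [this]
          · have : ¬ (n = 0 ∧ m = 0) := by omega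
            by_cases hn0 : n = 0
            · simp [hn, show m ≠ 0 by omega]
            · simp [hn, hn0]
      simp only [h2, Finset.sum_add_distrib, Finset.sum_ite_eq, Finset.sum_ite_eq',
        Finset.mem_range]
      rw [if_pos (by omega), if_pos (by omega), add_sub_cancel_left]
    rw [h1]
    have h3 := (inclusion 0 : E →L[ℂ] SumSpace E).hasSum (hx (z 0))
    simpa only [map_smul, inner_inclusion_left] using h3
  · have : ∀ k l, ⟪(inclusion 0 (v k) : SumSpace E), inclusion 0 (w l)⟫_ℂ = ⟪v k, w l⟫_ℂ :=
      fun k l => by rw [inner_inclusion_left, inclusion_apply, if_pos rfl]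
    simp only [this]
    exact hd

variable {H : Type u} [NormedAddCommGroup H] [InnerProductSpace ℂ H] [CompleteSpace H]
  {V : Submodule ℂ H} [CompleteSpace V]

/-- If the upper left corner of `U` lies over `1`, the determinant of `U` is that of the corner. -/
theorem exists_mem_detGraph_of_corner {U : (Matrix (Fin 3) (Fin 3) (extendedModule V))ˣ}
    {r : extendedModule V} (hU : U.val = !![r, 0, 0; 0, 1, 0; 0, 0, 1]) (h1 : p₁ V r = 1)
    {d : ℂ} (hd : IsNuclearDet (p₂ V r) d) :
    ∃ c : ℂˣ, (c : ℂ) = d ∧ (Units.map stabilize U, c) ∈ detGraph V := by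
  have hmap : ∀ {S : Type u} [Ring S] (f : extendedModule V →+* S),
      StableMatrix.map f (stabilize U.val) = stabilize !![f r, 0, 0; 0, 1, 0; 0, 0, 1] := by
    intro S _ f
    rw [map_stabilize, hU]
    congr 1
    ext i j
    fin_cases i <;> fin_cases j <;> simp
  have h2 : StableGL.map (p₁ V) (Units.map stabilize U) = 1 := by
    apply Units.ext
    change StableMatrix.map (p₁ V) (stabilize U.val) = 1
    rw [hmap, h1, ← map_one stabilize]
    congr 1
    ext i j
    fin_cases i <;> fin_cases j <;> simp
  have h3 : IsNuclearDet (extendedOperator V (Units.map stabilize U)) d := by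
    change IsNuclearDet (toOperator (StableMatrix.map (p₂ V) (stabilize U.val))) d
    rw [hmap]
    exact isNuclearDet_stabilize hd
  obtain ⟨c, hc⟩ := exists_mem_detGraph h2
  exact ⟨c, hc.2.unique h3, hc⟩

end Corner

/-! ### A limit of powers -/

section PowerLimit

/-- A variant of `(1 + t / n) ^ n → exp t` along a sequence of exponents. -/
theorem tendsto_pow_exp {d : ℕ → ℂ} {N : ℕ → ℕ} {t : ℂ} (hN : Tendsto N atTop atTop)
    (h : Tendsto (fun k => (N k : ℂ) * (d k - 1)) atTop (𝓝 t)) :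
    Tendsto (fun k => d k ^ N k) atTop (𝓝 (Complex.exp t)) := by
  have hN' : Tendsto (fun k => ((N k : ℂ))⁻¹) atTop (𝓝 0) := by
    have h1 : Tendsto (fun n : ℕ => ((n : ℂ))⁻¹) atTop (𝓝 0) := tendsto_inv_atTop_nhds_zero_nat
    exact h1.comp hN
  have hd : Tendsto d atTop (𝓝 1) := by
    have h1 := (hN'.mul h).add_const 1
    rw [zero_mul, zero_add] at h1
    refine h1.congr' ?_
    filter_upwards [hN.eventually_ne_atTop 0] with k hk
    have : (N k : ℂ) ≠ 0 := by exact_mod_cast hk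
    field_simp
    ring
  -- `log d = (d - 1) ℓ(d)` with `ℓ` continuous at `1` and `ℓ(1) = 1`
  have hs : ContinuousAt (dslope Complex.log 1) 1 :=
    continuousAt_dslope_same.2
      (Complex.hasDerivAt_log (by simp [Complex.slitPlane])).differentiableAt
  have h1 : dslope Complex.log 1 1 = 1 := by
    rw [dslope_same, (Complex.hasDerivAt_log (by simp [Complex.slitPlane])).deriv, inv_one]
  have h2 := h.mul (hs.tendsto.comp hd)
  rw [h1, mul_one] at h2
  refine (Complex.continuous_exp.continuousAt.tendsto.comp h2).congr' ?_
  filter_upwards [hd.eventually_ne one_ne_zero] with k hk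
  have h3 := sub_smul_dslope Complex.log 1 (d k)
  rw [Complex.log_one, sub_zero, smul_eq_mul] at h3
  simp only [Function.comp_apply]
  rw [mul_assoc, h3, Complex.exp_nat_mul, Complex.exp_log hk]

end PowerLimit

section MatrixGroup

variable {R : Type*} [Ring R]

theorem diag12_pow (a : Rˣ) (n : ℕ) : diag12 (a ^ n) = diag12 a ^ n := by
  induction n with
  | zero =>
    ext i j
    fin_cases i <;> fin_cases j <;> simp [diag12]
  | succ n ih =>
    rw [pow_succ (diag12 a), ← ih]
    ext i j
    rw [Units.val_mul]
    fin_cases i <;> fin_cases j <;>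
      simp [diag12, Matrix.mul_apply, Fin.sum_univ_three, ← inv_pow, pow_succ]
    exact ((Commute.refl _).pow_right n).eq

theorem diag13_pow (a : Rˣ) (n : ℕ) : diag13 (a ^ n) = diag13 a ^ n := by
  induction n with
  | zero =>
    ext i j
    fin_cases i <;> fin_cases j <;> simp [diag13]
  | succ n ih =>
    rw [pow_succ (diag13 a), ← ih]
    ext i j
    rw [Units.val_mul]
    fin_cases i <;> fin_cases j <;>
      simp [diag13, Matrix.mul_apply, Fin.sum_univ_three, ← inv_pow, pow_succ]
    exact ((Commute.refl _).pow_right n).eq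

/-- Both commutators are concentrated in the first coordinate, where they are `⁅a, b⁆` and `⁅b, a⁆`. -/
theorem commutator_diag12_diag13_swap (a b : Rˣ) :
    ⁅diag12 a, diag13 b⁆ = ⁅diag12 b, diag13 a⁆⁻¹ := by
  rw [eq_inv_iff_mul_eq_one]
  apply Units.ext
  rw [Units.val_mul, commutator_diag12_diag13, commutator_diag12_diag13, ← commutatorElement_inv a b]
  ext i j
  fin_cases i <;> fin_cases j <;> simp [Matrix.mul_apply, Fin.sum_univ_three, -commutatorElement_inv]

end MatrixGroup

/-! ### Toeplitz operators with triangular symbols -/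

section Compress

variable {H : Type u} [NormedAddCommGroup H] [InnerProductSpace ℂ H] [CompleteSpace H]
  {V : Submodule ℂ H} [CompleteSpace V]

theorem coe_compress (a : H →L[ℂ] H) (x : V) :
    compress V a x = V.orthogonalProjectionOnto (a x) := rfl

theorem compress_mul_of_right (a : H →L[ℂ] H) {b : H →L[ℂ] H} (hb : ∀ x ∈ V, b x ∈ V) :
    compress V (a * b) = compress V a * compress V b := by
  ext1 x
  change V.orthogonalProjectionOnto (a (b x))
    = V.orthogonalProjectionOnto (a (V.orthogonalProjectionOnto (b x) : V))
  congr 2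
  exact congrArg Subtype.val
    (Submodule.orthogonalProjectionOnto_mem_subspace_eq_self (⟨b x, hb x x.2⟩ : V)).symm

theorem compress_mul_of_left {a : H →L[ℂ] H} (ha : ∀ x ∈ Vᗮ, a x ∈ Vᗮ) (b : H →L[ℂ] H) :
    compress V (a * b) = compress V a * compress V b := by
  ext1 x
  change V.orthogonalProjectionOnto (a (b x))
    = V.orthogonalProjectionOnto (a (V.orthogonalProjectionOnto (b x) : V))
  rw [← sub_eq_zero, ← map_sub, ← map_sub]
  exact Submodule.orthogonalProjectionOnto_apply_of_mem_orthogonal (ha _ (by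
    rw [← Submodule.starProjection_apply]
    exact Submodule.sub_starProjection_mem_orthogonal _))

end Compress

/-! ### Symbols and their Toeplitz lifts -/

section Symbols

open MeasureTheory Real AddCircle

theorem mulOp_smul (c : ℂ) (φ : C(AddCircle (2 * π), ℂ)) : mulOp (c • φ) = c • mulOp φ := by
  rw [mulOp, map_smul, map_smul]; rfl

theorem mulOp_comm (φ ψ : C(AddCircle (2 * π), ℂ)) : mulOp φ * mulOp ψ = mulOp ψ * mulOp φ := by
  rw [← mulOp_mul, mul_comm φ ψ, mulOp_mul]

theorem continuous_mulOp : Continuous mulOp :=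
  (((ContinuousLinearMap.mul ℂ ℂ).holderL haarAddCircle ⊤ 2 2).comp
    (ContinuousMap.toLp ⊤ haarAddCircle ℂ)).continuous

/-- The continuous functions whose multiplication operators preserve the subspace `W`. -/
def preserve (W : Submodule ℂ L2Circle) : Subalgebra ℂ C(AddCircle (2 * π), ℂ) where
  carrier := {φ | ∀ x ∈ W, mulOp φ x ∈ W}
  mul_mem' {φ ψ} hφ hψ x hx := by
    rw [mulOp_mul]
    exact hφ _ (hψ x hx)
  add_mem' {φ ψ} hφ hψ x hx := by
    rw [mulOp_add]
    exact W.add_mem (hφ x hx) (hψ x hx)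
  algebraMap_mem' c x hx := by
    rw [Algebra.algebraMap_eq_smul_one, mulOp_smul, mulOp_one]
    exact W.smul_mem c hx

theorem isClosed_preserve {W : Submodule ℂ L2Circle} (hW : IsClosed (W : Set L2Circle)) :
    IsClosed (preserve W : Set C(AddCircle (2 * π), ℂ)) := by
  have h : (preserve W : Set C(AddCircle (2 * π), ℂ))
      = ⋂ x ∈ W, (fun φ => mulOp φ x) ⁻¹' W := by
    ext φ
    simp only [Set.mem_iInter, Set.mem_preimage]
    rfl
  rw [h]
  refine isClosed_biInter fun x _ => hW.preimage ?_
  exact continuous_mulOp.clm_apply continuous_const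

theorem fourierLp_mem_hardySpace {n : ℤ} (hn : 0 ≤ n) :
    (fourierLp 2 n : L2Circle) ∈ hardySpace :=
  Submodule.le_topologicalClosure _ (Submodule.subset_span ⟨n.toNat, by simp [hn]⟩)

theorem hardySpace_le {W : Submodule ℂ L2Circle} (hW : IsClosed (W : Set L2Circle))
    (h : ∀ n : ℤ, 0 ≤ n → (fourierLp 2 n : L2Circle) ∈ W) : hardySpace ≤ W := by
  refine Submodule.topologicalClosure_minimal _ (Submodule.span_le.2 ?_) hW
  rintro _ ⟨n, rfl⟩
  exact h n (Int.natCast_nonneg n)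

theorem isClosed_hardySpace : IsClosed (hardySpace : Set L2Circle) :=
  Submodule.isClosed_topologicalClosure _

theorem mem_hardySpace_orthogonal_iff {x : L2Circle} :
    x ∈ hardySpaceᗮ ↔ ∀ n : ℤ, 0 ≤ n → ⟪(fourierLp 2 n : L2Circle), x⟫_ℂ = 0 := by
  refine ⟨fun h n hn => h _ (fourierLp_mem_hardySpace hn), fun h y hy => ?_⟩
  have h1 : hardySpace ≤ (Submodule.span ℂ {x})ᗮ := by
    refine hardySpace_le (Submodule.isClosed_orthogonal _) fun n hn => ?_
    rw [Submodule.mem_orthogonal_singleton_iff_inner_left]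
    exact h n hn
  exact (Submodule.mem_orthogonal_singleton_iff_inner_left.1 (h1 hy))

theorem fourierLp_mem_orthogonal {n : ℤ} (hn : n < 0) :
    (fourierLp 2 n : L2Circle) ∈ hardySpaceᗮ :=
  mem_hardySpace_orthogonal_iff.2 fun m hm =>
    (orthonormal_fourier (T := 2 * π)).2 (by omega)

theorem hasSum_fourierLp (x : L2Circle) :
    HasSum (fun n : ℤ => ⟪(fourierLp 2 n : L2Circle), x⟫_ℂ • (fourierLp 2 n : L2Circle)) x := by
  have h := (fourierBasis (T := 2 * π)).hasSum_repr x
  simpa only [HilbertBasis.repr_apply_apply, coe_fourierBasis] using h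

/-- Functions without negative frequencies preserve the Hardy space. -/
theorem mem_preserve_hardySpace {φ : C(AddCircle (2 * π), ℂ)}
    (h : ∀ n : ℤ, n < 0 → fourierCoeff φ n = 0) : φ ∈ preserve hardySpace := by
  have h1 : hardySpace ≤ hardySpace.comap (mulOp φ : L2Circle →ₗ[ℂ] L2Circle) := by
    refine hardySpace_le (isClosed_hardySpace.preimage (mulOp φ).continuous) fun n hn => ?_
    refine isClosed_hardySpace.mem_of_tendsto (hasSum_fourierLp (mulOp φ (fourierLp 2 n)))
      (Eventually.of_forall fun s => Submodule.sum_mem _ fun k _ => ?_)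
    by_cases hk : 0 ≤ k
    · exact Submodule.smul_mem _ _ (fourierLp_mem_hardySpace hk)
    · rw [inner_mulOp, h _ (by omega), zero_smul]
      exact Submodule.zero_mem _
  exact fun x hx => h1 hx

/-- Functions without positive frequencies preserve the complement of the Hardy space. -/
theorem mem_preserve_orthogonal {φ : C(AddCircle (2 * π), ℂ)}
    (h : ∀ n : ℤ, 0 < n → fourierCoeff φ n = 0) : φ ∈ preserve hardySpaceᗮ := by
  intro x hx
  rw [mem_hardySpace_orthogonal_iff] at hx ⊢
  intro n hn
  have h1 := (hasSum_fourierLp x).mapL (mulOp φ)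
  have h2 := h1.mapL (innerSL ℂ (fourierLp 2 n : L2Circle))
  refine h2.unique ?_
  convert hasSum_zero using 1
  ext k
  rw [map_smul, map_smul, innerSL_apply_apply, inner_mulOp]
  by_cases hk : 0 ≤ k
  · rw [hx k hk, zero_smul]
  · rw [h _ (by omega), smul_zero]

theorem fourier_mem_preserve {n : ℤ} (hn : 0 ≤ n) : fourier n ∈ preserve hardySpace :=
  mem_preserve_hardySpace fun m hm => by
    rw [fourierCoeff_fourier, Pi.single_apply, if_neg (by omega)]

theorem fourier_mem_preserve_orthogonal {n : ℤ} (hn : n ≤ 0) :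
    fourier n ∈ preserve hardySpaceᗮ :=
  mem_preserve_orthogonal fun m hm => by
    rw [fourierCoeff_fourier, Pi.single_apply, if_neg (by omega)]

/-- The algebra of twice continuously differentiable functions on the circle. -/
def symbolAlgebra : Subalgebra ℂ C(AddCircle (2 * π), ℂ) where
  carrier := {φ | ContDiff ℝ 2 fun x : ℝ => φ x}
  mul_mem' {φ ψ} (hφ : ContDiff ℝ 2 fun x : ℝ => φ x) (hψ : ContDiff ℝ 2 fun x : ℝ => ψ x) :=
    hφ.mul hψ
  add_mem' {φ ψ} (hφ : ContDiff ℝ 2 fun x : ℝ => φ x) (hψ : ContDiff ℝ 2 fun x : ℝ => ψ x) :=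
    hφ.add hψ
  algebraMap_mem' c := (contDiff_const : ContDiff ℝ 2 fun _ : ℝ => c)

theorem mem_symbolAlgebra {φ : C(AddCircle (2 * π), ℂ)} :
    φ ∈ symbolAlgebra ↔ ContDiff ℝ 2 fun x : ℝ => φ x := Iff.rfl

theorem fourier_mem_symbolAlgebra (n : ℤ) : fourier n ∈ symbolAlgebra := by
  rw [mem_symbolAlgebra]
  simp only [fourier_coe_apply]
  exact ((contDiff_const.mul Complex.ofRealCLM.contDiff).div_const _).cexp

theorem mulOp_mem {φ : C(AddCircle (2 * π), ℂ)} (hφ : φ ∈ symbolAlgebra) :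
    mulOp φ ∈ universalModule hardySpace := by
  obtain ⟨C, hC⟩ := fourierCoeff_decay φ hφ
  exact mulOp_mem_of_decay _ C hC

/-- Multiplication operators with symbols in `symbolAlgebra`. -/
def multiplication : symbolAlgebra →+* universalModule hardySpace where
  toFun φ := ⟨mulOp φ, mulOp_mem φ.2⟩
  map_one' := Subtype.ext mulOp_one
  map_mul' φ ψ := Subtype.ext (mulOp_mul φ ψ)
  map_zero' := Subtype.ext mulOp_zero
  map_add' φ ψ := Subtype.ext (mulOp_add φ ψ)

/-- The lift of the multiplication operator with symbol `φ` to the fibre product, given by the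
Toeplitz operator with symbol `φ`. -/
def toeplitzLift (φ : symbolAlgebra) : extendedModule hardySpace :=
  ⟨(multiplication φ, compress hardySpace (mulOp φ)), by
    change IsTraceClass (compress hardySpace (mulOp φ) - compress hardySpace (mulOp φ))
    rw [sub_self]
    exact isTraceClass_zero⟩

theorem p₁_toeplitzLift (φ : symbolAlgebra) :
    p₁ hardySpace (toeplitzLift φ) = multiplication φ := rfl

theorem toeplitzLift_one : toeplitzLift 1 = 1 :=
  Subtype.ext (Prod.ext (map_one multiplication)
    ((congrArg (compress hardySpace) mulOp_one).trans (compress_one _)))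

theorem compress_mulOp_mul {φ ψ : C(AddCircle (2 * π), ℂ)}
    (h : ψ ∈ preserve hardySpace ∨ φ ∈ preserve hardySpaceᗮ) :
    compress hardySpace (mulOp (φ * ψ))
      = compress hardySpace (mulOp φ) * compress hardySpace (mulOp ψ) := by
  rw [mulOp_mul]
  exact h.elim (compress_mul_of_right _) fun h => compress_mul_of_left h _

theorem toeplitzLift_mul {φ ψ : symbolAlgebra}
    (h : (ψ : C(AddCircle (2 * π), ℂ)) ∈ preserve hardySpace
      ∨ (φ : C(AddCircle (2 * π), ℂ)) ∈ preserve hardySpaceᗮ) :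
    toeplitzLift (φ * ψ) = toeplitzLift φ * toeplitzLift ψ :=
  Subtype.ext (Prod.ext (map_mul multiplication φ ψ) (compress_mulOp_mul h))

end Symbols

/-! ### Algebraic identities for corners -/

section CornerRing

variable {R : Type*} [Ring R] {s s' : R}

/-- The corner entry of `⁅diag(a, a⁻¹, 1), shift⁆`; see `commutator_diag12_shift13`. When `a` commutes
with `s`, as for analytic symbols, it differs from `1` by a multiple of the idempotent `1 - s s'`. -/
theorem corner_of_commute (a : Rˣ) (ha : (a : R) * s = s * a) :
    (a : R) * s * ((a⁻¹ : Rˣ) : R) * s' + a * (1 - s * s') = 1 + (a - 1) * (1 - s * s') := by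
  rw [ha, mul_assoc s, Units.mul_inv, mul_one]
  noncomm_ring

/-- The same when `a` commutes with the left inverse `s'` of `s`, as for antianalytic symbols. -/
theorem corner_of_commute_left_inverse (a : Rˣ) (ha : (a : R) * s' = s' * a) :
    (a : R) * s * ((a⁻¹ : Rˣ) : R) * s' + a * (1 - s * s')
      = 1 + a * (1 - s * s') * (1 - ((a⁻¹ : Rˣ) : R)) := by
  have h1 : ((a⁻¹ : Rˣ) : R) * s' = s' * ((a⁻¹ : Rˣ) : R) := by
    rw [Units.inv_mul_eq_iff_eq_mul, ← mul_assoc, ha, mul_assoc, Units.mul_inv, mul_one]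
  rw [mul_assoc _ _ s', h1, ← sub_eq_zero]
  have h2 : (a : R) * ((a⁻¹ : Rˣ) : R) = 1 := Units.mul_inv a
  have h3 : (a : R) * s * (s' * ((a⁻¹ : Rˣ) : R)) + a * (1 - s * s')
      - (1 + a * (1 - s * s') * (1 - ((a⁻¹ : Rˣ) : R))) = a * ((a⁻¹ : Rˣ) : R) - 1 := by
    noncomm_ring
  rw [h3, h2, sub_self]

end CornerRing

/-! ### Determinants of commutators -/

section CommutatorDet

variable {Q K : Type*} [Group Q] [Group K]

/-- The determinant of the commutator of `x` and `y` is `d`. -/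
def HasCommutatorDet (D : Subgroup (Q × ℂˣ)) (x y : Q) (d : ℂˣ) : Prop := (⁅x, y⁆, d) ∈ D

namespace HasCommutatorDet

variable {π : Q →* K} {D : Subgroup (Q × ℂˣ)} {x x' y y' : Q} {d d' : ℂˣ}

theorem mul_left (h : HasCommutatorDet D x y d) (hD : IsDeterminantGraph π D)
    (h' : HasCommutatorDet D x' y d') : HasCommutatorDet D (x * x') y (d * d') :=
  (commutatorGraph hD y).mul_mem (x := (x, d)) (y := (x', d')) h h'

theorem pow_left (h : HasCommutatorDet D x y d) (hD : IsDeterminantGraph π D) (n : ℕ) :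
    HasCommutatorDet D (x ^ n) y (d ^ n) :=
  (commutatorGraph hD y).pow_mem (x := (x, d)) h n

theorem zpow_left (h : HasCommutatorDet D x y d) (hD : IsDeterminantGraph π D) (n : ℤ) :
    HasCommutatorDet D (x ^ n) y (d ^ n) :=
  (commutatorGraph hD y).zpow_mem (x := (x, d)) h n

theorem symm (h : HasCommutatorDet D x y d) (hD : IsDeterminantGraph π D) :
    HasCommutatorDet D y x d⁻¹ :=
  commutatorGraph_symm hD h

theorem mul_right (h : HasCommutatorDet D x y d) (hD : IsDeterminantGraph π D)
    (h' : HasCommutatorDet D x y' d') : HasCommutatorDet D x (y * y') (d * d') := by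
  have h1 := ((h.symm hD).mul_left hD (h'.symm hD)).symm hD
  rwa [← mul_inv, inv_inv] at h1

theorem pow_right (h : HasCommutatorDet D x y d) (hD : IsDeterminantGraph π D) (n : ℕ) :
    HasCommutatorDet D x (y ^ n) (d ^ n) := by
  have h1 := ((h.symm hD).pow_left hD n).symm hD
  rwa [inv_pow, inv_inv] at h1

theorem zpow_right (h : HasCommutatorDet D x y d) (hD : IsDeterminantGraph π D) (n : ℤ) :
    HasCommutatorDet D x (y ^ n) (d ^ n) := by
  have h1 := ((h.symm hD).zpow_left hD n).symm hD
  rwa [inv_zpow, inv_inv] at h1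

theorem unique (h : HasCommutatorDet D x y d) (hD : IsDeterminantGraph π D)
    (h' : HasCommutatorDet D x y d') : d = d' :=
  hD.unique h h'

end HasCommutatorDet

variable {R : Type*} [Ring R] {D : Subgroup (StableGL R × ℂˣ)}

theorem hasCommutatorDet_one_of_commute {a b : Rˣ} (hab : Commute a b) :
    HasCommutatorDet D (Units.map stabilize (diag12 a)) (Units.map stabilize (diag13 b)) 1 := by
  have h : (⁅diag12 a, diag13 b⁆ : (Matrix (Fin 3) (Fin 3) R)ˣ) = 1 := by
    apply Units.ext
    rw [commutator_diag12_diag13, commutatorElement_eq_one_iff_commute.2 hab]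
    ext i j
    fin_cases i <;> fin_cases j <;> rfl
  unfold HasCommutatorDet
  rw [← map_commutatorElement, h, map_one]
  exact D.one_mem

theorem HasCommutatorDet.diag_swap {a b : Rˣ} {d : ℂˣ}
    (h : HasCommutatorDet D (Units.map stabilize (diag12 b)) (Units.map stabilize (diag13 a)) d) :
    HasCommutatorDet D (Units.map stabilize (diag12 a)) (Units.map stabilize (diag13 b)) d⁻¹ := by
  have h1 := D.inv_mem h
  unfold HasCommutatorDet
  rw [← map_commutatorElement, commutator_diag12_diag13_swap, map_inv, map_commutatorElement]
  exact h1

variable {H : Type u} [NormedAddCommGroup H] [InnerProductSpace ℂ H] [CompleteSpace H]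
  {V : Submodule ℂ H} [CompleteSpace V]

theorem exists_hasCommutatorDet {U W : (Matrix (Fin 3) (Fin 3) (extendedModule V))ˣ}
    {r : extendedModule V} (hU : (⁅U, W⁆ : (Matrix (Fin 3) (Fin 3) (extendedModule V))ˣ).val
      = !![r, 0, 0; 0, 1, 0; 0, 0, 1]) (h1 : p₁ V r = 1)
    {d : ℂ} (hd : IsNuclearDet (p₂ V r) d) :
    ∃ c : ℂˣ, (c : ℂ) = d ∧
      HasCommutatorDet (detGraph V) (Units.map stabilize U) (Units.map stabilize W) c := by
  obtain ⟨c, hc, h⟩ := exists_mem_detGraph_of_corner hU h1 hd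
  refine ⟨c, hc, ?_⟩
  rw [map_commutatorElement] at h
  exact h

end CommutatorDet

/-! ### Exponentials of symbols -/

section Exponential

open MeasureTheory Real AddCircle

theorem exp_continuousMap_apply (f : C(AddCircle (2 * π), ℂ)) (x : AddCircle (2 * π)) :
    NormedSpace.exp f x = Complex.exp (f x) := by
  have h := NormedSpace.map_exp ((Pi.evalRingHom (fun _ : AddCircle (2 * π) => ℂ) x).comp
    ContinuousMap.coeFnRingHom) (continuous_eval_const x) f
  rw [Complex.exp_eq_exp_ℂ]
  exact h

/-- The exponential of a symbol. -/
def expSymbol (f : symbolAlgebra) : symbolAlgebra :=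
  ⟨NormedSpace.exp (f : C(AddCircle (2 * π), ℂ)), by
    rw [mem_symbolAlgebra]
    simp only [exp_continuousMap_apply]
    exact ContDiff.cexp f.2⟩

theorem expSymbol_add (f g : symbolAlgebra) :
    expSymbol (f + g) = expSymbol f * expSymbol g :=
  Subtype.ext NormedSpace.exp_add

theorem expSymbol_zero : expSymbol 0 = 1 := Subtype.ext NormedSpace.exp_zero

theorem expSymbol_neg_mul (f : symbolAlgebra) : expSymbol (-f) * expSymbol f = 1 := by
  rw [← expSymbol_add, neg_add_cancel, expSymbol_zero]

theorem expSymbol_mul_neg (f : symbolAlgebra) : expSymbol f * expSymbol (-f) = 1 := by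
  rw [← expSymbol_add, add_neg_cancel, expSymbol_zero]

theorem expSymbol_mem_preserve {W : Submodule ℂ L2Circle} (hW : IsClosed (W : Set L2Circle))
    {f : symbolAlgebra} (hf : (f : C(AddCircle (2 * π), ℂ)) ∈ preserve W) :
    (expSymbol f : C(AddCircle (2 * π), ℂ)) ∈ preserve W :=
  NormedSpace.exp_mem (R := ℂ) (isClosed_preserve hW) hf

/-- The symbols `f` for which `M(f)` preserves the Hardy space or its complement. -/
def IsTriangular (f : symbolAlgebra) : Prop :=
  (f : C(AddCircle (2 * π), ℂ)) ∈ preserve hardySpace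
    ∨ (f : C(AddCircle (2 * π), ℂ)) ∈ preserve hardySpaceᗮ

theorem neg_mem_preserve {W : Submodule ℂ L2Circle} {f : symbolAlgebra}
    (h : (f : C(AddCircle (2 * π), ℂ)) ∈ preserve W) :
    ((-f : symbolAlgebra) : C(AddCircle (2 * π), ℂ)) ∈ preserve W :=
  Subalgebra.neg_mem _ h

theorem smul_mem_preserve {W : Submodule ℂ L2Circle} {f : symbolAlgebra}
    (h : (f : C(AddCircle (2 * π), ℂ)) ∈ preserve W) (c : ℂ) :
    ((c • f : symbolAlgebra) : C(AddCircle (2 * π), ℂ)) ∈ preserve W :=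
  Subalgebra.smul_mem _ h c

theorem IsTriangular.smul {f : symbolAlgebra} (hf : IsTriangular f) (c : ℂ) :
    IsTriangular (c • f) :=
  hf.imp (smul_mem_preserve · c) (smul_mem_preserve · c)

/-- The properties of the Toeplitz lift on which the construction of lifts of units rests: it is
multiplicative on products `φ ψ` such that `M(ψ)` preserves the Hardy space or `M(φ)` preserves its
complement. -/
structure IsToeplitzLift {R : Type*} [Ring R] (T : symbolAlgebra → R) : Prop where
  map_one : T 1 = 1
  map_mul : ∀ {φ ψ : symbolAlgebra}, ((ψ : C(AddCircle (2 * π), ℂ)) ∈ preserve hardySpace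
      ∨ (φ : C(AddCircle (2 * π), ℂ)) ∈ preserve hardySpaceᗮ) → T (φ * ψ) = T φ * T ψ

theorem isToeplitzLift_toeplitzLift : IsToeplitzLift toeplitzLift :=
  ⟨toeplitzLift_one, toeplitzLift_mul⟩

/-- The function `e^{inθ}` as a symbol. -/
def monomial (n : ℤ) : symbolAlgebra := ⟨fourier n, fourier_mem_symbolAlgebra n⟩

theorem monomial_mem_preserve {n : ℤ} (hn : 0 ≤ n) :
    (monomial n : C(AddCircle (2 * π), ℂ)) ∈ preserve hardySpace :=
  fourier_mem_preserve hn

theorem monomial_mem_preserve_orthogonal {n : ℤ} (hn : n ≤ 0) :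
    (monomial n : C(AddCircle (2 * π), ℂ)) ∈ preserve hardySpaceᗮ :=
  fourier_mem_preserve_orthogonal hn

theorem monomial_add (m n : ℤ) : monomial (m + n) = monomial m * monomial n :=
  Subtype.ext (ContinuousMap.ext fun _ => fourier_add)

theorem monomial_zero : monomial 0 = 1 :=
  Subtype.ext (ContinuousMap.ext fun _ => fourier_zero)

namespace IsToeplitzLift

variable {R : Type*} [Ring R] {T : symbolAlgebra → R} (hT : IsToeplitzLift T)

include hT

theorem map_exp_add {f g : symbolAlgebra}
    (h : (g : C(AddCircle (2 * π), ℂ)) ∈ preserve hardySpace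
      ∨ (f : C(AddCircle (2 * π), ℂ)) ∈ preserve hardySpaceᗮ) :
    T (expSymbol (f + g)) = T (expSymbol f) * T (expSymbol g) := by
  rw [expSymbol_add]
  exact hT.map_mul (h.imp (expSymbol_mem_preserve isClosed_hardySpace)
    (expSymbol_mem_preserve (Submodule.isClosed_orthogonal _)))

/-- The lift of `M(e^f)` to a unit, for triangular `f`. -/
def expLift (f : symbolAlgebra) (hf : IsTriangular f) : Rˣ where
  val := T (expSymbol f)
  inv := T (expSymbol (-f))
  val_inv := by
    rw [← hT.map_exp_add (hf.imp_left neg_mem_preserve), add_neg_cancel, expSymbol_zero,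
      hT.map_one]
  inv_val := by
    rw [← hT.map_exp_add (hf.imp_right neg_mem_preserve), neg_add_cancel, expSymbol_zero,
      hT.map_one]

theorem expLift_val (f : symbolAlgebra) (hf : IsTriangular f) :
    (hT.expLift f hf).val = T (expSymbol f) := rfl

theorem expLift_commute {f g : symbolAlgebra} (hf : IsTriangular f) (hg : IsTriangular g)
    (h : ((f : C(AddCircle (2 * π), ℂ)) ∈ preserve hardySpace
        ∧ (g : C(AddCircle (2 * π), ℂ)) ∈ preserve hardySpace)
      ∨ ((f : C(AddCircle (2 * π), ℂ)) ∈ preserve hardySpaceᗮ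
        ∧ (g : C(AddCircle (2 * π), ℂ)) ∈ preserve hardySpaceᗮ)) :
    Commute (hT.expLift f hf) (hT.expLift g hg) := by
  apply Units.ext
  rw [Units.val_mul, Units.val_mul]
  simp only [expLift_val]
  rw [← hT.map_exp_add (h.imp And.right And.left),
    ← hT.map_exp_add (h.imp And.left And.right), add_comm]

theorem expLift_pow {f : symbolAlgebra} (hf : IsTriangular f) (n : ℕ) :
    hT.expLift ((n : ℂ) • f) (hf.smul n) = hT.expLift f hf ^ n := by
  induction n with
  | zero =>
    apply Units.ext
    rw [expLift_val, Nat.cast_zero, zero_smul, expSymbol_zero, hT.map_one, pow_zero,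
      Units.val_one]
  | succ n ih =>
    rw [pow_succ, ← ih]
    apply Units.ext
    rw [Units.val_mul]
    simp only [expLift_val]
    rw [← hT.map_exp_add (hf.imp_right (smul_mem_preserve · _))]
    congr 2
    push_cast
    rw [add_smul, one_smul]

theorem map_monomial_mul : T (monomial (-1)) * T (monomial 1) = 1 := by
  rw [← hT.map_mul (Or.inl (monomial_mem_preserve zero_le_one)), ← monomial_add,
    neg_add_cancel, monomial_zero, hT.map_one]

theorem expLift_mul_monomial {f : symbolAlgebra} (hf : IsTriangular f)
    (h : (f : C(AddCircle (2 * π), ℂ)) ∈ preserve hardySpace) :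
    (hT.expLift f hf : R) * T (monomial 1) = T (monomial 1) * hT.expLift f hf := by
  rw [expLift_val, ← hT.map_mul (Or.inl (monomial_mem_preserve zero_le_one)),
    ← hT.map_mul (Or.inl (expSymbol_mem_preserve isClosed_hardySpace h)), mul_comm]

theorem expLift_mul_monomial_neg {f : symbolAlgebra} (hf : IsTriangular f)
    (h : (f : C(AddCircle (2 * π), ℂ)) ∈ preserve hardySpaceᗮ) :
    (hT.expLift f hf : R) * T (monomial (-1)) = T (monomial (-1)) * hT.expLift f hf := by
  rw [expLift_val, ← hT.map_mul (Or.inr (monomial_mem_preserve_orthogonal (by norm_num))),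
    ← hT.map_mul (Or.inr (expSymbol_mem_preserve (Submodule.isClosed_orthogonal _) h)), mul_comm]

end IsToeplitzLift

end Exponential

/-! ### Corners of rank one -/

section CornerDet

variable {R S : Type*} [Ring R] [Ring S] {s s' : R}

theorem map_corner_eq_one (f : R →+* S) (h : f s * f s' = 1) (x y : R) :
    f (1 + x * (1 - s * s') * y) = 1 := by
  simp [h]

variable {E : Type u} [NormedAddCommGroup E] [InnerProductSpace ℂ E] [CompleteSpace E]

theorem map_mul_apply (f : R →+* (E →L[ℂ] E)) (x y : R) (z : E) : f (x * y) z = f x (f y z) := by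
  rw [map_mul]
  rfl

theorem map_one_apply (f : R →+* (E →L[ℂ] E)) (z : E) : f 1 z = z := by
  rw [map_one]
  rfl

theorem map_add_apply (f : R →+* (E →L[ℂ] E)) (x y : R) (z : E) :
    f (x + y) z = f x z + f y z := by
  rw [map_add]
  rfl

theorem map_sub_apply (f : R →+* (E →L[ℂ] E)) (x y : R) (z : E) :
    f (x - y) z = f x z - f y z := by
  rw [map_sub]
  rfl

/-- The corner of the commutator of a unit and a shift is a rank one perturbation of the identity;
its determinant is a matrix coefficient. -/
theorem isNuclearDet_corner (f : R →+* (E →L[ℂ] E)) {e : E} (he : ⟪e, e⟫_ℂ = 1)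
    (hs : ∀ y, f s (f s' y) = y - ⟪e, y⟫_ℂ • e) (a : Rˣ)
    (ha : (a : R) * s = s * a ∨ (a : R) * s' = s' * a) :
    IsNuclearDet (f (a * s * ((a⁻¹ : Rˣ) : R) * s' + a * (1 - s * s'))) ⟪e, f a e⟫_ℂ := by
  have hs' : ∀ y, f (1 - s * s') y = ⟪e, y⟫_ℂ • e := fun y => by
    rw [map_sub_apply, map_one_apply, map_mul_apply, hs, sub_sub_cancel]
  have hinv : f ((a⁻¹ : Rˣ) : R) (f a e) = e := by
    rw [← map_mul_apply, Units.inv_mul, map_one_apply]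
  rcases ha with ha | ha
  · rw [corner_of_commute a ha]
    have h1 := isNuclearDet_rankOne (A := f (1 + (a - 1) * (1 - s * s'))) e (f (a - 1) e)
      fun y => by
        rw [map_add_apply, map_one_apply, map_mul_apply, hs', map_smul]
    convert h1 using 1
    rw [map_sub_apply, map_one_apply, inner_sub_right, he]
    ring
  · rw [corner_of_commute_left_inverse a ha]
    have h1 := isNuclearDet_rankOne (A := f (1 + a * (1 - s * s') * (1 - ((a⁻¹ : Rˣ) : R))))
      ((f (1 - ((a⁻¹ : Rˣ) : R))).adjoint e) (f a e) fun y => by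
        rw [map_add_apply, map_one_apply, map_mul_apply, map_mul_apply, hs',
          map_smul, ContinuousLinearMap.adjoint_inner_left]
    convert h1 using 1
    rw [ContinuousLinearMap.adjoint_inner_left, map_sub_apply, map_one_apply, hinv,
      inner_sub_right, he]
    ring

/-- The corner of the commutator of two shifts exchanges the unit vectors `e` and `s e`: it is the
reflection `1 - ⟪e - s e, ·⟫ (e - s e)`, of determinant `1 - ‖e - s e‖ ^ 2 = -1`. -/
theorem isNuclearDet_corner_shift (f : R →+* (E →L[ℂ] E)) {e : E}
    (he : ⟪e, e⟫_ℂ = 1) (hse : f s' e = 0) (hiso : ∀ x y, ⟪f s x, y⟫_ℂ = ⟪x, f s' y⟫_ℂ)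
    (h : s' * s = 1)
    (hs : ∀ y, f s (f s' y) = y - ⟪e, y⟫_ℂ • e) :
    IsNuclearDet (f (1 - ((1 - s * s') + s * (1 - s * s') * s')
      + (s * (1 - s * s') + (1 - s * s') * s'))) (-1) := by
  have hs' : ∀ y, f (1 - s * s') y = ⟪e, y⟫_ℂ • e := fun y => by
    rw [map_sub_apply, map_one_apply, map_mul_apply, hs, sub_sub_cancel]
  have h1 := isNuclearDet_rankOne (A := f (1 - ((1 - s * s') + s * (1 - s * s') * s')
      + (s * (1 - s * s') + (1 - s * s') * s'))) (e - f s e) (f s e - e) fun y => by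
    rw [map_add_apply, map_sub_apply, map_add_apply, map_add_apply, map_one_apply, hs',
      map_mul_apply f (s * (1 - s * s')) s', map_mul_apply f s (1 - s * s'),
      map_mul_apply f s (1 - s * s'), map_mul_apply f (1 - s * s') s', hs', hs', map_smul,
      map_smul, inner_sub_left, hiso]
    module
  convert h1 using 1
  have h2 : f s' (f s e) = e := by rw [← map_mul_apply, h, map_one_apply]
  rw [inner_sub_left, inner_sub_right, inner_sub_right, hiso, hiso, h2, he, hse, inner_zero_right,
    ← inner_conj_symm e (f s e), hiso, hse, inner_zero_right]
  norm_num

theorem map_corner_of_commute (p : R →+* S) (h : p s * p s' = 1) (a : Rˣ)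
    (ha : (a : R) * s = s * a ∨ (a : R) * s' = s' * a) :
    p (a * s * ((a⁻¹ : Rˣ) : R) * s' + a * (1 - s * s')) = 1 := by
  rcases ha with ha | ha
  · rw [corner_of_commute a ha, ← mul_one ((↑a - 1) * (1 - s * s'))]
    exact map_corner_eq_one p h _ _
  · rw [corner_of_commute_left_inverse a ha]
    exact map_corner_eq_one p h _ _

theorem map_corner_shift (p : R →+* S) (h : p s * p s' = 1) :
    p (1 - ((1 - s * s') + s * (1 - s * s') * s')
      + (s * (1 - s * s') + (1 - s * s') * s')) = 1 := by
  simp [h]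

end CornerDet

section ShiftDet

variable {H : Type u} [NormedAddCommGroup H] [InnerProductSpace ℂ H] [CompleteSpace H]
  {V : Submodule ℂ H} [CompleteSpace V] {s s' : extendedModule V} (h : s' * s = 1)
  (h1 : p₁ V s * p₁ V s' = 1) {e : V} (he : ⟪e, e⟫_ℂ = 1)
  (hs : ∀ y, p₂ V s (p₂ V s' y) = y - ⟪e, y⟫_ℂ • e)

include h h1 he hs

theorem exists_hasCommutatorDet_diag12_shift13 (a : (extendedModule V)ˣ)
    (ha : (a : extendedModule V) * s = s * a ∨ (a : extendedModule V) * s' = s' * a) :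
    ∃ c : ℂˣ, (c : ℂ) = ⟪e, p₂ V a e⟫_ℂ ∧ HasCommutatorDet (detGraph V)
      (Units.map stabilize (diag12 a)) (Units.map stabilize (shift13 h)) c :=
  exists_hasCommutatorDet (commutator_diag12_shift13 h a) (map_corner_of_commute (p₁ V) h1 a ha)
    (isNuclearDet_corner (p₂ V) he hs a ha)

theorem exists_hasCommutatorDet_diag13_shift12 (a : (extendedModule V)ˣ)
    (ha : (a : extendedModule V) * s = s * a ∨ (a : extendedModule V) * s' = s' * a) :
    ∃ c : ℂˣ, (c : ℂ) = ⟪e, p₂ V a e⟫_ℂ ∧ HasCommutatorDet (detGraph V)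
      (Units.map stabilize (diag13 a)) (Units.map stabilize (shift12 h)) c :=
  exists_hasCommutatorDet (commutator_diag13_shift12 h a) (map_corner_of_commute (p₁ V) h1 a ha)
    (isNuclearDet_corner (p₂ V) he hs a ha)

theorem hasCommutatorDet_shift12_shift13 (hse : p₂ V s' e = 0)
    (hiso : ∀ x y, ⟪p₂ V s x, y⟫_ℂ = ⟪x, p₂ V s' y⟫_ℂ) :
    HasCommutatorDet (detGraph V) (Units.map stabilize (shift12 h))
      (Units.map stabilize (shift13 h)) (-1) := by
  obtain ⟨c, hc, hcd⟩ := exists_hasCommutatorDet (commutator_shift12_shift13 h rfl)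
    (map_corner_shift (p₁ V) h1) (isNuclearDet_corner_shift (p₂ V) he hse hiso h hs)
  have h2 : c = -1 := Units.ext (by rw [hc, Units.val_neg, Units.val_one])
  rw [h2] at hcd
  exact hcd

end ShiftDet

/-! ### The unilateral shift -/

section Shift

open MeasureTheory Real AddCircle

theorem inner_mulOp_fourier (k m : ℤ) (x : L2Circle) :
    ⟪(fourierLp 2 k : L2Circle), mulOp (fourier m) x⟫_ℂ
      = ⟪(fourierLp 2 (k - m) : L2Circle), x⟫_ℂ := by
  have h := ((hasSum_fourierLp x).mapL (mulOp (fourier m))).mapL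
    (innerSL ℂ (fourierLp 2 k : L2Circle))
  have h1 := hasSum_single (f := fun n : ℤ => innerSL ℂ (fourierLp 2 k : L2Circle)
    (mulOp (fourier m) (⟪(fourierLp 2 n : L2Circle), x⟫_ℂ • (fourierLp 2 n : L2Circle))))
    (k - m) fun n hn => by
      rw [map_smul, map_smul, innerSL_apply_apply, inner_mulOp, fourierCoeff_fourier,
        Pi.single_apply, if_neg (by omega), smul_zero]
  refine (h.unique h1).trans ?_
  rw [map_smul, map_smul, innerSL_apply_apply, inner_mulOp, fourierCoeff_fourier,
        Pi.single_apply, if_pos (by omega), smul_eq_mul, mul_one]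

theorem hardySpace_ext {x y : hardySpace}
    (h : ∀ n : ℤ, 0 ≤ n → ⟪(fourierLp 2 n : L2Circle), (x : L2Circle)⟫_ℂ
      = ⟪(fourierLp 2 n : L2Circle), (y : L2Circle)⟫_ℂ) : x = y := by
  have h1 : (x : L2Circle) - y ∈ hardySpaceᗮ := mem_hardySpace_orthogonal_iff.2 fun n hn => by
    rw [inner_sub_right, h n hn, sub_self]
  have h2 := Submodule.inner_right_of_mem_orthogonal (hardySpace.sub_mem x.2 y.2) h1
  exact Subtype.ext (sub_eq_zero.1 (inner_self_eq_zero.1 h2))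

theorem inner_compress (a : L2Circle →L[ℂ] L2Circle) {x : L2Circle} (hx : x ∈ hardySpace)
    (y : hardySpace) : ⟪x, (compress hardySpace a y : L2Circle)⟫_ℂ = ⟪x, a y⟫_ℂ := by
  rw [coe_compress]
  exact Submodule.inner_orthogonalProjectionOnto_eq_of_mem_left (⟨x, hx⟩ : hardySpace) _

/-- The constant function `1` as an element of the Hardy space. -/
def vacuum : hardySpace := ⟨fourierLp 2 0, fourierLp_mem_hardySpace le_rfl⟩

theorem inner_vacuum_self : ⟪vacuum, vacuum⟫_ℂ = 1 := by
  have h := (orthonormal_fourier (T := 2 * π)).1 0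
  have h1 : ⟪(fourierLp 2 0 : L2Circle), (fourierLp 2 0 : L2Circle)⟫_ℂ = 1 := by
    rw [inner_self_eq_norm_sq_to_K, h]
    simp
  exact h1

theorem inner_vacuum_compress (φ : C(AddCircle (2 * π), ℂ)) :
    ⟪vacuum, compress hardySpace (mulOp φ) vacuum⟫_ℂ = fourierCoeff φ 0 := by
  have h := inner_mulOp φ 0 0
  rw [sub_zero] at h
  rw [← h]
  exact inner_compress _ (fourierLp_mem_hardySpace le_rfl) _

theorem inner_vacuum (y : hardySpace) :
    ⟪vacuum, y⟫_ℂ = ⟪(fourierLp 2 0 : L2Circle), (y : L2Circle)⟫_ℂ := rfl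

/-- The unilateral shift fails to be invertible by the projection onto the constants. -/
theorem compress_shift_defect (y : hardySpace) :
    compress hardySpace (mulOp (fourier 1)) (compress hardySpace (mulOp (fourier (-1))) y)
      = y - ⟪vacuum, y⟫_ℂ • vacuum := by
  refine hardySpace_ext fun n hn => ?_
  rw [inner_compress _ (fourierLp_mem_hardySpace hn), inner_mulOp_fourier]
  have hv : ⟪(fourierLp 2 n : L2Circle), ((y - ⟪vacuum, y⟫_ℂ • vacuum : hardySpace) : L2Circle)⟫_ℂ
      = ⟪(fourierLp 2 n : L2Circle), (y : L2Circle)⟫_ℂ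
        - ⟪(fourierLp 2 0 : L2Circle), (y : L2Circle)⟫_ℂ
          * ⟪(fourierLp 2 n : L2Circle), (fourierLp 2 0 : L2Circle)⟫_ℂ := by
    change ⟪(fourierLp 2 n : L2Circle), (y : L2Circle)
      - ⟪vacuum, y⟫_ℂ • (fourierLp 2 0 : L2Circle)⟫_ℂ = _
    rw [inner_sub_right, inner_smul_right, inner_vacuum]
  rw [hv]
  rcases hn.eq_or_lt with rfl | hn'
  · have h1 : ⟪(fourierLp 2 0 : L2Circle), (fourierLp 2 0 : L2Circle)⟫_ℂ = 1 := inner_vacuum_self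
    rw [h1, mul_one, sub_self]
    exact Submodule.inner_left_of_mem_orthogonal (Subtype.prop _)
      (fourierLp_mem_orthogonal (by norm_num))
  · have h1 : ⟪(fourierLp 2 n : L2Circle), (fourierLp 2 0 : L2Circle)⟫_ℂ = 0 :=
      (orthonormal_fourier (T := 2 * π)).2 (by omega)
    rw [h1, mul_zero, sub_zero, inner_compress _ (fourierLp_mem_hardySpace (by omega)),
      inner_mulOp_fourier, sub_neg_eq_add, sub_add_cancel]

theorem compress_fourier_neg_one_vacuum :
    compress hardySpace (mulOp (fourier (-1))) vacuum = 0 := by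
  refine hardySpace_ext fun n hn => ?_
  rw [inner_compress _ (fourierLp_mem_hardySpace hn), inner_mulOp_fourier, Submodule.coe_zero,
    inner_zero_right]
  exact (orthonormal_fourier (T := 2 * π)).2 (by omega)

theorem inner_mulOp_fourier_left (x y : L2Circle) (m : ℤ) :
    ⟪mulOp (fourier m) x, y⟫_ℂ = ⟪x, mulOp (fourier (-m)) y⟫_ℂ := by
  have h := ((fourierBasis (T := 2 * π)).hasSum_inner_mul_inner (mulOp (fourier m) x) y)
  have h' := ((fourierBasis (T := 2 * π)).hasSum_inner_mul_inner x (mulOp (fourier (-m)) y))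
  simp only [coe_fourierBasis] at h h'
  rw [← (Equiv.addRight m).hasSum_iff] at h
  refine h.unique (h'.congr_fun ?_)
  intro k
  simp only [Function.comp, Equiv.coe_addRight]
  rw [inner_mulOp_fourier, ← inner_conj_symm, inner_mulOp_fourier, add_sub_cancel_right,
    inner_conj_symm, sub_neg_eq_add]

theorem inner_compress_fourier (x y : hardySpace) :
    ⟪compress hardySpace (mulOp (fourier 1)) x, y⟫_ℂ
      = ⟪x, compress hardySpace (mulOp (fourier (-1))) y⟫_ℂ := by
  have h := inner_mulOp_fourier_left (x : L2Circle) y 1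
  have h1 := inner_compress (mulOp (fourier 1)) y.2 x
  have h2 := inner_compress (mulOp (fourier (-1))) x.2 y
  change ⟪((compress hardySpace (mulOp (fourier 1)) x : hardySpace) : L2Circle), (y : L2Circle)⟫_ℂ
    = ⟪(x : L2Circle), ((compress hardySpace (mulOp (fourier (-1))) y : hardySpace) : L2Circle)⟫_ℂ
  rw [h2, ← h, ← inner_conj_symm, h1, inner_conj_symm]

end Shift

/-! ### Commutators with the lifts of monomials -/

section MonomialDet

open MeasureTheory Real AddCircle

/-- The Toeplitz lift of a triangular exponential. -/
def expUnit (f : symbolAlgebra) (hf : IsTriangular f) : (extendedModule hardySpace)ˣ :=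
  isToeplitzLift_toeplitzLift.expLift f hf

/-- The lift of `diag(z, z⁻¹, 1)`. -/
def lift12 : StableGL (extendedModule hardySpace) :=
  Units.map stabilize (shift12 isToeplitzLift_toeplitzLift.map_monomial_mul)

/-- The lift of `diag(z, 1, z⁻¹)`. -/
def lift13 : StableGL (extendedModule hardySpace) :=
  Units.map stabilize (shift13 isToeplitzLift_toeplitzLift.map_monomial_mul)

/-- The lift of `diag(e^f, e^{-f}, 1)`. -/
def expLift12 (f : symbolAlgebra) (hf : IsTriangular f) : StableGL (extendedModule hardySpace) :=
  Units.map stabilize (diag12 (expUnit f hf))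

/-- The lift of `diag(e^f, 1, e^{-f})`. -/
def expLift13 (f : symbolAlgebra) (hf : IsTriangular f) : StableGL (extendedModule hardySpace) :=
  Units.map stabilize (diag13 (expUnit f hf))

theorem p₁_monomial_mul :
    p₁ hardySpace (toeplitzLift (monomial 1)) * p₁ hardySpace (toeplitzLift (monomial (-1)))
      = 1 := by
  rw [p₁_toeplitzLift, p₁_toeplitzLift, ← map_mul, ← monomial_add, add_neg_cancel, monomial_zero,
    map_one]

theorem exists_hasCommutatorDet_expLift12_lift13 {f : symbolAlgebra} (hf : IsTriangular f) :
    ∃ c : ℂˣ, (c : ℂ) = fourierCoeff (expSymbol f : C(AddCircle (2 * π), ℂ)) 0 ∧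
      HasCommutatorDet (detGraph hardySpace) (expLift12 f hf) lift13 c := by
  rw [← inner_vacuum_compress]
  exact exists_hasCommutatorDet_diag12_shift13 isToeplitzLift_toeplitzLift.map_monomial_mul
    p₁_monomial_mul inner_vacuum_self compress_shift_defect (expUnit f hf)
    (hf.imp (isToeplitzLift_toeplitzLift.expLift_mul_monomial hf)
      (isToeplitzLift_toeplitzLift.expLift_mul_monomial_neg hf))

theorem exists_hasCommutatorDet_expLift13_lift12 {f : symbolAlgebra} (hf : IsTriangular f) :
    ∃ c : ℂˣ, (c : ℂ) = fourierCoeff (expSymbol f : C(AddCircle (2 * π), ℂ)) 0 ∧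
      HasCommutatorDet (detGraph hardySpace) (expLift13 f hf) lift12 c := by
  rw [← inner_vacuum_compress]
  exact exists_hasCommutatorDet_diag13_shift12 isToeplitzLift_toeplitzLift.map_monomial_mul
    p₁_monomial_mul inner_vacuum_self compress_shift_defect (expUnit f hf)
    (hf.imp (isToeplitzLift_toeplitzLift.expLift_mul_monomial hf)
      (isToeplitzLift_toeplitzLift.expLift_mul_monomial_neg hf))

/-- This sign accounts for the term `iπ m n` in the exponent, where `m` and `n` are winding numbers. -/
theorem hasCommutatorDet_lift12_lift13 :
    HasCommutatorDet (detGraph hardySpace) lift12 lift13 (-1) :=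
  hasCommutatorDet_shift12_shift13 isToeplitzLift_toeplitzLift.map_monomial_mul
    p₁_monomial_mul inner_vacuum_self compress_shift_defect compress_fourier_neg_one_vacuum
    inner_compress_fourier

end MonomialDet

/-! ### The exponential at the origin -/

section ExponentialLimit

/-- The derivative of `exp` at the origin in the direction `x`, along the steps `1 / (n + 1)`. -/
theorem tendsto_smul_exp_sub_one {A : Type*} [NormedRing A] [NormedAlgebra ℂ A] [CompleteSpace A]
    (x : A) : Tendsto (fun n : ℕ => ((n : ℂ) + 1) • (NormedSpace.exp (((n : ℂ) + 1)⁻¹ • x) - 1))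
      atTop (𝓝 x) := by
  have h := (hasDerivAt_exp_smul_const (𝕂 := ℂ) x 0).tendsto_slope_zero
  simp only [zero_smul, NormedSpace.exp_zero, one_mul, zero_add] at h
  have h1 : Tendsto (fun n : ℕ => ((n : ℂ) + 1)⁻¹) atTop (𝓝[≠] 0) := by
    refine tendsto_nhdsWithin_iff.2 ⟨?_, Eventually.of_forall fun n => ?_⟩
    · have h2 : Tendsto (fun n : ℕ => (n : ℂ)⁻¹) atTop (𝓝 0) := tendsto_inv_atTop_nhds_zero_nat
      have h3 := h2.comp (tendsto_add_atTop_nat 1)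
      refine h3.congr fun n => ?_
      simp
    · exact inv_ne_zero (Nat.cast_add_one_ne_zero n)
  refine (h.comp h1).congr fun n => ?_
  simp

end ExponentialLimit

/-! ### Fourier coefficients as continuous functionals -/

section Coefficient

open MeasureTheory Real AddCircle

/-- `φ ↦ M(φ)` as a continuous linear map. -/
def mulOpL : C(AddCircle (2 * π), ℂ) →L[ℂ] (L2Circle →L[ℂ] L2Circle) :=
  ((ContinuousLinearMap.mul ℂ ℂ).holderL haarAddCircle ⊤ 2 2).comp
    (ContinuousMap.toLp ⊤ haarAddCircle ℂ)

/-- The Fourier coefficient as a continuous linear functional on continuous functions. -/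
def coefficient (n : ℤ) : C(AddCircle (2 * π), ℂ) →L[ℂ] ℂ :=
  (innerSL ℂ (fourierLp 2 n : L2Circle)).comp
    ((ContinuousLinearMap.apply ℂ L2Circle (fourierLp 2 0 : L2Circle)).comp mulOpL)

theorem coefficient_apply (n : ℤ) (φ : C(AddCircle (2 * π), ℂ)) :
    coefficient n φ = fourierCoeff φ n := by
  have h := inner_mulOp φ n 0
  rw [sub_zero] at h
  exact h

theorem coefficient_one : coefficient 0 1 = 1 := by
  have h := fourierCoeff_fourier (T := 2 * π) 0
  rw [coefficient_apply]
  have h1 : (1 : C(AddCircle (2 * π), ℂ)) = fourier 0 := ContinuousMap.ext fun _ => fourier_zero.symm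
  rw [h1, h, Pi.single_eq_same]

end Coefficient

/-! ### Commutators of exponentials and monomials -/

section MeanDet

namespace IsToeplitzLift

variable {R : Type*} [Ring R] {T : symbolAlgebra → R} (hT : IsToeplitzLift T)

include hT

theorem stabilize_diag12_expLift_pow {f g : symbolAlgebra} (hf : IsTriangular f)
    (hg : IsTriangular g) (n : ℕ) (h : (n : ℂ) • g = f) :
    Units.map stabilize (diag12 (hT.expLift f hf))
      = Units.map stabilize (diag12 (hT.expLift g hg)) ^ n := by
  subst h
  rw [← map_pow, ← diag12_pow, ← hT.expLift_pow hg n]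

theorem stabilize_diag13_expLift_pow {f g : symbolAlgebra} (hf : IsTriangular f)
    (hg : IsTriangular g) (n : ℕ) (h : (n : ℂ) • g = f) :
    Units.map stabilize (diag13 (hT.expLift f hf))
      = Units.map stabilize (diag13 (hT.expLift g hg)) ^ n := by
  subst h
  rw [← map_pow, ← diag13_pow, ← hT.expLift_pow hg n]

end IsToeplitzLift

open MeasureTheory Real AddCircle

/-- The exponential as a unit. -/
def cexpUnit (z : ℂ) : ℂˣ := Units.mk0 (Complex.exp z) (Complex.exp_ne_zero z)

theorem cexpUnit_val (z : ℂ) : (cexpUnit z : ℂ) = Complex.exp z := rfl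

theorem expLift12_pow {f g : symbolAlgebra} (hf : IsTriangular f) (hg : IsTriangular g) (n : ℕ)
    (h : (n : ℂ) • g = f) : expLift12 f hf = expLift12 g hg ^ n :=
  isToeplitzLift_toeplitzLift.stabilize_diag12_expLift_pow hf hg n h

theorem expLift13_pow {f g : symbolAlgebra} (hf : IsTriangular f) (hg : IsTriangular g) (n : ℕ)
    (h : (n : ℂ) • g = f) : expLift13 f hf = expLift13 g hg ^ n :=
  isToeplitzLift_toeplitzLift.stabilize_diag13_expLift_pow hf hg n h

/-- The scaling `f / (n + 1)`. -/
def divNat (f : symbolAlgebra) (n : ℕ) : symbolAlgebra := ((n : ℂ) + 1)⁻¹ • f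

theorem natCast_smul_divNat (f : symbolAlgebra) (n : ℕ) : ((n + 1 : ℕ) : ℂ) • divNat f n = f := by
  rw [divNat, smul_smul, Nat.cast_add, Nat.cast_one,
    mul_inv_cancel₀ (Nat.cast_add_one_ne_zero n), one_smul]

/-- If the determinants of the commutators with `e^{f / n}` are given by the mean of `e^{f / n}`,
multiplicativity forces the determinant for `e^f` to be the exponential of the mean of `f`. -/
theorem eq_cexpUnit_mean (f : symbolAlgebra) {c : ℕ → ℂˣ} {d : ℂˣ}
    (hc : ∀ n, (c n : ℂ) = fourierCoeff (expSymbol (divNat f n) : C(AddCircle (2 * π), ℂ)) 0)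
    (hd : ∀ n, d = c n ^ (n + 1)) :
    d = cexpUnit (fourierCoeff (f : C(AddCircle (2 * π), ℂ)) 0) := by
  have h1 := ((coefficient 0).continuous.tendsto _).comp
    (tendsto_smul_exp_sub_one (f : C(AddCircle (2 * π), ℂ)))
  rw [coefficient_apply] at h1
  have h2 : ∀ n : ℕ, ((coefficient 0) ∘ fun n : ℕ => ((n : ℂ) + 1) •
      (NormedSpace.exp (((n : ℂ) + 1)⁻¹ • (f : C(AddCircle (2 * π), ℂ))) - 1)) n
        = ((n + 1 : ℕ) : ℂ) * ((c n : ℂ) - 1) := fun n => by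
    simp only [Function.comp_apply]
    rw [map_smul, map_sub, coefficient_one, coefficient_apply, hc, smul_eq_mul, Nat.cast_add,
      Nat.cast_one]
    rfl
  have h3 := tendsto_pow_exp (tendsto_add_atTop_nat 1) (h1.congr h2)
  have h4 : ∀ n, (c n : ℂ) ^ (n + 1) = d := fun n => by
    rw [← Units.val_pow_eq_pow_val, ← hd]
  simp only [h4] at h3
  exact Units.ext (tendsto_nhds_unique tendsto_const_nhds h3)

/-- The corner gives the mean of `e^f`; scaling `f`, this improves to the exponential of the mean. -/
theorem hasCommutatorDet_expLift12_lift13 {f : symbolAlgebra} (hf : IsTriangular f) :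
    HasCommutatorDet (detGraph hardySpace) (expLift12 f hf) lift13
      (cexpUnit (fourierCoeff (f : C(AddCircle (2 * π), ℂ)) 0)) := by
  obtain ⟨d, -, hd⟩ := exists_hasCommutatorDet_expLift12_lift13 hf
  have hn : ∀ n, IsTriangular (divNat f n) := fun n => hf.smul _
  choose c hc hcd using fun n => exists_hasCommutatorDet_expLift12_lift13 (hn n)
  have h1 : ∀ n, d = c n ^ (n + 1) := fun n => by
    have h2 := (hcd n).pow_left (isDeterminantGraph_detGraph hardySpace) (n + 1)
    rw [← expLift12_pow hf (hn n) (n + 1) (natCast_smul_divNat f n)] at h2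
    exact hd.unique (isDeterminantGraph_detGraph hardySpace) h2
  rw [← eq_cexpUnit_mean f hc h1]
  exact hd

theorem hasCommutatorDet_expLift13_lift12 {f : symbolAlgebra} (hf : IsTriangular f) :
    HasCommutatorDet (detGraph hardySpace) (expLift13 f hf) lift12
      (cexpUnit (fourierCoeff (f : C(AddCircle (2 * π), ℂ)) 0)) := by
  obtain ⟨d, -, hd⟩ := exists_hasCommutatorDet_expLift13_lift12 hf
  have hn : ∀ n, IsTriangular (divNat f n) := fun n => hf.smul _
  choose c hc hcd using fun n => exists_hasCommutatorDet_expLift13_lift12 (hn n)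
  have h1 : ∀ n, d = c n ^ (n + 1) := fun n => by
    have h2 := (hcd n).pow_left (isDeterminantGraph_detGraph hardySpace) (n + 1)
    rw [← expLift13_pow hf (hn n) (n + 1) (natCast_smul_divNat f n)] at h2
    exact hd.unique (isDeterminantGraph_detGraph hardySpace) h2
  rw [← eq_cexpUnit_mean f hc h1]
  exact hd

end MeanDet

/-! ### Commutators close to the identity -/

section ToeplitzCommutator

variable {H : Type u} [NormedAddCommGroup H] [InnerProductSpace ℂ H] [CompleteSpace H]
  (V : Submodule ℂ H) [CompleteSpace V]

/-- The part of `T` mapping `Vᗮ` to `V`. -/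
def corner (T : H →L[ℂ] H) : H →L[ℂ] V := V.orthogonalProjectionOnto ∘L T ∘L Vᗮ.starProjection

theorem tendsto_clm_apply {E F : Type*} [NormedAddCommGroup E] [NormedSpace ℂ E]
    [NormedAddCommGroup F] [NormedSpace ℂ F] {T : ℕ → E →L[ℂ] F} {T₀ : E →L[ℂ] F} {x : ℕ → E}
    {x₀ : E} (hT : Tendsto T atTop (𝓝 T₀)) (hx : Tendsto x atTop (𝓝 x₀)) :
    Tendsto (fun n => T n (x n)) atTop (𝓝 (T₀ x₀)) :=
  (isBoundedBilinearMap_apply.continuous.tendsto (T₀, x₀)).comp (hT.prodMk_nhds hx)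

theorem corner_apply (T : H →L[ℂ] H) (x : H) :
    corner V T x = V.orthogonalProjectionOnto (T (Vᗮ.starProjection x)) := rfl

theorem continuous_corner : Continuous (corner V) := by
  unfold corner
  fun_prop

theorem compress_mul_eq (U W : H →L[ℂ] H) (y : V) :
    compress V (U * W) y = compress V U (compress V W y)
      + V.orthogonalProjectionOnto (U (Vᗮ.starProjection (W y))) := by
  simp only [coe_compress]
  rw [← map_add]
  congr 1
  change U (W y) = _
  rw [← Submodule.starProjection_apply, ← map_add, Submodule.starProjection_orthogonal', sub_apply]
  simp

/-- The functional of the rank one operators in `isNuclearDet_toeplitzCommutator`. -/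
theorem inner_corner_adjoint {B : V →L[ℂ] V} (Y : H →L[ℂ] H) (x : H) (z : V) :
    ⟪B.adjoint (corner V Y.adjoint x), z⟫_ℂ = ⟪x, Vᗮ.starProjection (Y (B z))⟫_ℂ := by
  rw [ContinuousLinearMap.adjoint_inner_left, corner_apply,
    Submodule.inner_orthogonalProjectionOnto_eq_of_mem_right,
    ContinuousLinearMap.adjoint_inner_left, Submodule.inner_starProjection_left_eq_right]

variable {V}

/-- The multiplicative commutator of two Toeplitz operators as a perturbation of the identity by
an operator factoring through `Vᗮ`. The perturbation is quadratic in `ε`: the compressions of `U` and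
`W` fail to be multiplicative only through the corner of `U` and the opposite corner of `W`. -/
theorem isNuclearDet_toeplitzCommutator {ι : Type u} (b : HilbertBasis ι ℂ H)
    {U W X Y : H →L[ℂ] H} {B : V →L[ℂ] V} {ε : ℂ} (hU : U = 1 + ε • X) (hW : W = 1 + ε • Y)
    (hUW : U * W = W * U) (hWU : compress V (W * U) * B = 1)
    (hsum : Summable fun k => ‖B.adjoint (corner V Y.adjoint (b k))‖ * ‖-corner V X (b k)‖) :
    IsNuclearDet (compress V U * compress V W * B) (minorSum fun j k =>
      ε ^ 2 * ⟪B.adjoint (corner V Y.adjoint (b j)), -corner V X (b k)⟫_ℂ) := by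
  -- the operator `-ε² (corner X) Y B` from `V` through `Vᗮ` to `V`, expanded in the basis `b` of `H`
  refine ⟨ι, fun k => B.adjoint (corner V Y.adjoint (b k)), fun k => ε ^ 2 • -corner V X (b k),
    ?_, fun z => ?_, ?_⟩
  · refine (hsum.mul_left (‖ε ^ 2‖)).congr fun k => ?_
    rw [norm_smul]
    ring
  · have h1 := (((b.hasSum_repr (Vᗮ.starProjection (Y (B z)))).mapL (corner V X)).const_smul
      (ε ^ 2)).neg
    have h2 : -(ε ^ 2 • corner V X (Vᗮ.starProjection (Y (B z))))
        = (compress V U * compress V W * B) z - z := by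
      have h3 : compress V (W * U) (B z) = z := DFunLike.congr_fun hWU z
      rw [← hUW, compress_mul_eq] at h3
      have h4 : Vᗮ.starProjection (W (B z)) = ε • Vᗮ.starProjection (Y (B z)) := by
        rw [hW, add_apply, map_add, smul_apply, map_smul]
        have : Vᗮ.starProjection ((1 : H →L[ℂ] H) (B z)) = 0 := by
          change Vᗮ.starProjection (B z : H) = 0
          rw [Submodule.starProjection_apply_eq_zero_iff, Submodule.orthogonal_orthogonal]
          exact (B z).2
        rw [this, zero_add]
      have h5 : V.orthogonalProjectionOnto (U (Vᗮ.starProjection (W (B z))))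
          = ε ^ 2 • corner V X (Vᗮ.starProjection (Y (B z))) := by
        rw [h4, map_smul, map_smul, hU, add_apply, map_add, smul_apply, map_smul]
        have h6 : V.orthogonalProjectionOnto ((1 : H →L[ℂ] H) (Vᗮ.starProjection (Y (B z)))) = 0 :=
          Submodule.orthogonalProjectionOnto_apply_of_mem_orthogonal
            (Submodule.starProjection_apply_mem _ _)
        have h7 : Vᗮ.starProjection (Vᗮ.starProjection (Y (B z))) = Vᗮ.starProjection (Y (B z)) :=
          DFunLike.congr_fun Vᗮ.isIdempotentElem_starProjection (Y (B z))
        rw [h6, zero_add, smul_smul, ← pow_two, corner_apply, h7]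
      rw [h5] at h3
      change _ = compress V U (compress V W (B z)) - z
      rw [eq_sub_iff_add_eq, neg_add_eq_iff_eq_add]
      exact h3.symm.trans (add_comm _ _)
    rw [← h2]
    refine h1.congr_fun fun k => ?_
    rw [map_smul, b.repr_apply_apply, inner_corner_adjoint]
    module
  · congr 1
    ext j k
    rw [inner_smul_right]

/-- For multiplicative commutators of Toeplitz operators at distance `ε` from the identity, the
determinant is `1 + ε² t + o(ε²)`, where `-t` is the trace of the corner of `X₀` times the opposite
corner of `Y₀`. -/
theorem tendsto_det_toeplitzCommutator {ι : Type u} (b : HilbertBasis ι ℂ H)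
    {X Y : ℕ → H →L[ℂ] H} {B : ℕ → V →L[ℂ] V} {X₀ Y₀ : H →L[ℂ] H}
    (hX : Tendsto X atTop (𝓝 X₀)) (hY : Tendsto Y atTop (𝓝 Y₀)) (hB : Tendsto B atTop (𝓝 1))
    {c : ι → ℝ} (hc : Summable c) (hXc : ∀ n k, ‖corner V (X n) (b k)‖ ^ 2 ≤ c k)
    (hYc : ∀ n k, ‖corner V (Y n).adjoint (b k)‖ ^ 2 ≤ c k)
    {ε : ℕ → ℂ} (hε : Tendsto ε atTop (𝓝 0)) (hε0 : ∀ n, ε n ≠ 0) (hε1 : ∀ n, ‖ε n‖ ≤ 1) {d : ℕ → ℂ}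
    (hd : ∀ n, (Summable fun k => ‖(B n).adjoint (corner V (Y n).adjoint (b k))‖
        * ‖-corner V (X n) (b k)‖) →
      d n = minorSum fun j k => ε n ^ 2 *
        ⟪(B n).adjoint (corner V (Y n).adjoint (b j)), -corner V (X n) (b k)⟫_ℂ) :
    Tendsto (fun n => (ε n ^ 2)⁻¹ * (d n - 1)) atTop
      (𝓝 (∑' k, ⟪corner V Y₀.adjoint (b k), -corner V X₀ (b k)⟫_ℂ)) := by
  obtain ⟨M, hM⟩ := (Metric.isBounded_range_of_tendsto B hB).exists_norm_le
  have hM' : ∀ n, ‖B n‖ ≤ M := fun n => hM _ ⟨n, rfl⟩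
  have hM0 : 0 ≤ M := (norm_nonneg (B 0)).trans (hM' 0)
  have hc0 : ∀ k, 0 ≤ c k := fun k => (sq_nonneg _).trans (hXc 0 k)
  have hle : ∀ n k, ‖(B n).adjoint (corner V (Y n).adjoint (b k))‖ * ‖-corner V (X n) (b k)‖
      ≤ M * c k := fun n k => by
    have h1 : ‖(B n).adjoint (corner V (Y n).adjoint (b k))‖
        ≤ M * ‖corner V (Y n).adjoint (b k)‖ := by
      refine ((B n).adjoint.le_opNorm _).trans ?_
      rw [LinearIsometryEquiv.norm_map]
      gcongr
      exact hM' n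
    rw [norm_neg]
    calc _ ≤ M * ‖corner V (Y n).adjoint (b k)‖ * ‖corner V (X n) (b k)‖ := by gcongr
      _ = M * (‖corner V (Y n).adjoint (b k)‖ * ‖corner V (X n) (b k)‖) := by ring
      _ ≤ M * c k := by
        gcongr
        nlinarith [hXc n k, hYc n k,
          sq_nonneg (‖corner V (Y n).adjoint (b k)‖ - ‖corner V (X n) (b k)‖)]
  have hsum : ∀ n, Summable fun k => ‖(B n).adjoint (corner V (Y n).adjoint (b k))‖
        * ‖-corner V (X n) (b k)‖ := fun n =>
    Summable.of_nonneg_of_le (fun k => by positivity) (hle n) (hc.mul_left M)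
  simp only [fun n => hd n (hsum n)]
  have key := tendsto_minorSum_smul (l := atTop) (hc.mul_left M)
    (fun k => mul_nonneg hM0 (hc0 k))
    (G := fun n j k => ⟪(B n).adjoint (corner V (Y n).adjoint (b j)), -corner V (X n) (b k)⟫_ℂ)
    (G' := fun j k => ⟪corner V Y₀.adjoint (b j), -corner V X₀ (b k)⟫_ℂ)
    (ε := fun n => ε n ^ 2) (fun j k => ?_) (fun n s => ?_) (by simpa using hε.pow 2)
    (fun n => pow_ne_zero 2 (hε0 n))
    (fun n => by rw [norm_pow]; exact pow_le_one₀ (norm_nonneg _) (hε1 n))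
  · exact key
  · have hB' : Tendsto (fun n => (B n).adjoint) atTop (𝓝 1) := by
      have h := (ContinuousLinearMap.adjoint (𝕜 := ℂ) (E := V) (F := V)).continuous.tendsto 1
      have h1 : ContinuousLinearMap.adjoint (1 : V →L[ℂ] V) = 1 := ContinuousLinearMap.adjoint_id
      rw [h1] at h
      exact h.comp hB
    have hY' : Tendsto (fun n => (Y n).adjoint) atTop (𝓝 Y₀.adjoint) :=
      ((ContinuousLinearMap.adjoint (𝕜 := ℂ) (E := H) (F := H)).continuous.tendsto _).comp hY
    have h1 : Tendsto (fun n => corner V (Y n).adjoint (b j)) atTop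
        (𝓝 (corner V Y₀.adjoint (b j))) :=
      tendsto_clm_apply (((continuous_corner V).tendsto _).comp hY') tendsto_const_nhds
    have h2 : Tendsto (fun n => corner V (X n) (b k)) atTop (𝓝 (corner V X₀ (b k))) :=
      tendsto_clm_apply (((continuous_corner V).tendsto _).comp hX) tendsto_const_nhds
    exact (tendsto_clm_apply hB' h1).inner h2.neg
  · refine (principalMinor_inner_le _ _ s).trans ?_
    exact Finset.prod_le_prod (fun k _ => by positivity) fun k _ => hle n k

end ToeplitzCommutator

/-! ### Decay of Fourier coefficients -/

section Decay

open MeasureTheory Real AddCircle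

theorem fourierCoeff_eq_integral_exp (φ : AddCircle (2 * π) → ℂ) (n : ℤ) :
    fourierCoeff φ n
      = ((2 * π)⁻¹ : ℝ) • ∫ x in (0 : ℝ)..2 * π, Complex.exp (-(n * Complex.I * x)) * φ x := by
  rw [fourierCoeff_eq_intervalIntegral _ _ 0, zero_add, one_div]
  congr 1
  apply intervalIntegral.integral_congr
  intro x _
  simp only [smul_eq_mul, fourier_coe_apply]
  congr 2
  have : (π : ℂ) ≠ 0 := by exact_mod_cast Real.pi_ne_zero
  push_cast
  field_simp

theorem norm_exp_neg_int_mul_I (n : ℤ) (x : ℝ) :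
    ‖Complex.exp (-(n * Complex.I * x))‖ = 1 := by
  have : -(n * Complex.I * x) = ((-(n * x) : ℝ) : ℂ) * Complex.I := by push_cast; ring
  rw [this, Complex.norm_exp_ofReal_mul_I]

/-- A bound for the second derivative bounds the Fourier coefficients. -/
theorem sq_mul_norm_fourierCoeff_le {φ : C(AddCircle (2 * π), ℂ)} {f' f'' : ℝ → ℂ}
    (hf : ∀ x : ℝ, HasDerivAt (fun x : ℝ => φ x) (f' x) x) (hf' : ∀ x, HasDerivAt f' (f'' x) x)
    (hc : Continuous f'') {C : ℝ} (hC : ∀ x ∈ Set.Icc 0 (2 * π), ‖f'' x‖ ≤ C) (n : ℤ) :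
    (n : ℝ) ^ 2 * ‖fourierCoeff φ n‖ ≤ C := by
  have hper : ∀ x : ℝ, φ ((x + 2 * π : ℝ) : AddCircle (2 * π)) = φ (x : AddCircle (2 * π)) :=
    fun x => by rw [AddCircle.coe_add_period]
  have hper0 : φ ((2 * π : ℝ) : AddCircle (2 * π)) = φ ((0 : ℝ) : AddCircle (2 * π)) := by
    have := hper 0
    rwa [zero_add] at this
  have hper1 : f' (2 * π) = f' 0 := by
    have h1 : HasDerivAt (fun x : ℝ => φ ((x + 2 * π : ℝ) : AddCircle (2 * π))) (f' (2 * π)) 0 := by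
      have h2 := hf (0 + 2 * π)
      rw [zero_add] at h2
      exact HasDerivAt.comp_add_const 0 (2 * π) (by rw [zero_add]; exact h2)
    simp only [hper] at h1
    exact h1.unique (hf 0)
  have hcont : Continuous f' := continuous_iff_continuousAt.2 fun x => (hf' x).continuousAt
  have h1 := integral_fourier_deriv hf hcont hper0 n
  have h2 := integral_fourier_deriv hf' hc hper1 n
  rw [h1] at h2
  have hnorm : ‖∫ x in (0 : ℝ)..2 * π, Complex.exp (-(n * Complex.I * x)) * f'' x‖
      ≤ C * |2 * π - 0| := by
    refine intervalIntegral.norm_integral_le_of_norm_le_const fun x hx => ?_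
    rw [norm_mul, norm_exp_neg_int_mul_I, one_mul]
    rw [Set.uIoc_of_le Real.two_pi_pos.le] at hx
    exact hC x ⟨hx.1.le, hx.2⟩
  rw [h2, norm_mul, norm_mul, Complex.norm_I, mul_one, Complex.norm_intCast,
    norm_mul, norm_mul, Complex.norm_I, mul_one, Complex.norm_intCast, sub_zero,
    abs_of_pos Real.two_pi_pos] at hnorm
  rw [fourierCoeff_eq_integral_exp, norm_smul, Real.norm_of_nonneg (by positivity), ← sq_abs]
  have h3 : (0 : ℝ) < 2 * π := Real.two_pi_pos
  have h4 := mul_le_mul_of_nonneg_left hnorm (inv_nonneg.2 h3.le)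
  rw [mul_comm C, inv_mul_cancel_left₀ h3.ne'] at h4
  refine le_trans (le_of_eq ?_) h4
  ring

/-- The Fourier coefficients of `(n + 1) (e^{f / (n + 1)} - 1)` decay quadratically, uniformly
in `n`. -/
theorem exists_decay_bound (f : symbolAlgebra) : ∃ C : ℝ, ∀ (n : ℕ) (m : ℤ),
    (m : ℝ) ^ 2 * ‖fourierCoeff (((n : ℂ) + 1) • ((expSymbol (divNat f n) :
      C(AddCircle (2 * π), ℂ)) - 1) : C(AddCircle (2 * π), ℂ)) m‖ ≤ C := by
  set F : ℝ → ℂ := fun x => (f : C(AddCircle (2 * π), ℂ)) x with hF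
  have hF2 : ContDiff ℝ 2 F := f.2
  have hF1 : ContDiff ℝ 1 (deriv F) := ((contDiff_succ_iff_deriv (n := 1)).1 hF2).2.2
  have hd0 : ∀ x, HasDerivAt F (deriv F x) x := fun x =>
    (hF2.differentiable (by norm_num) x).hasDerivAt
  have hd1 : ∀ x, HasDerivAt (deriv F) (deriv (deriv F) x) x := fun x =>
    (hF1.differentiable (by norm_num) x).hasDerivAt
  have hc0 : Continuous F := hF2.continuous
  have hc1 : Continuous (deriv F) := hF1.continuous
  have hc2 : Continuous (deriv (deriv F)) := hF1.continuous_deriv le_rfl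
  obtain ⟨C, hC⟩ := (isCompact_Icc (a := (0 : ℝ)) (b := 2 * π)).exists_bound_of_continuousOn
    (f := fun x => ((‖deriv (deriv F) x‖ + ‖deriv F x‖ ^ 2) * Real.exp ‖F x‖ : ℝ))
    (by fun_prop)
  refine ⟨C, fun n m => ?_⟩
  set ε : ℂ := ((n : ℂ) + 1)⁻¹ with hε
  have hn0 : (n : ℂ) + 1 ≠ 0 := Nat.cast_add_one_ne_zero n
  have hε1 : ‖ε‖ ≤ 1 := by
    rw [hε, norm_inv, ← Nat.cast_add_one, Complex.norm_natCast]
    exact inv_le_one_of_one_le₀ (by exact_mod_cast Nat.succ_pos n)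
  have hval : ∀ x : ℝ, (((n : ℂ) + 1) • ((expSymbol (divNat f n) :
      C(AddCircle (2 * π), ℂ)) - 1) : C(AddCircle (2 * π), ℂ)) x
        = ((n : ℂ) + 1) * (Complex.exp (ε * F x) - 1) := fun x => by
    change ((n : ℂ) + 1) * (NormedSpace.exp (((n : ℂ) + 1)⁻¹ • (f : C(AddCircle (2 * π), ℂ))) x - 1)
      = _
    rw [exp_continuousMap_apply]
    rfl
  have hE : ∀ x, HasDerivAt (fun x => Complex.exp (ε * F x))
      (Complex.exp (ε * F x) * (ε * deriv F x)) x := fun x => ((hd0 x).const_mul ε).cexp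
  refine sq_mul_norm_fourierCoeff_le (f' := fun x => Complex.exp (ε * F x) * deriv F x)
    (f'' := fun x => Complex.exp (ε * F x) * (ε * deriv F x) * deriv F x
      + Complex.exp (ε * F x) * deriv (deriv F) x) (fun x => ?_) (fun x => (hE x).mul (hd1 x))
    (by fun_prop) (fun x hx => ?_) m
  · simp only [hval]
    refine (((hE x).sub_const 1).const_mul ((n : ℂ) + 1)).congr_deriv ?_
    rw [mul_left_comm, ← mul_assoc _ ε, hε, mul_inv_cancel₀ hn0, one_mul]
  · refine le_trans ?_ ((le_abs_self _).trans (hC x hx))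
    have h1 : ‖Complex.exp (ε * F x)‖ ≤ Real.exp ‖F x‖ := by
      rw [Complex.norm_exp]
      refine Real.exp_le_exp.2 ((Complex.re_le_norm _).trans ?_)
      rw [norm_mul]
      exact mul_le_of_le_one_left (norm_nonneg _) hε1
    calc _ ≤ ‖Complex.exp (ε * F x)‖ * (‖ε‖ * ‖deriv F x‖) * ‖deriv F x‖
          + ‖Complex.exp (ε * F x)‖ * ‖deriv (deriv F) x‖ := by
          refine (norm_add_le _ _).trans (le_of_eq ?_)
          simp only [norm_mul]
      _ ≤ Real.exp ‖F x‖ * (1 * ‖deriv F x‖) * ‖deriv F x‖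
          + Real.exp ‖F x‖ * ‖deriv (deriv F) x‖ := by gcongr
      _ = _ := by ring

end Decay

section CornerBound

open MeasureTheory Real AddCircle

theorem summable_one_div_one_add_sq : Summable fun n : ℤ => 1 / (1 + (n : ℝ) ^ 2) := by
  refine Summable.of_norm_bounded_eventually
    (g := fun n : ℤ => 1 / (n : ℝ) ^ 2) (Real.summable_one_div_int_pow.2 one_lt_two) ?_
  rw [Filter.eventually_cofinite]
  refine (Set.finite_singleton (0 : ℤ)).subset fun n hn => ?_
  by_contra h0
  apply hn
  have : (0 : ℝ) < (n : ℝ) ^ 2 := by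
    have : (n : ℝ) ≠ 0 := by exact_mod_cast h0
    positivity
  rw [Real.norm_of_nonneg (by positivity)]
  exact one_div_le_one_div_of_le this (by linarith)

theorem corner_fourierLp_of_nonneg (T : L2Circle →L[ℂ] L2Circle) {k : ℤ} (hk : 0 ≤ k) :
    corner hardySpace T (fourierLp 2 k) = 0 := by
  have h : hardySpaceᗮ.starProjection (fourierLp 2 k : L2Circle) = 0 := by
    rw [Submodule.starProjection_apply_eq_zero_iff]
    exact Submodule.le_orthogonal_orthogonal _ (fourierLp_mem_hardySpace hk)
  rw [corner_apply, h, map_zero, map_zero]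

theorem inner_corner_fourierLp (T : L2Circle →L[ℂ] L2Circle) {j k : ℤ} (hk : k < 0) :
    ⟪(fourierLp 2 j : L2Circle), (corner hardySpace T (fourierLp 2 k) : L2Circle)⟫_ℂ
      = if 0 ≤ j then ⟪(fourierLp 2 j : L2Circle), T (fourierLp 2 k)⟫_ℂ else 0 := by
  rw [corner_apply, Submodule.starProjection_eq_self_iff.2 (fourierLp_mem_orthogonal hk)]
  split_ifs with hj
  · exact Submodule.inner_orthogonalProjectionOnto_eq_of_mem_left
      (⟨_, fourierLp_mem_hardySpace hj⟩ : hardySpace) _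
  · exact Submodule.inner_left_of_mem_orthogonal (Subtype.prop _)
      (fourierLp_mem_orthogonal (not_le.1 hj))

/-- If the matrix entries of `T` decay quadratically away from the diagonal, its corner is a
Hilbert–Schmidt operator, with summable squared norms of the columns. -/
theorem norm_corner_sq_le {T : L2Circle →L[ℂ] L2Circle} {C : ℝ}
    (h : ∀ j k : ℤ, ((j - k : ℤ) : ℝ) ^ 2 *
      ‖⟪(fourierLp 2 j : L2Circle), T (fourierLp 2 k)⟫_ℂ‖ ≤ C)
    (k : ℤ) : ‖corner hardySpace T (fourierLp 2 k)‖ ^ 2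
      ≤ (4 * C ^ 2 * ∑' j : ℤ, 1 / (1 + (j : ℝ) ^ 2)) * (1 / (1 + (k : ℝ) ^ 2)) := by
  have hS : 0 ≤ ∑' j : ℤ, 1 / (1 + (j : ℝ) ^ 2) := tsum_nonneg fun j => by positivity
  rcases le_or_gt 0 k with hk | hk
  · rw [corner_fourierLp_of_nonneg T hk, norm_zero, zero_pow two_ne_zero]
    positivity
  have h1 := hasSum_norm_inner_sq (fourierBasis (T := 2 * π))
    (corner hardySpace T (fourierLp 2 k) : L2Circle)
  simp only [coe_fourierBasis, inner_corner_fourierLp T hk] at h1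
  rw [mul_assoc, mul_comm (∑' j : ℤ, 1 / (1 + (j : ℝ) ^ 2)), ← mul_assoc]
  refine hasSum_le (fun j => ?_) h1 (summable_one_div_one_add_sq.hasSum.mul_left _)
  split_ifs with hj
  -- `j` and `k` have opposite signs, so `|j - k|` dominates both `|j|` and `|k|`
  · have h2 : (1 : ℝ) + (j : ℝ) ^ 2 ≤ 2 * ((j - k : ℤ) : ℝ) ^ 2 := by
      exact_mod_cast (show (1 : ℤ) + j ^ 2 ≤ 2 * (j - k) ^ 2 by nlinarith)
    have h3 : (1 : ℝ) + (k : ℝ) ^ 2 ≤ 2 * ((j - k : ℤ) : ℝ) ^ 2 := by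
      exact_mod_cast (show (1 : ℤ) + k ^ 2 ≤ 2 * (j - k) ^ 2 by nlinarith)
    have h4 := h j k
    set y := ‖⟪(fourierLp 2 j : L2Circle), T (fourierLp 2 k)⟫_ℂ‖
    set q : ℝ := ((j - k : ℤ) : ℝ) ^ 2
    have hy : 0 ≤ y := norm_nonneg _
    have hq : 0 ≤ q := sq_nonneg _
    rw [mul_one_div, mul_one_div, div_div, le_div_iff₀ (by positivity)]
    have h5 : (1 + (k : ℝ) ^ 2) * (1 + (j : ℝ) ^ 2) ≤ (2 * q) * (2 * q) :=
      mul_le_mul h3 h2 (by positivity) (by positivity)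
    have h6 : (q * y) ^ 2 ≤ C ^ 2 := pow_le_pow_left₀ (by positivity) h4 2
    have h7 := mul_le_mul_of_nonneg_left h5 (sq_nonneg y)
    nlinarith
  · rw [norm_zero, zero_pow two_ne_zero]
    positivity

end CornerBound

/-! ### The trace of a Toeplitz commutator -/

section AntidiagonalSum

/-- Summation of a double series with terms `a (i + j + 1)` along the antidiagonals. -/
theorem hasSum_antidiagonal_succ {a : ℕ → ℂ} {C : ℝ}
    (h : ∀ n : ℕ, ((n : ℝ) + 1) ^ 4 * ‖a n‖ ≤ C) :
    HasSum (fun p : ℕ × ℕ => a (p.1 + p.2)) (∑' n : ℕ, ((n : ℂ) + 1) * a n) := by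
  have hs : Summable fun n : ℕ => 1 / ((n : ℝ) + 1) ^ 2 := by
    have h1 := (summable_nat_add_iff 1).2 (Real.summable_one_div_nat_pow.2 one_lt_two)
    simpa using h1
  have h1 : Summable fun p : ℕ × ℕ => a (p.1 + p.2) := by
    refine Summable.of_norm_bounded ((hs.mul_of_nonneg hs (fun n => by positivity)
      (fun n => by positivity)).mul_left C) fun ⟨i, j⟩ => ?_
    have h2 := h (i + j)
    push_cast at h2
    have hi : (0 : ℝ) ≤ i := i.cast_nonneg
    have hj : (0 : ℝ) ≤ j := j.cast_nonneg
    rw [one_div_mul_one_div, mul_one_div, le_div_iff₀ (by positivity)]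
    refine le_trans ?_ h2
    rw [mul_comm]
    gcongr
    calc ((i : ℝ) + 1) ^ 2 * ((j : ℝ) + 1) ^ 2 ≤ ((i : ℝ) + j + 1) ^ 2 * ((i : ℝ) + j + 1) ^ 2 := by
          gcongr <;> linarith
      _ = _ := by ring
  have h2 := (Finset.HasAntidiagonal.sigmaAntidiagonalEquivProd (A := ℕ)).hasSum_iff.2 h1.hasSum
  have h3 := h2.sigma fun n => hasSum_fintype _
  have h4 : ∀ n : ℕ, ∑ c : Finset.HasAntidiagonal.antidiagonal n,
      ((fun p : ℕ × ℕ => a (p.1 + p.2)) ∘ Finset.HasAntidiagonal.sigmaAntidiagonalEquivProd) ⟨n, c⟩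
        = ((n : ℂ) + 1) * a n := fun n => by
    have h5 : ∀ c : Finset.HasAntidiagonal.antidiagonal n,
        ((fun p : ℕ × ℕ => a (p.1 + p.2)) ∘ Finset.HasAntidiagonal.sigmaAntidiagonalEquivProd) ⟨n, c⟩ = a n :=
      fun c => congrArg a (Finset.HasAntidiagonal.mem_antidiagonal.1 c.2)
    rw [Finset.sum_congr rfl fun c _ => h5 c]
    simp
  simp only [h4] at h3
  rw [h3.tsum_eq]
  exact h1.hasSum

end AntidiagonalSum

section Trace

open MeasureTheory Real AddCircle

/-- The pairing `∑ m f̂(m) ĝ(-m)` over `m > 0`. -/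
def pairing (f g : C(AddCircle (2 * π), ℂ)) : ℂ :=
  ∑' n : ℕ, ((n : ℂ) + 1) * (fourierCoeff f (n + 1) * fourierCoeff g (-(n + 1)))

theorem inner_adjoint_mulOp (g : C(AddCircle (2 * π), ℂ)) (j k : ℤ) :
    ⟪(fourierLp 2 j : L2Circle), (mulOp g).adjoint (fourierLp 2 k)⟫_ℂ
      = starRingEnd ℂ (fourierCoeff g (k - j)) := by
  rw [ContinuousLinearMap.adjoint_inner_right, ← inner_conj_symm, inner_mulOp]

/-- The diagonal entries of the product of the Hankel operators of `f` and `g`. -/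
theorem hasSum_inner_corner (f g : C(AddCircle (2 * π), ℂ)) (l : ℕ) :
    HasSum (fun i : ℕ => fourierCoeff f ((l + i : ℕ) + 1) * fourierCoeff g (-((l + i : ℕ) + 1)))
      ⟪corner hardySpace (mulOp g).adjoint (fourierLp 2 (-(l + 1) : ℤ)),
        corner hardySpace (mulOp f) (fourierLp 2 (-(l + 1) : ℤ))⟫_ℂ := by
  have hk : (-(l + 1) : ℤ) < 0 := by omega
  have h := (fourierBasis (T := 2 * π)).hasSum_inner_mul_inner
    (corner hardySpace (mulOp g).adjoint (fourierLp 2 (-(l + 1) : ℤ)) : L2Circle)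
    (corner hardySpace (mulOp f) (fourierLp 2 (-(l + 1) : ℤ)) : L2Circle)
  simp only [coe_fourierBasis] at h
  rw [← (Nat.cast_injective (R := ℤ)).hasSum_iff] at h
  · refine h.congr_fun fun i => ?_
    simp only [Function.comp_apply]
    rw [← inner_conj_symm, inner_corner_fourierLp _ hk, inner_corner_fourierLp _ hk,
      if_pos (Int.natCast_nonneg i), if_pos (Int.natCast_nonneg i), inner_mulOp,
      inner_adjoint_mulOp, Complex.conj_conj, mul_comm]
    congr 2
    · push_cast; ring
    · push_cast; ring
  · intro j hj
    rw [inner_corner_fourierLp _ hk, if_neg, mul_zero]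
    exact fun h0 => hj ⟨j.toNat, Int.toNat_of_nonneg h0⟩

/-- The trace of the product of two Hankel operators. -/
theorem tsum_inner_corner {f g : C(AddCircle (2 * π), ℂ)} (hf : f ∈ symbolAlgebra)
    (hg : g ∈ symbolAlgebra) :
    ∑' k : ℤ, ⟪corner hardySpace (mulOp g).adjoint (fourierLp 2 k),
        -corner hardySpace (mulOp f) (fourierLp 2 k)⟫_ℂ = -pairing f g := by
  obtain ⟨C, hC⟩ := fourierCoeff_decay f hf
  obtain ⟨C', hC'⟩ := fourierCoeff_decay g hg
  have h1 : ∀ n : ℕ, ((n : ℝ) + 1) ^ 4 * ‖fourierCoeff f (n + 1) * fourierCoeff g (-(n + 1))‖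
      ≤ C * C' := fun n => by
    have h2 := hC (n + 1)
    have h3 := hC' (-(n + 1))
    push_cast at h2 h3
    have h4 := mul_le_mul h2 h3 (by positivity) ((by positivity : (0 : ℝ) ≤ _).trans h2)
    rw [norm_mul]
    refine le_trans (le_of_eq ?_) h4
    ring
  have h2 := (hasSum_antidiagonal_succ h1).prod_fiberwise fun l => hasSum_inner_corner f g l
  have h3 : HasSum (fun k : ℤ => ⟪corner hardySpace (mulOp g).adjoint (fourierLp 2 k),
        -corner hardySpace (mulOp f) (fourierLp 2 k)⟫_ℂ) (-pairing f g) := by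
    have hinj : Function.Injective fun l : ℕ => (-(l + 1) : ℤ) := fun a b hab => by
      simp only [neg_inj, add_left_inj, Nat.cast_inj] at hab
      exact hab
    rw [← hinj.hasSum_iff]
    · refine h2.neg.congr_fun fun l => ?_
      simp only [Function.comp_apply, inner_neg_right]
    · intro k hk
      rw [corner_fourierLp_of_nonneg _ (k := k), inner_zero_left]
      by_contra hneg
      exact hk ⟨(-k - 1).toNat, by simp only; omega⟩
  exact h3.tsum_eq

end Trace

theorem tendsto_clm_mul_one {E : Type*} [NormedAddCommGroup E] [NormedSpace ℂ E]
    {T S : ℕ → E →L[ℂ] E} (hT : Tendsto T atTop (𝓝 1)) (hS : Tendsto S atTop (𝓝 1)) :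
    Tendsto (fun n => T n * S n) atTop (𝓝 1) := by
  simpa using hT.mul hS

/-! ### Commutators of two exponentials -/

section PairDet

variable {R S : Type*} [Ring R] [Ring S]

theorem map_commutator_val (f : R →+* S) (a b : Rˣ) :
    f ((⁅a, b⁆ : Rˣ) : R)
      = f a * f b * (f ((a⁻¹ : Rˣ) : R) * f ((b⁻¹ : Rˣ) : R)) := by
  rw [commutatorElement_def, Units.val_mul, Units.val_mul, Units.val_mul, map_mul, map_mul, map_mul,
    mul_assoc]

theorem map_mul_map_inv (f : R →+* S) (a b : Rˣ) :
    f b * f a * (f ((a⁻¹ : Rˣ) : R) * f ((b⁻¹ : Rˣ) : R)) = 1 := by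
  rw [← map_mul, ← map_mul, ← map_mul, ← map_one f]
  congr 1
  rw [mul_assoc, Units.mul_inv_cancel_left, Units.mul_inv]

theorem map_commutator_of_commute (f : R →+* S) {a b : Rˣ} (h : f a * f b = f b * f a) :
    f ((⁅a, b⁆ : Rˣ) : R) = 1 := by
  rw [map_commutator_val, h]
  exact map_mul_map_inv f a b

variable {H : Type u} [NormedAddCommGroup H] [InnerProductSpace ℂ H] [CompleteSpace H]
  {V : Submodule ℂ H} [CompleteSpace V]

theorem exists_hasCommutatorDet_diag12_diag13 {a b : (extendedModule V)ˣ}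
    (h : p₁ V a * p₁ V b = p₁ V b * p₁ V a) {d : ℂ}
    (hd : IsNuclearDet (p₂ V a * p₂ V b * (p₂ V ((a⁻¹ : (extendedModule V)ˣ) : extendedModule V)
      * p₂ V ((b⁻¹ : (extendedModule V)ˣ) : extendedModule V))) d) :
    ∃ c : ℂˣ, (c : ℂ) = d ∧ HasCommutatorDet (detGraph V)
      (Units.map stabilize (diag12 a)) (Units.map stabilize (diag13 b)) c := by
  rw [← map_commutator_val (p₂ V)] at hd
  exact exists_hasCommutatorDet (commutator_diag12_diag13 a b)
    (map_commutator_of_commute (p₁ V) h) hd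

/-- The commutator of lifts of commuting elements lies over `1`, hence has a determinant. -/
theorem exists_hasCommutatorDet_of_commute {a b : (extendedModule V)ˣ}
    (h : p₁ V a * p₁ V b = p₁ V b * p₁ V a) :
    ∃ c : ℂˣ, HasCommutatorDet (detGraph V)
      (Units.map stabilize (diag12 a)) (Units.map stabilize (diag13 b)) c := by
  have h1 : IsTraceClass (p₂ V ((⁅a, b⁆ : (extendedModule V)ˣ) : extendedModule V) - 1) := by
    have h2 : IsTraceClass (compress V ((p₁ V ((⁅a, b⁆ : (extendedModule V)ˣ) : extendedModule V) :
      universalModule V) : H →L[ℂ] H) - p₂ V ((⁅a, b⁆ : (extendedModule V)ˣ) : extendedModule V)) :=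
      (((⁅a, b⁆ : (extendedModule V)ˣ) : extendedModule V)).2
    rw [map_commutator_of_commute (p₁ V) h] at h2
    have h3 : compress V ((1 : universalModule V) : H →L[ℂ] H) = 1 := compress_one V
    rw [h3] at h2
    have h4 := h2.neg
    rwa [neg_sub] at h4
  obtain ⟨d, hd⟩ := exists_isNuclearDet h1
  rw [map_commutator_val (p₂ V)] at hd
  obtain ⟨c, -, hc⟩ := exists_hasCommutatorDet_diag12_diag13 h hd
  exact ⟨c, hc⟩

end PairDet

section ExpDet

open MeasureTheory Real AddCircle

theorem p₁_expUnit_comm {f g : symbolAlgebra} (hf : IsTriangular f) (hg : IsTriangular g) :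
    p₁ hardySpace (expUnit f hf) * p₁ hardySpace (expUnit g hg)
      = p₁ hardySpace (expUnit g hg) * p₁ hardySpace (expUnit f hf) := by
  change multiplication _ * multiplication _ = multiplication _ * multiplication _
  rw [← map_mul, mul_comm (expSymbol f) (expSymbol g), map_mul]

theorem exists_hasCommutatorDet_expLift {f g : symbolAlgebra} (hf : IsTriangular f)
    (hg : IsTriangular g) :
    ∃ c : ℂˣ, HasCommutatorDet (detGraph hardySpace) (expLift12 f hf) (expLift13 g hg) c :=
  exists_hasCommutatorDet_of_commute (p₁_expUnit_comm hf hg)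

/-- The difference quotient `(n + 1) (e^{f / (n + 1)} - 1)`. -/
def expQuotient (f : symbolAlgebra) (n : ℕ) : C(AddCircle (2 * π), ℂ) :=
  ((n : ℂ) + 1) • ((expSymbol (divNat f n) : C(AddCircle (2 * π), ℂ)) - 1)

theorem tendsto_expQuotient (f : symbolAlgebra) :
    Tendsto (expQuotient f) atTop (𝓝 (f : C(AddCircle (2 * π), ℂ))) :=
  tendsto_smul_exp_sub_one (f : C(AddCircle (2 * π), ℂ))

theorem mulOp_expSymbol_divNat (f : symbolAlgebra) (n : ℕ) :
    mulOp (expSymbol (divNat f n)) = 1 + ((n : ℂ) + 1)⁻¹ • mulOp (expQuotient f n) := by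
  rw [← mulOp_smul, ← mulOp_one, ← mulOp_add, expQuotient, smul_smul,
    inv_mul_cancel₀ (Nat.cast_add_one_ne_zero n), one_smul, add_sub_cancel]

theorem tendsto_inv_natCast_add_one : Tendsto (fun n : ℕ => ((n : ℂ) + 1)⁻¹) atTop (𝓝 0) := by
  have h2 : Tendsto (fun n : ℕ => (n : ℂ)⁻¹) atTop (𝓝 0) := tendsto_inv_atTop_nhds_zero_nat
  refine (h2.comp (tendsto_add_atTop_nat 1)).congr fun n => ?_
  simp

theorem tendsto_compress_expSymbol_neg (f : symbolAlgebra) :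
    Tendsto (fun n => compress hardySpace (mulOp (expSymbol (-divNat f n)))) atTop (𝓝 1) := by
  have h1 : Tendsto (fun n : ℕ => -(((n : ℂ) + 1)⁻¹ • (f : C(AddCircle (2 * π), ℂ)))) atTop
      (𝓝 0) := by
    have := (tendsto_inv_natCast_add_one.smul_const (f : C(AddCircle (2 * π), ℂ))).neg
    rwa [zero_smul, neg_zero] at this
  have h2 := (NormedSpace.exp_continuous (𝔸 := C(AddCircle (2 * π), ℂ))).tendsto 0
  rw [NormedSpace.exp_zero] at h2
  have h3 := (continuous_mulOp.tendsto 1).comp (h2.comp h1)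
  rw [mulOp_one] at h3
  have hc : Continuous (compress hardySpace) := by
    unfold compress
    fun_prop
  have h4 := (hc.tendsto 1).comp h3
  rw [compress_one] at h4
  exact h4

theorem mem_preserve_divNat {W : Submodule ℂ L2Circle} {f : symbolAlgebra}
    (h : (f : C(AddCircle (2 * π), ℂ)) ∈ preserve W) (n : ℕ) :
    (divNat f n : C(AddCircle (2 * π), ℂ)) ∈ preserve W := smul_mem_preserve h _

/-- The Toeplitz operators of `e^g` and `e^f` multiply to that of `e^g e^f`, since `e^f` preserves the
Hardy space. In the opposite order this fails, which is the source of the determinant. -/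
theorem compress_exp_mul {f g : symbolAlgebra} (hf : IsTriangular f) (hg : IsTriangular g)
    (hf' : (f : C(AddCircle (2 * π), ℂ)) ∈ preserve hardySpace) :
    compress hardySpace (mulOp (expSymbol g) * mulOp (expSymbol f))
      * (compress hardySpace (mulOp (expSymbol (-f))) * compress hardySpace (mulOp (expSymbol (-g))))
      = 1 := by
  have h0 : compress hardySpace (mulOp (expSymbol g) * mulOp (expSymbol f))
      = compress hardySpace (mulOp (expSymbol g)) * compress hardySpace (mulOp (expSymbol f)) :=
    compress_mul_of_right _ (expSymbol_mem_preserve isClosed_hardySpace hf')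
  rw [h0]
  exact map_mul_map_inv (p₂ hardySpace) (expUnit f hf) (expUnit g hg)

/-- A summable bound for the Hankel operators of the difference quotients, uniform in `n`. -/
theorem exists_corner_bound (f g : symbolAlgebra) : ∃ c : ℤ → ℝ, Summable c ∧
    (∀ n k, ‖corner hardySpace (mulOp (expQuotient f n)) (fourierLp 2 k)‖ ^ 2 ≤ c k) ∧
    ∀ n k, ‖corner hardySpace (mulOp (expQuotient g n)).adjoint (fourierLp 2 k)‖ ^ 2 ≤ c k := by
  obtain ⟨C, hC⟩ := exists_decay_bound f
  obtain ⟨C', hC'⟩ := exists_decay_bound g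
  set S : ℝ := ∑' j : ℤ, 1 / (1 + (j : ℝ) ^ 2)
  have hS : 0 ≤ S := tsum_nonneg fun j => by positivity
  refine ⟨fun k => (4 * C ^ 2 * S + 4 * C' ^ 2 * S) * (1 / (1 + (k : ℝ) ^ 2)),
    summable_one_div_one_add_sq.mul_left _, fun n k => ?_, fun n k => ?_⟩
  · refine (norm_corner_sq_le (C := C) (fun i j => ?_) k).trans ?_
    · rw [inner_mulOp]
      exact hC n (i - j)
    · exact mul_le_mul_of_nonneg_right (le_add_of_nonneg_right (by positivity)) (by positivity)
  · refine (norm_corner_sq_le (C := C') (fun i j => ?_) k).trans ?_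
    · rw [inner_adjoint_mulOp, RCLike.norm_conj]
      have h1 := hC' n (j - i)
      have h2 : ((i - j : ℤ) : ℝ) ^ 2 = ((j - i : ℤ) : ℝ) ^ 2 := by push_cast; ring
      rw [h2]
      exact h1
    · exact mul_le_mul_of_nonneg_right (le_add_of_nonneg_left (by positivity)) (by positivity)

/-- The determinant of the commutator for `f / (n + 1)` and `g / (n + 1)`, to leading order. -/
theorem tendsto_det_expLift {f g : symbolAlgebra}
    (hf : (f : C(AddCircle (2 * π), ℂ)) ∈ preserve hardySpace)
    (hfn : ∀ n, IsTriangular (divNat f n)) (hgn : ∀ n, IsTriangular (divNat g n)) {c : ℕ → ℂˣ}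
    (hc : ∀ n, HasCommutatorDet (detGraph hardySpace) (expLift12 _ (hfn n)) (expLift13 _ (hgn n))
      (c n)) :
    Tendsto (fun n : ℕ => ((((n : ℂ) + 1)⁻¹) ^ 2)⁻¹ * ((c n : ℂ) - 1)) atTop
      (𝓝 (-pairing f g)) := by
  obtain ⟨b, hb, hbf, hbg⟩ := exists_corner_bound f g
  have hfb : ∀ k, fourierBasis (T := 2 * π) k = (fourierLp 2 k : L2Circle) := fun k => by
    rw [coe_fourierBasis]
  rw [← tsum_inner_corner f.2 g.2]
  simp only [← hfb] at hbf hbg ⊢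
  refine tendsto_det_toeplitzCommutator (V := hardySpace) (fourierBasis (T := 2 * π))
    (X := fun n => mulOp (expQuotient f n)) (Y := fun n => mulOp (expQuotient g n))
    (B := fun n => compress hardySpace (mulOp (expSymbol (-divNat f n)))
      * compress hardySpace (mulOp (expSymbol (-divNat g n))))
    ((continuous_mulOp.tendsto _).comp (tendsto_expQuotient f))
    ((continuous_mulOp.tendsto _).comp (tendsto_expQuotient g))
    (tendsto_clm_mul_one (tendsto_compress_expSymbol_neg f) (tendsto_compress_expSymbol_neg g))
    hb hbf hbg tendsto_inv_natCast_add_one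
    (fun n => inv_ne_zero (Nat.cast_add_one_ne_zero n)) (fun n => ?_) fun n hsum => ?_
  · rw [norm_inv, ← Nat.cast_add_one, Complex.norm_natCast]
    exact inv_le_one_of_one_le₀ (by exact_mod_cast Nat.succ_pos n)
  · have h1 := isNuclearDet_toeplitzCommutator (V := hardySpace) (fourierBasis (T := 2 * π))
      (mulOp_expSymbol_divNat f n) (mulOp_expSymbol_divNat g n) (mulOp_comm _ _)
      (compress_exp_mul (hfn n) (hgn n) (mem_preserve_divNat hf n)) hsum
    obtain ⟨c', hc', h2⟩ := exists_hasCommutatorDet_diag12_diag13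
      (p₁_expUnit_comm (hfn n) (hgn n)) h1
    rw [← hc']
    exact congrArg Units.val ((hc n).unique (isDeterminantGraph_detGraph hardySpace) h2)

/-- The determinant of the commutator of the lifts of `e^f` and `e^g`, for `f` without negative and
`g` without positive frequencies: the exponential of the trace of `[T_f, T_g]`. By multiplicativity it
is the `(n + 1) ^ 2`-th power of the determinant for `f / (n + 1)` and `g / (n + 1)`. -/
theorem hasCommutatorDet_expLift12_expLift13 {f g : symbolAlgebra}
    (hf : (f : C(AddCircle (2 * π), ℂ)) ∈ preserve hardySpace)
    (hg : (g : C(AddCircle (2 * π), ℂ)) ∈ preserve hardySpaceᗮ) :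
    HasCommutatorDet (detGraph hardySpace) (expLift12 f (Or.inl hf)) (expLift13 g (Or.inr hg))
      (cexpUnit (-pairing f g)) := by
  have hD := isDeterminantGraph_detGraph hardySpace
  have hfn : ∀ n, IsTriangular (divNat f n) := fun n => Or.inl (mem_preserve_divNat hf n)
  have hgn : ∀ n, IsTriangular (divNat g n) := fun n => Or.inr (mem_preserve_divNat hg n)
  obtain ⟨d, hd⟩ := exists_hasCommutatorDet_expLift (f := f) (g := g) (Or.inl hf) (Or.inr hg)
  choose c hc using fun n => exists_hasCommutatorDet_expLift (hfn n) (hgn n)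
  have hpow : ∀ n, d = c n ^ ((n + 1) * (n + 1)) := fun n => by
    have h2 := ((hc n).pow_left hD (n + 1)).pow_right hD (n + 1)
    rw [← expLift12_pow (Or.inl hf) (hfn n) (n + 1) (natCast_smul_divNat f n),
      ← expLift13_pow (Or.inr hg) (hgn n) (n + 1) (natCast_smul_divNat g n), ← pow_mul] at h2
    exact hd.unique hD h2
  have h1 : Tendsto (fun n : ℕ => (n + 1) * (n + 1)) atTop atTop :=
    (tendsto_add_atTop_nat 1).atTop_mul_atTop₀ (tendsto_add_atTop_nat 1)
  have h2 := tendsto_pow_exp (d := fun n => (c n : ℂ)) h1 (t := -pairing f g) (by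
    refine (tendsto_det_expLift hf hfn hgn hc).congr fun n => ?_
    rw [inv_pow, inv_inv, pow_two]
    push_cast
    rfl)
  have h4 : ∀ n, (c n : ℂ) ^ ((n + 1) * (n + 1)) = d := fun n => by
    rw [← Units.val_pow_eq_pow_val, ← hpow]
  simp only [h4] at h2
  have h5 : d = cexpUnit (-pairing f g) := Units.ext (tendsto_nhds_unique tendsto_const_nhds h2)
  rw [← h5]
  exact hd

end ExpDet

/-! ### Splitting a symbol into its analytic parts -/

section FourierSeries

open MeasureTheory Real AddCircle

theorem fourier_coe_eq (n : ℤ) (x : ℝ) :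
    fourier n (x : AddCircle (2 * π)) = Complex.exp (n * Complex.I * x) := by
  rw [fourier_coe_apply]
  congr 1
  have : (π : ℂ) ≠ 0 := by exact_mod_cast Real.pi_ne_zero
  push_cast
  field_simp

theorem iteratedDeriv_fourier (c : ℂ) (n : ℤ) (k : ℕ) :
    iteratedDeriv k (fun x : ℝ => c * fourier n (x : AddCircle (2 * π)))
      = fun x : ℝ => c * (n * Complex.I) ^ k * fourier n (x : AddCircle (2 * π)) := by
  induction k with
  | zero => simp
  | succ k ih =>
    rw [iteratedDeriv_succ, ih]
    ext x
    have h := (hasDerivAt_fourier (2 * π) n x).const_mul (c * (n * Complex.I) ^ k)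
    rw [h.deriv, pow_succ]
    have : (π : ℂ) ≠ 0 := by exact_mod_cast Real.pi_ne_zero
    push_cast
    field_simp

/-- Fourier series with rapidly decaying coefficients converge to twice continuously
differentiable functions. -/
theorem exists_symbol_of_coefficients {c : ℤ → ℂ} {C : ℝ}
    (hc : ∀ n : ℤ, (n : ℝ) ^ 4 * ‖c n‖ ≤ C) :
    ∃ ψ : symbolAlgebra, HasSum (fun n => c n • fourier n) (ψ : C(AddCircle (2 * π), ℂ)) ∧
      ∀ n, fourierCoeff (ψ : C(AddCircle (2 * π), ℂ)) n = c n := by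
  have hC : 0 ≤ C := (by positivity : (0 : ℝ) ≤ (0 : ℤ) ^ 4 * ‖c 0‖).trans (hc 0)
  -- the series may be differentiated twice term by term
  have hb : ∀ k : ℕ, k ≤ 2 → ∀ n : ℤ,
      ‖c n‖ * |(n : ℝ)| ^ k ≤ (2 * C + ‖c 0‖) * (1 / (1 + (n : ℝ) ^ 2)) := by
    intro k hk n
    rcases eq_or_ne n 0 with rfl | hn
    · have h1 : |((0 : ℤ) : ℝ)| ^ k ≤ 1 := pow_le_one₀ (abs_nonneg _) (by simp)
      have h2 := mul_le_mul_of_nonneg_left h1 (norm_nonneg (c 0))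
      refine h2.trans ?_
      simp only [Int.cast_zero]
      norm_num
      exact hC
    · have h1 : (1 : ℝ) ≤ |(n : ℝ)| := by
        rw [← Int.cast_abs]
        exact_mod_cast Int.one_le_abs hn
      have h2 : |(n : ℝ)| ^ k ≤ (n : ℝ) ^ 2 := by
        rw [← sq_abs (n : ℝ)]
        exact pow_le_pow_right₀ h1 hk
      have h3 : (1 : ℝ) ≤ (n : ℝ) ^ 2 := by
        rw [← sq_abs (n : ℝ)]
        exact one_le_pow₀ h1
      rw [mul_one_div, le_div_iff₀ (by positivity)]
      calc ‖c n‖ * |(n : ℝ)| ^ k * (1 + (n : ℝ) ^ 2)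
          ≤ ‖c n‖ * (n : ℝ) ^ 2 * ((n : ℝ) ^ 2 + (n : ℝ) ^ 2) := by gcongr
        _ = 2 * ((n : ℝ) ^ 4 * ‖c n‖) := by ring
        _ ≤ 2 * C := by linarith [hc n]
        _ ≤ _ := by linarith [norm_nonneg (c 0)]
  have hs : ∀ k : ℕ, k ≤ 2 → Summable fun n : ℤ => ‖c n‖ * |(n : ℝ)| ^ k := fun k hk =>
    Summable.of_nonneg_of_le (fun n => by positivity) (hb k hk)
      (summable_one_div_one_add_sq.mul_left _)
  have hsum : Summable fun n : ℤ => c n • (fourier n : C(AddCircle (2 * π), ℂ)) := by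
    refine Summable.of_norm ((hs 0 (by norm_num)).congr fun n => ?_)
    rw [norm_smul, fourier_norm, pow_zero]
  have hdiff : ContDiff ℝ 2 fun x : ℝ => ∑' n : ℤ, c n * fourier n (x : AddCircle (2 * π)) := by
    have h := contDiff_tsum (𝕜 := ℝ) (N := 2)
      (f := fun (n : ℤ) (x : ℝ) => c n * fourier n (x : AddCircle (2 * π)))
      (v := fun k n => ‖c n‖ * |(n : ℝ)| ^ k) (fun n => ?_) (fun k hk => hs k (by exact_mod_cast hk))
      (fun k n x hk => ?_)
    · exact h
    · exact contDiff_const.mul (fourier_mem_symbolAlgebra n)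
    · rw [norm_iteratedFDeriv_eq_norm_iteratedDeriv, iteratedDeriv_fourier, norm_mul, norm_mul,
        norm_pow, norm_mul, Complex.norm_I, mul_one, Complex.norm_intCast, fourier_coe_eq]
      have h1 : (n * Complex.I * x : ℂ) = ((n * x : ℝ) : ℂ) * Complex.I := by push_cast; ring
      rw [h1, Complex.norm_exp_ofReal_mul_I, mul_one]
  have hval : ∀ x : AddCircle (2 * π), (∑' n : ℤ, c n • (fourier n : C(AddCircle (2 * π), ℂ))) x
      = ∑' n : ℤ, c n * fourier n x := fun x => by
    have h := hsum.hasSum.mapL (ContinuousMap.evalCLM ℂ x)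
    exact h.tsum_eq.symm
  refine ⟨⟨∑' n : ℤ, c n • fourier n, ?_⟩, hsum.hasSum, fun m => ?_⟩
  · rw [mem_symbolAlgebra]
    simp only [hval]
    exact hdiff
  · rw [← coefficient_apply]
    refine (hsum.hasSum.mapL (coefficient m)).unique ?_
    have h := hasSum_single (f := fun n : ℤ =>
      coefficient m (c n • (fourier n : C(AddCircle (2 * π), ℂ)))) m fun n hn => by
        rw [map_smul, coefficient_apply, fourierCoeff_fourier, Pi.single_apply, if_neg hn.symm,
          smul_zero]
    convert h using 1
    rw [map_smul, coefficient_apply, fourierCoeff_fourier, Pi.single_eq_same, smul_eq_mul, mul_one]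

theorem summable_fourierCoeff (φ : symbolAlgebra) :
    Summable (fourierCoeff (φ : C(AddCircle (2 * π), ℂ))) := by
  obtain ⟨C, hC⟩ := fourierCoeff_decay (φ : C(AddCircle (2 * π), ℂ)) φ.2
  refine Summable.of_norm_bounded
    (summable_one_div_one_add_sq.mul_left (2 * C + ‖fourierCoeff φ.1 0‖)) fun n => ?_
  have hC0 : 0 ≤ C := (by positivity : (0 : ℝ) ≤ (0 : ℤ) ^ 2 * ‖fourierCoeff φ.1 0‖).trans (hC 0)
  rw [mul_one_div, le_div_iff₀ (by positivity)]
  rcases eq_or_ne n 0 with rfl | hn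
  · simp only [Int.cast_zero]
    norm_num
    exact hC0
  · have h1 : (1 : ℝ) ≤ (n : ℝ) ^ 2 := by
      rw [← sq_abs (n : ℝ), ← Int.cast_abs]
      exact one_le_pow₀ (by exact_mod_cast Int.one_le_abs hn)
    have h2 := hC n
    nlinarith [norm_nonneg (fourierCoeff φ.1 n), norm_nonneg (fourierCoeff φ.1 0)]

/-- A symbol with rapidly decaying Fourier coefficients is a sum of symbols with nonnegative and
with negative frequencies. -/
theorem exists_decomposition {φ : symbolAlgebra} {C : ℝ}
    (hφ : ∀ n : ℤ, (n : ℝ) ^ 4 * ‖fourierCoeff (φ : C(AddCircle (2 * π), ℂ)) n‖ ≤ C) :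
    ∃ φp φm : symbolAlgebra, φ = φp + φm ∧
      (∀ n : ℤ, fourierCoeff (φp : C(AddCircle (2 * π), ℂ)) n
        = if 0 ≤ n then fourierCoeff (φ : C(AddCircle (2 * π), ℂ)) n else 0) ∧
      ∀ n : ℤ, fourierCoeff (φm : C(AddCircle (2 * π), ℂ)) n
        = if n < 0 then fourierCoeff (φ : C(AddCircle (2 * π), ℂ)) n else 0 := by
  have hle : ∀ (q : ℤ → Prop) [DecidablePred q] (n : ℤ), (n : ℝ) ^ 4 *
      ‖if q n then fourierCoeff (φ : C(AddCircle (2 * π), ℂ)) n else 0‖ ≤ C := by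
    intro q _ n
    split_ifs
    · exact hφ n
    · rw [norm_zero, mul_zero]
      exact (by positivity : (0 : ℝ) ≤ _).trans (hφ n)
  obtain ⟨φ₁, hs₁, hc₁⟩ := exists_symbol_of_coefficients (hle fun n => 0 ≤ n)
  obtain ⟨φ₂, hs₂, hc₂⟩ := exists_symbol_of_coefficients (hle fun n => n < 0)
  refine ⟨φ₁, φ₂, Subtype.ext ?_, hc₁, hc₂⟩
  refine (hasSum_fourier_series_of_summable (summable_fourierCoeff φ)).unique
    ((hs₁.add hs₂).congr_fun fun n => ?_)
  rw [← add_smul]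
  congr 1
  split_ifs <;> first | omega | simp

/-- The pairing sees only the positive frequencies of `f` and the negative frequencies of `g`. -/
theorem pairing_congr {f f' g g' : C(AddCircle (2 * π), ℂ)}
    (hf : ∀ n : ℤ, 0 < n → fourierCoeff f n = fourierCoeff f' n)
    (hg : ∀ n : ℤ, n < 0 → fourierCoeff g n = fourierCoeff g' n) : pairing f g = pairing f' g' := by
  unfold pairing
  congr 1
  ext n
  rw [hf _ (by omega), hg _ (by omega)]

end FourierSeries

/-! ### The pairing as an integral -/

section Integral

open MeasureTheory Real AddCircle

/-- Parseval's identity for `∫ φ dγ`, integrating the Fourier series of `φ` term by term. -/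
theorem hasSum_integral_mul_deriv (φ γ : symbolAlgebra) {g g' : ℝ → ℂ}
    (hγ : ∀ x : ℝ, (γ : C(AddCircle (2 * π), ℂ)) x = g x) (hg : ∀ x, HasDerivAt g (g' x) x)
    (hg' : Continuous g') :
    HasSum (fun n : ℤ => fourierCoeff (φ : C(AddCircle (2 * π), ℂ)) n
        * (-(n * Complex.I) * (2 * π * fourierCoeff (γ : C(AddCircle (2 * π), ℂ)) (-n))))
      (∫ x in (0 : ℝ)..2 * π, (φ : C(AddCircle (2 * π), ℂ)) x * g' x) := by
  set Φ : C(AddCircle (2 * π), ℂ) := φ.1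
  have hsum : Summable (fourierCoeff Φ) := summable_fourierCoeff φ
  have h := intervalIntegral.hasSum_integral_of_dominated_convergence (μ := volume) (a := 0)
    (b := 2 * π) (F := fun (n : ℤ) (x : ℝ) => fourierCoeff Φ n * fourier n (x : AddCircle (2 * π))
      * g' x) (f := fun x : ℝ => Φ x * g' x) (fun n x => ‖fourierCoeff Φ n‖ * ‖g' x‖)
    (fun n => ?_) (fun n => ?_) ?_ ?_ ?_
  · refine h.congr_fun fun n => ?_
    have hper : g (2 * π) = g 0 := by
      rw [← hγ, ← hγ]
      congr 1
      rw [AddCircle.coe_period, AddCircle.coe_zero]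
    have h1 := integral_fourier_deriv hg hg' hper (-n)
    have h2 := fourierCoeff_eq_integral_exp (γ : C(AddCircle (2 * π), ℂ)) (-n)
    simp only [hγ] at h2
    have h3 : (∫ x in (0 : ℝ)..2 * π, Complex.exp (-((-n : ℤ) * Complex.I * x)) * g x)
        = 2 * π * fourierCoeff (γ : C(AddCircle (2 * π), ℂ)) (-n) := by
      rw [h2, Complex.real_smul]
      have : (π : ℂ) ≠ 0 := by exact_mod_cast Real.pi_ne_zero
      push_cast
      field_simp
    rw [h3] at h1
    simp only [mul_assoc, intervalIntegral.integral_const_mul]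
    congr 1
    rw [← mul_assoc, ← mul_assoc] at *
    have h4 : ∀ x : ℝ, fourier n (x : AddCircle (2 * π)) * g' x
        = Complex.exp (-((-n : ℤ) * Complex.I * x)) * g' x := fun x => by
      rw [fourier_coe_eq]
      congr 2
      push_cast
      ring
    simp only [h4]
    rw [h1]
    push_cast
    ring
  · apply Continuous.aestronglyMeasurable
    have : Continuous fun x : ℝ => fourier n (x : AddCircle (2 * π)) :=
      (fourier n).continuous.comp (AddCircle.continuous_mk' _)
    fun_prop
  · refine Eventually.of_forall fun x _ => ?_
    have h1 : ‖fourier n (x : AddCircle (2 * π))‖ ≤ 1 :=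
      ((fourier n).norm_coe_le_norm _).trans (fourier_norm n).le
    rw [norm_mul, norm_mul]
    gcongr
    exact mul_le_of_le_one_right (norm_nonneg _) h1
  · exact Eventually.of_forall fun x _ => hsum.norm.mul_right _
  · simp only [tsum_mul_right]
    apply Continuous.intervalIntegrable
    fun_prop
  · refine Eventually.of_forall fun x _ => ?_
    exact (has_pointwise_sum_fourier_series_of_summable hsum x).mul_right _

/-- The terms of `∫ φ dγ` with positive and with negative index form the two pairings. -/
theorem integral_mul_deriv_eq (φ γ : symbolAlgebra) {g g' : ℝ → ℂ}
    (hγ : ∀ x : ℝ, (γ : C(AddCircle (2 * π), ℂ)) x = g x) (hg : ∀ x, HasDerivAt g (g' x) x)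
    (hg' : Continuous g') :
    ∫ x in (0 : ℝ)..2 * π, (φ : C(AddCircle (2 * π), ℂ)) x * g' x
      = 2 * π * Complex.I * (pairing γ φ - pairing φ γ) := by
  have h := hasSum_integral_mul_deriv φ γ hγ hg hg'
  set F : ℤ → ℂ := fun n : ℤ => fourierCoeff (φ : C(AddCircle (2 * π), ℂ)) n
        * (-(n * Complex.I) * (2 * π * fourierCoeff (γ : C(AddCircle (2 * π), ℂ)) (-n))) with hF
  have hs1 : Summable fun n : ℕ => F n := h.summable.comp_injective Nat.cast_injective
  have hs2 : Summable fun n : ℕ => F (-(n + 1)) :=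
    h.summable.comp_injective (i := fun n : ℕ => (-(n + 1) : ℤ)) fun a b hab => by
      simp only [neg_inj, add_left_inj, Nat.cast_inj] at hab
      exact hab
  rw [← h.tsum_eq, tsum_of_nat_of_neg_add_one hs1 hs2, hs1.tsum_eq_zero_add]
  have h0 : F (0 : ℕ) = 0 := by simp [hF]
  have h1 : ∀ n : ℕ, F ((n + 1 : ℕ)) = -(2 * π * Complex.I) * (((n : ℂ) + 1)
      * (fourierCoeff (φ : C(AddCircle (2 * π), ℂ)) (n + 1)
        * fourierCoeff (γ : C(AddCircle (2 * π), ℂ)) (-(n + 1)))) := fun n => by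
    simp only [hF]
    push_cast
    ring
  have h2 : ∀ n : ℕ, F (-(n + 1)) = (2 * π * Complex.I) * (((n : ℂ) + 1)
      * (fourierCoeff (γ : C(AddCircle (2 * π), ℂ)) (n + 1)
        * fourierCoeff (φ : C(AddCircle (2 * π), ℂ)) (-(n + 1)))) := fun n => by
    simp only [hF, neg_neg]
    push_cast
    ring
  rw [h0]
  simp only [h1, h2, tsum_mul_left]
  unfold pairing
  ring

end Integral

section CommutatorDet

variable {Q K : Type*} [Group Q] [Group K]

/-- Bimultiplicativity of the determinant of the commutator for products of three factors. -/
theorem HasCommutatorDet.zpow_mul_mul {π : Q →* K} {D : Subgroup (Q × ℂˣ)}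
    (hD : IsDeterminantGraph π D) {x₀ x₁ x₂ y₀ y₁ y₂ : Q}
    {d₀₀ d₀₁ d₀₂ d₁₀ d₁₁ d₁₂ d₂₀ d₂₁ d₂₂ : ℂˣ}
    (h₀₀ : HasCommutatorDet D x₀ y₀ d₀₀) (h₀₁ : HasCommutatorDet D x₀ y₁ d₀₁)
    (h₀₂ : HasCommutatorDet D x₀ y₂ d₀₂) (h₁₀ : HasCommutatorDet D x₁ y₀ d₁₀)
    (h₁₁ : HasCommutatorDet D x₁ y₁ d₁₁) (h₁₂ : HasCommutatorDet D x₁ y₂ d₁₂)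
    (h₂₀ : HasCommutatorDet D x₂ y₀ d₂₀) (h₂₁ : HasCommutatorDet D x₂ y₁ d₂₁)
    (h₂₂ : HasCommutatorDet D x₂ y₂ d₂₂) (m n : ℤ) :
    HasCommutatorDet D (x₀ ^ m * x₁ * x₂) (y₀ ^ n * y₁ * y₂)
      (((d₀₀ ^ m) ^ n * d₀₁ ^ m * d₀₂ ^ m) * (d₁₀ ^ n * d₁₁ * d₁₂) * (d₂₀ ^ n * d₂₁ * d₂₂)) :=
  have h₀ := ((((h₀₀.zpow_left hD m).zpow_right hD n).mul_right hD
    (h₀₁.zpow_left hD m)).mul_right hD (h₀₂.zpow_left hD m))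
  have h₁ := ((h₁₀.zpow_right hD n).mul_right hD h₁₁).mul_right hD h₁₂
  have h₂ := ((h₂₀.zpow_right hD n).mul_right hD h₂₁).mul_right hD h₂₂
  (h₀.mul_left hD h₁).mul_left hD h₂

end CommutatorDet

/-! ### Lifts of invertible symbols -/

section SymbolUnits

open MeasureTheory Real AddCircle

/-- A smooth function on the circle as a symbol. -/
def toSymbol : SmoothCircle →+* symbolAlgebra where
  toFun f := ⟨f.toContinuousMap, f.contDiff⟩
  map_one' := rfl
  map_mul' _ _ := rfl
  map_zero' := rfl
  map_add' _ _ := rfl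

/-- The function `e^{iθ}` as a unit. -/
def monomialUnit : symbolAlgebraˣ where
  val := monomial 1
  inv := monomial (-1)
  val_inv := by rw [← monomial_add, add_neg_cancel, monomial_zero]
  inv_val := by rw [← monomial_add, neg_add_cancel, monomial_zero]

/-- The exponential of a symbol as a unit. -/
def expSymbolUnit (f : symbolAlgebra) : symbolAlgebraˣ where
  val := expSymbol f
  inv := expSymbol (-f)
  val_inv := expSymbol_mul_neg f
  inv_val := expSymbol_neg_mul f

theorem expSymbolUnit_add (f g : symbolAlgebra) :
    expSymbolUnit (f + g) = expSymbolUnit f * expSymbolUnit g :=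
  Units.ext (expSymbol_add f g)

theorem monomialUnit_zpow (m : ℤ) : (monomialUnit ^ m).val = monomial m := by
  have h : (monomial : ℤ → symbolAlgebra) m * ((monomialUnit ^ m)⁻¹).val = 1 := by
    induction m with
    | zero => rw [zpow_zero, inv_one, Units.val_one, mul_one, monomial_zero]
    | succ n ih =>
      rw [monomial_add, zpow_add_one, mul_inv, Units.val_mul, mul_mul_mul_comm, ih, one_mul]
      exact monomialUnit.val_inv
    | pred n ih =>
      rw [sub_eq_add_neg, monomial_add, zpow_add, mul_inv, Units.val_mul, mul_mul_mul_comm, ih,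
        one_mul, zpow_neg_one, inv_inv]
      exact monomialUnit.inv_val
  exact ((Units.mul_inv_eq_one).1 h).symm

theorem map_zpow_mul_mul {G G' L : Type*} [Group G] [Group G'] [Group L] (φ : G →* L)
    (ψ : G' →* L) {x y z : G} {x' y' z' : G'} (hx : φ x = ψ x') (hy : φ y = ψ y')
    (hz : φ z = ψ z') (m : ℤ) : φ (x ^ m * y * z) = ψ (x' ^ m * (y' * z')) := by
  simp only [map_mul, map_zpow, hx, hy, hz, mul_assoc]

namespace IsToeplitzLift

variable {R M : Type*} [Ring R] [Ring M] {T : symbolAlgebra → R} (hT : IsToeplitzLift T)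
  {p : R →+* M} {μ : symbolAlgebra →+* M}

theorem map_shift12 (h : ∀ φ, p (T φ) = μ φ) (h01 : (0 : ℕ) ≠ 1) :
    StableGL.map p (Units.map stabilize (shift12 hT.map_monomial_mul))
      = StableGL.map μ (diagHom h01 monomialUnit) :=
  (ConnesKaroubi.map_shift12 _ p (Units.map (μ : symbolAlgebra →* M) monomialUnit)
    (h _) (h _) h01).trans (map_diag μ h01 monomialUnit).symm

theorem map_shift13 (h : ∀ φ, p (T φ) = μ φ) (h02 : (0 : ℕ) ≠ 2) :
    StableGL.map p (Units.map stabilize (shift13 hT.map_monomial_mul))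
      = StableGL.map μ (diagHom h02 monomialUnit) :=
  (ConnesKaroubi.map_shift13 _ p (Units.map (μ : symbolAlgebra →* M) monomialUnit)
    (h _) (h _) h02).trans (map_diag μ h02 monomialUnit).symm

theorem map_expLift (h : ∀ φ, p (T φ) = μ φ) {f : symbolAlgebra} (hf : IsTriangular f) :
    Units.map (p : R →* M) (hT.expLift f hf)
      = Units.map (μ : symbolAlgebra →* M) (expSymbolUnit f) :=
  Units.ext (h _)

theorem map_diag12 (h : ∀ φ, p (T φ) = μ φ) (h01 : (0 : ℕ) ≠ 1) {f : symbolAlgebra}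
    (hf : IsTriangular f) : StableGL.map p (Units.map stabilize (diag12 (hT.expLift f hf)))
      = StableGL.map μ (diagHom h01 (expSymbolUnit f)) :=
  (ConnesKaroubi.map_diag12 p (hT.expLift f hf) h01).trans
    ((congrArg (StableGL.diag h01) (hT.map_expLift h hf)).trans
      (map_diag μ h01 (expSymbolUnit f)).symm)

theorem map_diag13 (h : ∀ φ, p (T φ) = μ φ) (h02 : (0 : ℕ) ≠ 2) {f : symbolAlgebra}
    (hf : IsTriangular f) : StableGL.map p (Units.map stabilize (diag13 (hT.expLift f hf)))
      = StableGL.map μ (diagHom h02 (expSymbolUnit f)) :=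
  (ConnesKaroubi.map_diag13 p (hT.expLift f hf) h02).trans
    ((congrArg (StableGL.diag h02) (hT.map_expLift h hf)).trans
      (map_diag μ h02 (expSymbolUnit f)).symm)

theorem map_product12 (h : ∀ φ, p (T φ) = μ φ) (h01 : (0 : ℕ) ≠ 1) {f g : symbolAlgebra}
    (hf : IsTriangular f) (hg : IsTriangular g) (m : ℤ) {u : symbolAlgebraˣ}
    (hu : u = monomialUnit ^ m * expSymbolUnit (f + g)) :
    StableGL.map p (Units.map stabilize (shift12 hT.map_monomial_mul) ^ m
        * Units.map stabilize (diag12 (hT.expLift f hf))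
        * Units.map stabilize (diag12 (hT.expLift g hg)))
      = StableGL.map μ (StableGL.diag h01 u) := by
  rw [hu, expSymbolUnit_add]
  exact map_zpow_mul_mul (StableGL.map p) ((StableGL.map μ).comp (diagHom h01))
    (hT.map_shift12 h h01) (hT.map_diag12 h h01 hf) (hT.map_diag12 h h01 hg) m

theorem map_product13 (h : ∀ φ, p (T φ) = μ φ) (h02 : (0 : ℕ) ≠ 2) {f g : symbolAlgebra}
    (hf : IsTriangular f) (hg : IsTriangular g) (m : ℤ) {u : symbolAlgebraˣ}
    (hu : u = monomialUnit ^ m * expSymbolUnit (f + g)) :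
    StableGL.map p (Units.map stabilize (shift13 hT.map_monomial_mul) ^ m
        * Units.map stabilize (diag13 (hT.expLift f hf))
        * Units.map stabilize (diag13 (hT.expLift g hg)))
      = StableGL.map μ (StableGL.diag h02 u) := by
  rw [hu, expSymbolUnit_add]
  exact map_zpow_mul_mul (StableGL.map p) ((StableGL.map μ).comp (diagHom h02))
    (hT.map_shift13 h h02) (hT.map_diag13 h h02 hf) (hT.map_diag13 h h02 hg) m

end IsToeplitzLift

/-- The image of a symbol is the commutator of the standard lifts of the two diagonal matrices. -/
theorem coe_map_steinbergSymbol {A B : Type*} [CommRing A] [Ring B] (f : A →+* B) (a b : Aˣ)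
    (h01 : (0 : ℕ) ≠ 1) (h02 : (0 : ℕ) ≠ 2) :
    (K₂.map f (steinbergSymbol a b (Commute.all _ _)) : Steinberg B)
      = ⁅Steinberg.map f (Steinberg.h h01 a), Steinberg.map f (Steinberg.h h02 b)⁆ :=
  (rfl : _ = Steinberg.map f ⁅Steinberg.h h01 a, Steinberg.h h02 b⁆).trans
    (map_commutatorElement (Steinberg.map f) _ _)

theorem proj_map_h {A A' B : Type*} [CommRing A] [CommRing A'] [Ring B] (f : A →+* A')
    (g : A' →+* B) {i j : ℕ} (hij : i ≠ j) (a : Aˣ) :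
    StableGL.map g (StableGL.diag hij (Units.map (f : A →* A') a))
      = Steinberg.proj B (Steinberg.map (g.comp f) (Steinberg.h hij a)) := by
  rw [Steinberg.proj_map, Steinberg.proj_h, map_diag, map_diag]
  rfl

end SymbolUnits

/-! ### The character on invertible symbols -/

section SymbolLift

variable {f₁ f₂ g₁ g₂ : symbolAlgebra}
  (hf₁ : (f₁ : C(AddCircle (2 * Real.pi), ℂ)) ∈ preserve hardySpace)
  (hf₂ : (f₂ : C(AddCircle (2 * Real.pi), ℂ)) ∈ preserve hardySpaceᗮ)
  (hg₁ : (g₁ : C(AddCircle (2 * Real.pi), ℂ)) ∈ preserve hardySpace)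
  (hg₂ : (g₂ : C(AddCircle (2 * Real.pi), ℂ)) ∈ preserve hardySpaceᗮ)

/-- The lift of `diag(a, a⁻¹, 1)` for `a = z^m e^{f₁ + f₂}`, `f₁` without negative and `f₂` without
positive frequencies. -/
def symbolLift12 (m : ℤ) : StableGL (extendedModule hardySpace) :=
  lift12 ^ m * expLift12 f₁ (Or.inl hf₁) * expLift12 f₂ (Or.inr hf₂)

/-- The lift of `diag(a, 1, a⁻¹)` for `a = z^m e^{f₁ + f₂}`, `f₁` without negative and `f₂` without
positive frequencies. -/
def symbolLift13 (m : ℤ) : StableGL (extendedModule hardySpace) :=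
  lift13 ^ m * expLift13 f₁ (Or.inl hf₁) * expLift13 f₂ (Or.inr hf₂)

theorem map_symbolLift12 (h01 : (0 : ℕ) ≠ 1) (m : ℤ) {u : symbolAlgebraˣ}
    (hu : u = monomialUnit ^ m * expSymbolUnit (f₁ + f₂)) :
    StableGL.map (p₁ hardySpace) (symbolLift12 hf₁ hf₂ m)
      = StableGL.map multiplication (StableGL.diag h01 u) :=
  isToeplitzLift_toeplitzLift.map_product12 p₁_toeplitzLift h01 (Or.inl hf₁) (Or.inr hf₂) m hu

theorem map_symbolLift13 (h02 : (0 : ℕ) ≠ 2) (m : ℤ) {u : symbolAlgebraˣ}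
    (hu : u = monomialUnit ^ m * expSymbolUnit (f₁ + f₂)) :
    StableGL.map (p₁ hardySpace) (symbolLift13 hf₁ hf₂ m)
      = StableGL.map multiplication (StableGL.diag h02 u) :=
  isToeplitzLift_toeplitzLift.map_product13 p₁_toeplitzLift h02 (Or.inl hf₁) (Or.inr hf₂) m hu

theorem cexpUnit_mul (z w : ℂ) : cexpUnit z * cexpUnit w = cexpUnit (z + w) :=
  Units.ext (Complex.exp_add z w).symm

theorem cexpUnit_inv (z : ℂ) : (cexpUnit z)⁻¹ = cexpUnit (-z) :=
  (eq_inv_of_mul_eq_one_left (by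
    rw [cexpUnit_mul, neg_add_cancel]; exact Units.ext Complex.exp_zero)).symm

theorem cexpUnit_zpow (z : ℂ) (n : ℤ) : cexpUnit z ^ n = cexpUnit (n * z) :=
  Units.ext (by
    rw [Units.val_zpow_eq_zpow_val, cexpUnit_val, cexpUnit_val, Complex.exp_int_mul])

theorem cexpUnit_pi : cexpUnit (Real.pi * Complex.I) = -1 := Units.ext Complex.exp_pi_mul_I

theorem cexpUnit_zero : cexpUnit 0 = 1 := Units.ext Complex.exp_zero

theorem IsToeplitzLift.hasCommutatorDet_one {R : Type*} [Ring R] {T : symbolAlgebra → R}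
    (hT : IsToeplitzLift T) (D : Subgroup (StableGL R × ℂˣ)) {f g : symbolAlgebra}
    (hf : IsTriangular f) (hg : IsTriangular g)
    (h : ((f : C(AddCircle (2 * Real.pi), ℂ)) ∈ preserve hardySpace
        ∧ (g : C(AddCircle (2 * Real.pi), ℂ)) ∈ preserve hardySpace)
      ∨ ((f : C(AddCircle (2 * Real.pi), ℂ)) ∈ preserve hardySpaceᗮ
        ∧ (g : C(AddCircle (2 * Real.pi), ℂ)) ∈ preserve hardySpaceᗮ)) :
    HasCommutatorDet D (Units.map stabilize (diag12 (hT.expLift f hf)))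
      (Units.map stabilize (diag13 (hT.expLift g hg))) 1 :=
  hasCommutatorDet_one_of_commute (hT.expLift_commute hf hg h)

theorem hasCommutatorDet_expLift_one {f g : symbolAlgebra}
    (hf : IsTriangular f) (hg : IsTriangular g)
    (h : ((f : C(AddCircle (2 * Real.pi), ℂ)) ∈ preserve hardySpace
        ∧ (g : C(AddCircle (2 * Real.pi), ℂ)) ∈ preserve hardySpace)
      ∨ ((f : C(AddCircle (2 * Real.pi), ℂ)) ∈ preserve hardySpaceᗮ
        ∧ (g : C(AddCircle (2 * Real.pi), ℂ)) ∈ preserve hardySpaceᗮ)) :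
    HasCommutatorDet (detGraph hardySpace) (expLift12 f hf) (expLift13 g hg) 1 :=
  isToeplitzLift_toeplitzLift.hasCommutatorDet_one (detGraph hardySpace) hf hg h

theorem hasCommutatorDet_expLift_swap {f g : symbolAlgebra}
    (hf : IsTriangular f) (hg : IsTriangular g) {d : ℂˣ}
    (h : HasCommutatorDet (detGraph hardySpace) (expLift12 f hf) (expLift13 g hg) d) :
    HasCommutatorDet (detGraph hardySpace) (expLift12 g hg) (expLift13 f hf) d⁻¹ :=
  HasCommutatorDet.diag_swap (a := expUnit g hg) (b := expUnit f hf) h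

theorem cexpUnit_product (m n : ℤ) (a₁ a₂ b₁ b₂ c d : ℂ) :
    (((-1) ^ m) ^ n * (cexpUnit b₁)⁻¹ ^ m * (cexpUnit b₂)⁻¹ ^ m)
        * (cexpUnit a₁ ^ n * 1 * cexpUnit (-c)) * (cexpUnit a₂ ^ n * (cexpUnit (-d))⁻¹ * 1)
      = cexpUnit (Real.pi * Complex.I * m * n - m * (b₁ + b₂) + n * (a₁ + a₂) - c + d) := by
  rw [← cexpUnit_pi, ← cexpUnit_zero]
  simp only [cexpUnit_inv, cexpUnit_zpow, cexpUnit_mul]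
  congr 1
  ring

/-- The nine commutators of the factors: the sign from `z` and `z`, the means from `z` and exponentials,
the pairings from an analytic and an antianalytic exponential; exponentials of the same kind
commute. -/
theorem hasCommutatorDet_symbolLift (m n : ℤ) :
    HasCommutatorDet (detGraph hardySpace) (symbolLift12 hf₁ hf₂ m) (symbolLift13 hg₁ hg₂ n)
      (cexpUnit (Real.pi * Complex.I * m * n
        - m * (fourierCoeff (g₁ : C(AddCircle (2 * Real.pi), ℂ)) 0
          + fourierCoeff (g₂ : C(AddCircle (2 * Real.pi), ℂ)) 0)
        + n * (fourierCoeff (f₁ : C(AddCircle (2 * Real.pi), ℂ)) 0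
          + fourierCoeff (f₂ : C(AddCircle (2 * Real.pi), ℂ)) 0)
        - pairing f₁ g₂ + pairing g₁ f₂)) := by
  have hD := isDeterminantGraph_detGraph hardySpace
  have h := HasCommutatorDet.zpow_mul_mul hD hasCommutatorDet_lift12_lift13
    ((hasCommutatorDet_expLift13_lift12 (Or.inl hg₁)).symm hD)
    ((hasCommutatorDet_expLift13_lift12 (Or.inr hg₂)).symm hD)
    (hasCommutatorDet_expLift12_lift13 (Or.inl hf₁))
    (hasCommutatorDet_expLift_one (Or.inl hf₁) (Or.inl hg₁) (Or.inl ⟨hf₁, hg₁⟩))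
    (hasCommutatorDet_expLift12_expLift13 hf₁ hg₂)
    (hasCommutatorDet_expLift12_lift13 (Or.inr hf₂))
    (hasCommutatorDet_expLift_swap _ _ (hasCommutatorDet_expLift12_expLift13 hg₁ hf₂))
    (hasCommutatorDet_expLift_one (Or.inr hf₂) (Or.inr hg₂) (Or.inr ⟨hf₂, hg₂⟩)) m n
  rw [← cexpUnit_product]
  exact h

/-- The Connes–Karoubi character on the symbol of `z^m e^{f₁ + f₂}` and `z^n e^{g₁ + g₂}`. -/
theorem IsConnesKaroubiCharacter.apply_steinbergSymbol
    {ck : K₂ (universalModule hardySpace) →* ℂˣ} (hck : IsConnesKaroubiCharacter hardySpace ck)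
    (hf₁ : (f₁ : C(AddCircle (2 * Real.pi), ℂ)) ∈ preserve hardySpace)
    (hf₂ : (f₂ : C(AddCircle (2 * Real.pi), ℂ)) ∈ preserve hardySpaceᗮ)
    (hg₁ : (g₁ : C(AddCircle (2 * Real.pi), ℂ)) ∈ preserve hardySpace)
    (hg₂ : (g₂ : C(AddCircle (2 * Real.pi), ℂ)) ∈ preserve hardySpaceᗮ)
    {u v : SmoothCircleˣ} {m n : ℤ}
    (hu : Units.map (toSymbol : SmoothCircle →* symbolAlgebra) u
      = monomialUnit ^ m * expSymbolUnit (f₁ + f₂))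
    (hv : Units.map (toSymbol : SmoothCircle →* symbolAlgebra) v
      = monomialUnit ^ n * expSymbolUnit (g₁ + g₂)) :
    ck (K₂.map multiplicationModule (steinbergSymbol u v (Commute.all _ _)))
      = cexpUnit (Real.pi * Complex.I * m * n
        - m * (fourierCoeff (g₁ : C(AddCircle (2 * Real.pi), ℂ)) 0
          + fourierCoeff (g₂ : C(AddCircle (2 * Real.pi), ℂ)) 0)
        + n * (fourierCoeff (f₁ : C(AddCircle (2 * Real.pi), ℂ)) 0
          + fourierCoeff (f₂ : C(AddCircle (2 * Real.pi), ℂ)) 0)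
        - pairing f₁ g₂ + pairing g₁ f₂) := by
  have h01 : (0 : ℕ) ≠ 1 := by decide
  have h02 : (0 : ℕ) ≠ 2 := by decide
  exact hck.eq_of_commutator (coe_map_steinbergSymbol multiplicationModule u v h01 h02)
    ((map_symbolLift12 hf₁ hf₂ h01 m hu).trans (proj_map_h toSymbol multiplication h01 u))
    ((map_symbolLift13 hg₁ hg₂ h02 n hv).trans (proj_map_h toSymbol multiplication h02 v))
    (hasCommutatorDet_symbolLift hf₁ hf₂ hg₁ hg₂ m n)

end SymbolLift

/-! ### Smooth logarithms -/

section Logarithm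

open scoped ContDiff

open Real in
/-- A nowhere vanishing smooth `2π`-periodic function has a smooth logarithm, the primitive of its
logarithmic derivative, which is periodic up to a winding number. -/
theorem exists_smooth_log {P : ℝ → ℂ} (hP : ContDiff ℝ ∞ P) (hper : ∀ x, P (x + 2 * π) = P x)
    (h0 : ∀ x, P x ≠ 0) : ∃ (a : ℝ → ℂ) (m : ℤ), ContDiff ℝ ∞ a ∧ (∀ x, Complex.exp (a x) = P x) ∧
      ∀ x, a (x + 2 * π) = a x + m * (2 * π * Complex.I) := by
  have hd : ∀ x, HasDerivAt P (deriv P x) x := fun x =>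
    (hP.differentiable (by simp)).differentiableAt.hasDerivAt
  have hP' : ContDiff ℝ ∞ (deriv P) := (contDiff_infty_iff_deriv.1 hP).2
  have hL : ContDiff ℝ ∞ fun x => deriv P x / P x := by
    simp only [div_eq_mul_inv]
    exact hP'.mul (hP.inv h0)
  set a : ℝ → ℂ := fun x => Complex.log (P 0) + ∫ t in (0 : ℝ)..x, deriv P t / P t with ha
  have had : ∀ x, HasDerivAt a (deriv P x / P x) x := fun x =>
    (intervalIntegral.integral_hasDerivAt_right (hL.continuous.intervalIntegrable _ _)
      (hL.continuous.stronglyMeasurableAtFilter _ _) hL.continuous.continuousAt).const_add _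
  have hexp : ∀ x, Complex.exp (a x) = P x := by
    have h1 : ∀ x, HasDerivAt (fun x => Complex.exp (-a x) * P x) 0 x := fun x => by
      have h := (had x).neg.cexp.mul (hd x)
      have e : Complex.exp (-a x) * -(deriv P x / P x) * P x + Complex.exp (-a x) * deriv P x
          = 0 := by
        rw [mul_assoc, neg_mul, div_mul_cancel₀ _ (h0 x), mul_neg, neg_add_cancel]
      rw [← e]
      exact h
    intro x
    have h2 := is_const_of_deriv_eq_zero (fun x => (h1 x).differentiableAt)
      (fun x => (h1 x).deriv) x 0
    have h3 : Complex.exp (-a 0) * P 0 = 1 := by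
      simp only [ha, intervalIntegral.integral_same, add_zero]
      rw [Complex.exp_neg, Complex.exp_log (h0 0), inv_mul_cancel₀ (h0 0)]
    rw [h3, Complex.exp_neg] at h2
    exact (eq_of_inv_mul_eq_one h2)
  have hP'per : ∀ x, deriv P (x + 2 * π) = deriv P x := fun x => by
    rw [← deriv_comp_add_const P (2 * π) x, funext hper]
  have hconst : ∀ x, a (x + 2 * π) - a x = a (0 + 2 * π) - a 0 := fun x => by
    have h1 : ∀ x, HasDerivAt (fun x => a (x + 2 * π) - a x) 0 x := fun x => by
      have h := ((had (x + 2 * π)).comp_add_const x (2 * π)).sub (had x)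
      rw [hP'per, hper, sub_self] at h
      exact h
    exact is_const_of_deriv_eq_zero (fun x => (h1 x).differentiableAt) (fun x => (h1 x).deriv) x 0
  obtain ⟨m, hm⟩ : ∃ m : ℤ, a (0 + 2 * π) = a 0 + m * (2 * π * Complex.I) :=
    Complex.exp_eq_exp_iff_exists_int.1 (by rw [hexp, hexp, hper])
  refine ⟨a, m, ?_, hexp, fun x => ?_⟩
  · rw [contDiff_infty_iff_deriv]
    refine ⟨fun x => (had x).differentiableAt, ?_⟩
    rw [funext fun x => (had x).deriv]
    exact hL
  · rw [← sub_eq_iff_eq_add', hconst, hm, add_sub_cancel_left]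

end Logarithm

/-! ### Factorization of smooth functions -/

section Periodic

open MeasureTheory Real AddCircle
open scoped ContDiff Manifold

theorem exists_symbol_of_periodic {f : ℝ → ℂ} (hf : ContDiff ℝ ∞ f)
    (hper : Function.Periodic f (2 * π)) :
    ∃ φ : symbolAlgebra, ∀ x : ℝ, (φ : C(AddCircle (2 * π), ℂ)) x = f x :=
  ⟨⟨⟨hper.lift, continuous_coinduced_dom.2 hf.continuous⟩, contDiff_infty.1 hf 2⟩, fun _ => rfl⟩

theorem fourierCoeff_deriv {φ ψ : symbolAlgebra} {f : ℝ → ℂ} (hf : ContDiff ℝ ∞ f)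
    (hper : Function.Periodic f (2 * π))
    (hφ : ∀ x : ℝ, (φ : C(AddCircle (2 * π), ℂ)) x = f x)
    (hψ : ∀ x : ℝ, (ψ : C(AddCircle (2 * π), ℂ)) x = deriv f x) (n : ℤ) :
    fourierCoeff (ψ : C(AddCircle (2 * π), ℂ)) n
      = n * Complex.I * fourierCoeff (φ : C(AddCircle (2 * π), ℂ)) n := by
  have h := integral_fourier_deriv
    (fun x => (hf.differentiable (by simp)).differentiableAt.hasDerivAt)
    (contDiff_infty_iff_deriv.1 hf).2.continuous (by simpa using hper 0) n
  rw [fourierCoeff_eq_integral_exp, fourierCoeff_eq_integral_exp]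
  simp only [hφ, hψ]
  rw [h, mul_smul_comm]

theorem periodic_deriv {f : ℝ → ℂ} {c : ℝ} (hper : Function.Periodic f c) :
    Function.Periodic (deriv f) c := fun x => by
  rw [← deriv_comp_add_const f c x, funext hper]

/-- Quartic decay of the Fourier coefficients: quadratic decay for the second derivative. -/
theorem exists_symbol_of_smooth {f : ℝ → ℂ} (hf : ContDiff ℝ ∞ f)
    (hper : Function.Periodic f (2 * π)) :
    ∃ (φ : symbolAlgebra) (C : ℝ), (∀ x : ℝ, (φ : C(AddCircle (2 * π), ℂ)) x = f x) ∧
      ∀ n : ℤ, (n : ℝ) ^ 4 * ‖fourierCoeff (φ : C(AddCircle (2 * π), ℂ)) n‖ ≤ C := by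
  have hf1 := (contDiff_infty_iff_deriv.1 hf).2
  have hf2 := (contDiff_infty_iff_deriv.1 hf1).2
  have hper1 := periodic_deriv hper
  obtain ⟨φ, hφ⟩ := exists_symbol_of_periodic hf hper
  obtain ⟨φ', hφ'⟩ := exists_symbol_of_periodic hf1 hper1
  obtain ⟨φ'', hφ''⟩ := exists_symbol_of_periodic hf2 (periodic_deriv hper1)
  obtain ⟨C, hC⟩ := fourierCoeff_decay (φ'' : C(AddCircle (2 * π), ℂ)) φ''.2
  refine ⟨φ, C, hφ, fun n => (le_of_eq ?_).trans (hC n)⟩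
  rw [fourierCoeff_deriv hf1 hper1 hφ' hφ'', fourierCoeff_deriv hf hper hφ hφ', norm_mul, norm_mul,
    norm_mul, norm_mul, Complex.norm_I, Complex.norm_intCast, mul_one, ← mul_assoc, ← mul_assoc,
    ← sq_abs (n : ℝ)]
  have : (n : ℝ) ^ 4 = |(n : ℝ)| ^ 4 := by rw [← abs_pow, abs_of_nonneg (by positivity)]
  rw [this]
  ring

theorem SmoothCircle.contDiff_infty (p : SmoothCircle) :
    ContDiff ℝ ∞ fun x : ℝ => p (Circle.exp x) :=
  (p.contMDiff.comp contMDiff_circleExp).contDiff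

/-- A nowhere vanishing smooth function on the circle is `z^m e^{φ₁ + φ₂}` with symbols `φ₁` without
negative and `φ₂` without positive frequencies; here `m` is its winding number. -/
theorem exists_factorization (p : SmoothCircle) (hp : ∀ x, p x ≠ 0) :
    ∃ (a : ℝ → ℂ) (m : ℤ) (φ₁ φ₂ : symbolAlgebra), ContDiff ℝ ∞ a ∧
      (∀ x : ℝ, Complex.exp (a x) = p (Circle.exp x)) ∧
      (∀ x : ℝ, ((φ₁ + φ₂ : symbolAlgebra) : C(AddCircle (2 * π), ℂ)) x
        = a x - m * Complex.I * x) ∧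
      (∀ n : ℤ, n < 0 → fourierCoeff (φ₁ : C(AddCircle (2 * π), ℂ)) n = 0) ∧
      (∀ n : ℤ, 0 < n → fourierCoeff (φ₂ : C(AddCircle (2 * π), ℂ)) n = 0) ∧
      Units.map (toSymbol : SmoothCircle →* symbolAlgebra) (p.unit hp)
        = monomialUnit ^ m * expSymbolUnit (φ₁ + φ₂) := by
  obtain ⟨a, m, ha, hexp, hm⟩ := exists_smooth_log p.contDiff_infty
    (fun x => by rw [Circle.exp_add, Circle.exp_two_pi, mul_one]) (fun x => hp _)
  have hf : ContDiff ℝ ∞ fun x : ℝ => a x - m * Complex.I * x :=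
    ha.sub (contDiff_const.mul Complex.ofRealCLM.contDiff)
  obtain ⟨φ, C, hφ, hC⟩ := exists_symbol_of_smooth hf fun x => by
    simp only [hm]
    push_cast
    ring
  obtain ⟨φ₁, φ₂, rfl, h1, h2⟩ := exists_decomposition hC
  refine ⟨a, m, φ₁, φ₂, ha, hexp, hφ, fun n hn => by rw [h1, if_neg (by omega)],
    fun n hn => by rw [h2, if_neg (by omega)], ?_⟩
  apply Units.ext
  rw [Units.val_mul, monomialUnit_zpow]
  refine Subtype.ext (ContinuousMap.ext fun t => ?_)
  obtain ⟨x, rfl⟩ := QuotientAddGroup.mk_surjective t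
  change p (AddCircle.toCircle (x : AddCircle (2 * π))) = fourier m (x : AddCircle (2 * π))
    * NormedSpace.exp ((φ₁ + φ₂ : symbolAlgebra) : C(AddCircle (2 * π), ℂ)) x
  rw [exp_continuousMap_apply, hφ, fourier_coe_eq, ← Complex.exp_add,
    AddCircle.toCircle_apply_mk, div_self Real.two_pi_pos.ne', one_mul, ← hexp]
  congr 1
  ring

end Periodic

/-! ### Branches of the logarithm -/

section Branch

open MeasureTheory Real

/-- Two continuous branches of the logarithm on an interval differ by a constant. -/
theorem IsLogBranch.exists_eq_add {p : SmoothCircle} {a a' : ℝ → ℂ} (h : IsLogBranch p a)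
    (h' : IsLogBranch p a') :
    ∃ k : ℤ, ∀ x ∈ Set.Icc 0 (2 * π), a' x = a x + k * (2 * π * Complex.I) := by
  have h1 : ∀ x ∈ Set.Icc 0 (2 * π), ∃ k : ℤ, a' x = a x + k * (2 * π * Complex.I) := fun x hx =>
    Complex.exp_eq_exp_iff_exists_int.1 ((h'.2 x hx).trans (h.2 x hx).symm)
  -- the difference divided by `2πi` is continuous with integral values
  have hc : ContinuousOn (fun x => ((a' x - a x) / (2 * π * Complex.I)).re) (Set.Icc 0 (2 * π)) :=
    Complex.continuous_re.comp_continuousOn ((h'.1.sub h.1).div_const _)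
  have hk : ∀ (x : ℝ) (k : ℤ), a' x = a x + k * (2 * π * Complex.I) →
      ((a' x - a x) / (2 * π * Complex.I)).re = k := fun x k hx => by
    rw [hx, add_sub_cancel_left, mul_div_cancel_right₀ _ Complex.two_pi_I_ne_zero]
    simp
  have h0 : (0 : ℝ) ∈ Set.Icc 0 (2 * π) := ⟨le_rfl, Real.two_pi_pos.le⟩
  obtain ⟨k, hk0⟩ := h1 0 h0
  refine ⟨k, fun x hx => ?_⟩
  obtain ⟨l, hl⟩ := h1 x hx
  have h2 := isPreconnected_Icc.constant_of_mapsTo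
    (T := Set.range ((↑) : ℤ → ℝ)) Int.isClosedEmbedding_coe_real.isEmbedding.isDiscrete_range hc
    (fun y hy => by
      obtain ⟨j, hj⟩ := h1 y hy
      exact ⟨j, (hk y j hj).symm⟩) hx h0
  rw [hk x l hl, hk 0 k hk0] at h2
  rw [hl, Int.cast_injective h2]

/-- Only the open interval matters: the branches are unconstrained outside `[0, 2π]`, so `deriv b'` may
have junk values at the endpoints. -/
theorem integral_mul_deriv_branch {a b a' b' : ℝ → ℂ} {k l : ℂ}
    (ha' : ∀ x ∈ Set.Icc 0 (2 * π), a' x = a x + k)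
    (hb' : ∀ x ∈ Set.Icc 0 (2 * π), b' x = b x + l) :
    ∫ x in (0 : ℝ)..2 * π, a' x * deriv b' x = ∫ x in (0 : ℝ)..2 * π, (a x + k) * deriv b x := by
  refine intervalIntegral.integral_congr_Ioo_of_le Real.two_pi_pos.le fun x hx => ?_
  have h1 : b' =ᶠ[𝓝 x] fun x => b x + l := by
    filter_upwards [Ioo_mem_nhds hx.1 hx.2] with y hy using hb' y (Set.Ioo_subset_Icc_self hy)
  have h2 := h1.deriv_eq
  rw [deriv_add_const] at h2
  simp only [ha' x (Set.Ioo_subset_Icc_self hx), h2]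

theorem integral_deriv_branch {b b' : ℝ → ℂ} {l : ℂ} (hb : Differentiable ℝ b)
    (hc : Continuous (deriv b))
    (hb' : ∀ x ∈ Set.Icc 0 (2 * π), b' x = b x + l) :
    ∫ x in (0 : ℝ)..2 * π, deriv b' x = b (2 * π) - b 0 := by
  have h := integral_mul_deriv_branch (a := 0) (a' := 1) (k := 1) (fun x _ => by simp) hb'
  simp only [Pi.one_apply, one_mul, Pi.zero_apply, zero_add] at h
  rw [h]
  exact intervalIntegral.integral_deriv_eq_sub (fun x _ => hb x) (hc.intervalIntegrable _ _)

/-- Integration of `log p d log q` for `log p = f + c + i m θ` and `log q = g + i n θ`. -/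
theorem integral_linear_add {f g g' : ℝ → ℂ} (hf : Continuous f)
    (hg : ∀ x, HasDerivAt g (g' x) x) (hg' : Continuous g') (hper : g (2 * π) = g 0) (m n c : ℂ) :
    ∫ x in (0 : ℝ)..2 * π, (f x + m * x + c) * (g' x + n)
      = (∫ x in (0 : ℝ)..2 * π, f x * g' x) + n * (∫ x in (0 : ℝ)..2 * π, f x)
        + m * (2 * π * g 0 - ∫ x in (0 : ℝ)..2 * π, g x) + m * n * (2 * π ^ 2) + c * n * (2 * π) := by
  have hgc : Continuous g := continuous_iff_continuousAt.2 fun x => (hg x).continuousAt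
  have e : ∀ x : ℝ, (f x + m * x + c) * (g' x + n)
      = f x * g' x + n * f x + m * (x * g' x) + m * n * x + (c * g' x + c * n) := fun x => by ring
  have hx := intervalIntegral.integral_mul_deriv_eq_deriv_mul (a := 0) (b := 2 * π)
    (u := fun x : ℝ => (x : ℂ)) (u' := fun _ => 1) (v := g) (v' := g')
    (fun x _ => (hasDerivAt_id x).ofReal_comp) (fun x _ => hg x)
    (continuous_const.intervalIntegrable _ _) (hg'.intervalIntegrable _ _)
  have hx' : ∫ x in (0 : ℝ)..2 * π, g' x = 0 := by
    rw [intervalIntegral.integral_eq_sub_of_hasDerivAt (fun x _ => hg x)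
      (hg'.intervalIntegrable _ _), hper, sub_self]
  have hx'' : ∫ x in (0 : ℝ)..2 * π, (x : ℂ) = 2 * π ^ 2 := by
    rw [intervalIntegral.integral_ofReal, integral_id]
    push_cast
    ring
  simp only [e]
  rw [intervalIntegral.integral_add, intervalIntegral.integral_add, intervalIntegral.integral_add,
    intervalIntegral.integral_add, intervalIntegral.integral_add,
    intervalIntegral.integral_const_mul, intervalIntegral.integral_const_mul,
    intervalIntegral.integral_const_mul, intervalIntegral.integral_const_mul,
    intervalIntegral.integral_const, hx, hx', hx'', hper]
  · simp only [one_mul, Complex.real_smul]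
    push_cast
    ring
  all_goals
    apply Continuous.intervalIntegrable
    fun_prop

end Branch

/-! ### The integral formula -/

section Formula

open MeasureTheory Real

/-- The exponent of the integral formula for arbitrary branches `a'` and `b'`, in terms of the smooth
logarithms `a = φ + i m θ` and `b = γ + i n θ`. Changing the branches adds an integral multiple of
`2πi`, because the winding numbers `m` and `n` are integers. -/
theorem log_integral_eq {a b a' b' : ℝ → ℂ} {m n k l : ℤ} {φ γ : symbolAlgebra}
    (ha : Differentiable ℝ a) (ha1 : Continuous (deriv a)) (hb : Differentiable ℝ b)
    (hb1 : Continuous (deriv b))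
    (hφ : ∀ x : ℝ, (φ : C(AddCircle (2 * π), ℂ)) x = a x - m * Complex.I * x)
    (hγ : ∀ x : ℝ, (γ : C(AddCircle (2 * π), ℂ)) x = b x - n * Complex.I * x)
    (ha' : ∀ x ∈ Set.Icc 0 (2 * π), a' x = a x + k * (2 * π * Complex.I))
    (hb' : ∀ x ∈ Set.Icc 0 (2 * π), b' x = b x + l * (2 * π * Complex.I)) :
    1 / (2 * π * Complex.I) * ((∫ x in (0 : ℝ)..2 * π, a' x * deriv b' x)
        - b' 0 * ∫ x in (0 : ℝ)..2 * π, deriv a' x)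
      = π * Complex.I * m * n - m * fourierCoeff (γ : C(AddCircle (2 * π), ℂ)) 0
        + n * fourierCoeff (φ : C(AddCircle (2 * π), ℂ)) 0 - pairing φ γ + pairing γ φ
        + ((k * n - l * m : ℤ) : ℂ) * (2 * π * Complex.I) := by
  have hπ : (π : ℂ) ≠ 0 := by exact_mod_cast Real.pi_ne_zero
  have hmean : ∀ ψ : symbolAlgebra, (∫ x in (0 : ℝ)..2 * π, (ψ : C(AddCircle (2 * π), ℂ)) x)
      = 2 * π * fourierCoeff (ψ : C(AddCircle (2 * π), ℂ)) 0 := fun ψ => by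
    rw [fourierCoeff_eq_integral_exp, Complex.real_smul]
    simp only [Int.cast_zero, zero_mul, neg_zero, Complex.exp_zero, one_mul]
    push_cast
    field_simp
  have hcont : ∀ ψ : symbolAlgebra, Continuous fun x : ℝ => (ψ : C(AddCircle (2 * π), ℂ)) x :=
    fun ψ => ψ.1.continuous.comp (AddCircle.continuous_mk' _)
  have hper : ∀ ψ : symbolAlgebra, (ψ : C(AddCircle (2 * π), ℂ)) ((2 * π : ℝ) : AddCircle (2 * π))
      = (ψ : C(AddCircle (2 * π), ℂ)) ((0 : ℝ) : AddCircle (2 * π)) := fun ψ => by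
    rw [AddCircle.coe_period, AddCircle.coe_zero]
  have hγd : ∀ x : ℝ, HasDerivAt (fun x : ℝ => (γ : C(AddCircle (2 * π), ℂ)) x)
      (deriv b x - n * Complex.I) x := fun x => by
    simp only [hγ]
    have h := (hb x).hasDerivAt.sub ((hasDerivAt_id x).ofReal_comp.const_mul (n * Complex.I))
    rw [Complex.ofReal_one, mul_one] at h
    exact h
  have h1 := integral_mul_deriv_branch ha' hb'
  have h2 := integral_deriv_branch ha ha1 ha'
  have h3 := integral_linear_add (hcont φ) hγd (hb1.sub continuous_const) (hper γ)
    (m * Complex.I) (n * Complex.I) (k * (2 * π * Complex.I))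
  have h4 := integral_mul_deriv_eq φ γ (fun _ => rfl) hγd (hb1.sub continuous_const)
  have h5 : a (2 * π) - a 0 = m * Complex.I * (2 * π) := by
    have h6 := hper φ
    rw [hφ, hφ] at h6
    push_cast at h6
    linear_combination h6
  have h7 : b' 0 = (γ : C(AddCircle (2 * π), ℂ)) ((0 : ℝ) : AddCircle (2 * π))
      + l * (2 * π * Complex.I) := by
    rw [hb' 0 ⟨le_rfl, Real.two_pi_pos.le⟩, hγ]
    simp
  have h8 : (∫ x in (0 : ℝ)..2 * π, (a x + k * (2 * π * Complex.I)) * deriv b x)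
      = ∫ x in (0 : ℝ)..2 * π, ((φ : C(AddCircle (2 * π), ℂ)) x + m * Complex.I * x
        + k * (2 * π * Complex.I)) * (deriv b x - n * Complex.I + n * Complex.I) := by
    congr 1
    ext x
    rw [hφ]
    ring
  rw [h1, h8, h3, h4, hmean, hmean, h2, h5, h7]
  field_simp
  push_cast
  ring_nf

variable {φ₁ φ₂ γ₁ γ₂ : symbolAlgebra}

theorem fourierCoeff_add (ψ₁ ψ₂ : symbolAlgebra) (j : ℤ) :
    fourierCoeff ((ψ₁ + ψ₂ : symbolAlgebra) : C(AddCircle (2 * π), ℂ)) j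
      = fourierCoeff (ψ₁ : C(AddCircle (2 * π), ℂ)) j
        + fourierCoeff (ψ₂ : C(AddCircle (2 * π), ℂ)) j := by
  rw [← coefficient_apply, ← coefficient_apply, ← coefficient_apply]
  exact map_add (coefficient j) _ _

theorem pairing_add (hφ₂ : ∀ n : ℤ, 0 < n → fourierCoeff (φ₂ : C(AddCircle (2 * π), ℂ)) n = 0)
    (hγ₁ : ∀ n : ℤ, n < 0 → fourierCoeff (γ₁ : C(AddCircle (2 * π), ℂ)) n = 0) :
    pairing ((φ₁ + φ₂ : symbolAlgebra) : C(AddCircle (2 * π), ℂ))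
      ((γ₁ + γ₂ : symbolAlgebra) : C(AddCircle (2 * π), ℂ)) = pairing φ₁ γ₂ :=
  pairing_congr (fun j hj => by rw [fourierCoeff_add, hφ₂ j hj, add_zero])
    fun j hj => by rw [fourierCoeff_add, hγ₁ j hj, zero_add]

theorem apply_symbol_eq_exp {c : ℂˣ} {m n : ℤ} {z : ℂ} {k : ℤ}
    (hφ₁ : ∀ n : ℤ, n < 0 → fourierCoeff (φ₁ : C(AddCircle (2 * π), ℂ)) n = 0)
    (hφ₂ : ∀ n : ℤ, 0 < n → fourierCoeff (φ₂ : C(AddCircle (2 * π), ℂ)) n = 0)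
    (hγ₁ : ∀ n : ℤ, n < 0 → fourierCoeff (γ₁ : C(AddCircle (2 * π), ℂ)) n = 0)
    (hγ₂ : ∀ n : ℤ, 0 < n → fourierCoeff (γ₂ : C(AddCircle (2 * π), ℂ)) n = 0)
    (hc : c = cexpUnit (Real.pi * Complex.I * m * n
        - m * (fourierCoeff (γ₁ : C(AddCircle (2 * Real.pi), ℂ)) 0
          + fourierCoeff (γ₂ : C(AddCircle (2 * Real.pi), ℂ)) 0)
        + n * (fourierCoeff (φ₁ : C(AddCircle (2 * Real.pi), ℂ)) 0
          + fourierCoeff (φ₂ : C(AddCircle (2 * Real.pi), ℂ)) 0)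
        - pairing φ₁ γ₂ + pairing γ₁ φ₂))
    (hz : z = π * Complex.I * m * n
        - m * fourierCoeff ((γ₁ + γ₂ : symbolAlgebra) : C(AddCircle (2 * π), ℂ)) 0
        + n * fourierCoeff ((φ₁ + φ₂ : symbolAlgebra) : C(AddCircle (2 * π), ℂ)) 0
        - pairing ((φ₁ + φ₂ : symbolAlgebra) : C(AddCircle (2 * π), ℂ))
          ((γ₁ + γ₂ : symbolAlgebra) : C(AddCircle (2 * π), ℂ))
        + pairing ((γ₁ + γ₂ : symbolAlgebra) : C(AddCircle (2 * π), ℂ))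
          ((φ₁ + φ₂ : symbolAlgebra) : C(AddCircle (2 * π), ℂ))
        + k * (2 * π * Complex.I)) : (c : ℂ) = Complex.exp z := by
  rw [hc, hz, Complex.exp_add, Complex.exp_int_mul_two_pi_mul_I, mul_one, pairing_add hφ₂ hγ₁,
    pairing_add hγ₂ hφ₁, fourierCoeff_add, fourierCoeff_add, cexpUnit_val]

/-- The exponents in `IsConnesKaroubiCharacter.apply_steinbergSymbol` and in `log_integral_eq` agree up
to an integral multiple of `2πi`. -/
theorem IsConnesKaroubiCharacter.formula {ck : K₂ (universalModule hardySpace) →* ℂˣ}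
    (hck : IsConnesKaroubiCharacter hardySpace ck) (p q : SmoothCircle) (hp : ∀ x, p x ≠ 0)
    (hq : ∀ x, q x ≠ 0) :
    (∃ a, IsLogBranch p a) ∧ (∃ b, IsLogBranch q b) ∧
      ∀ a b : ℝ → ℂ, IsLogBranch p a → IsLogBranch q b →
        ((ck.comp (K₂.map multiplicationModule)
            (steinbergSymbol (p.unit hp) (q.unit hq) (Commute.all _ _)) : ℂˣ) : ℂ) =
          Complex.exp (1 / (2 * Real.pi * Complex.I) *
            ((∫ θ in (0 : ℝ)..2 * Real.pi, a θ * deriv b θ)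
              - b 0 * ∫ θ in (0 : ℝ)..2 * Real.pi, deriv a θ)) := by
  obtain ⟨a, m, φ₁, φ₂, ha, hae, hφ, hφ₁, hφ₂, hu⟩ := exists_factorization p hp
  obtain ⟨b, n, γ₁, γ₂, hb, hbe, hγ, hγ₁, hγ₂, hv⟩ := exists_factorization q hq
  have hpa : IsLogBranch p a := ⟨ha.continuous.continuousOn, fun θ _ => hae θ⟩
  have hqb : IsLogBranch q b := ⟨hb.continuous.continuousOn, fun θ _ => hbe θ⟩
  refine ⟨⟨a, hpa⟩, ⟨b, hqb⟩, fun a' b' ha' hb' => ?_⟩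
  obtain ⟨k, hk⟩ := hpa.exists_eq_add ha'
  obtain ⟨l, hl⟩ := hqb.exists_eq_add hb'
  have ha2 := contDiff_infty_iff_deriv.1 ha
  have hb2 := contDiff_infty_iff_deriv.1 hb
  exact apply_symbol_eq_exp hφ₁ hφ₂ hγ₁ hγ₂ (hck.apply_steinbergSymbol
    (mem_preserve_hardySpace hφ₁) (mem_preserve_orthogonal hφ₂) (mem_preserve_hardySpace hγ₁)
    (mem_preserve_orthogonal hγ₂) hu hv)
    (log_integral_eq ha2.1 ha2.2.continuous hb2.1 hb2.2.continuous hφ hγ hk hl)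

end Formula

end ConnesKaroubi

end

theorem mainTheorem2 :
    ∃ ck : K₂ (universalModule hardySpace) →* ℂˣ,
      IsConnesKaroubiCharacter hardySpace ck ∧
      (∀ ck', IsConnesKaroubiCharacter hardySpace ck' → ck' = ck) ∧
      ∀ (p q : SmoothCircle) (hp : ∀ x, p x ≠ 0) (hq : ∀ x, q x ≠ 0),
        (∃ a, IsLogBranch p a) ∧ (∃ b, IsLogBranch q b) ∧
        ∀ a b : ℝ → ℂ, IsLogBranch p a → IsLogBranch q b →
          ((ck.comp (K₂.map multiplicationModule)
              (steinbergSymbol (p.unit hp) (q.unit hq) (Commute.all _ _)) : ℂˣ) : ℂ) =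
            Complex.exp (1 / (2 * Real.pi * Complex.I) *
              ((∫ θ in (0 : ℝ)..2 * Real.pi, a θ * deriv b θ)
                - b 0 * ∫ θ in (0 : ℝ)..2 * Real.pi, deriv a θ)) := by
  obtain ⟨ck, hck⟩ := exists_isConnesKaroubiCharacter hardySpace
  exact ⟨ck, hck, fun ck' h => h.eq hck, hck.formula⟩
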